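/- Let $d\ge 1$, $T>0$, $H\in[1/2,1)$, and let $X=(X_t)_{t\ge0}$ be a $d$-dimensional fractional Brownian motion with Hurst parameter $H$ on a probability space $(\Omega,\mathcal F,P)$: its components are independent, centred real Gaussian processes with a.s. continuous paths and covariance $\tfrac12\left(s^{2H}+t^{2H}-|s-t|^{2H}\right)$. For $\varphi\in C_0^\infty(\mathbb R^d;\mathbb R^d)$ (smooth with compact support) let $$I^-_\varepsilon(\varphi)=\int_0^T\Big\langle \varphi(X_t),\frac{X_{t+\varepsilon}-X_t}{\varepsilon}\Big\rangle\,dt,\qquad \varepsilon>0 .$$ For $s\in\mathbb R$ let $H_2^{s}(\mathbb R^d)$ be the Sobolev space of tempered (real) distributional fields $f$ on $\mathbb R^d$ with values in $\mathbb R^d$ such that $(1-\Delta)^{s/2}f\in L^2$, normed by $\|(1-\Delta)^{s/2}f\|_{L^2}$; the dual of $H_2^{\alpha}(\mathbb R^d)$ is identified with $H_2^{-\alpha}(\mathbb R^d)$ through the distributional pairing. Then for every $\varphi\in C_0^\infty(\mathbb R^d;\mathbb R^d)$ the forward integral $I^-(\varphi)=\int_0^T\langle\varphi(X_t),d^-X_t\rangle$,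 i.e. the limit in probability of $I^-_\varepsilon(\varphi)$ as $\varepsilon\to0^+$, exists; and for every $\alpha>\alpha_H:=\frac d2-1+\frac1{2H}$ the family $I^-$ admits a pathwise redefinition with values in $H_2^{-\alpha}(\mathbb R^d)$: there is a Borel measurable map $\xi:\Omega\to \left(H_2^{\alpha}(\mathbb R^d)\right)'=H_2^{-\alpha}(\mathbb R^d)$ such that, for every $\varphi\in C_0^\infty(\mathbb R^d;\mathbb R^d)$, $$I^-(\varphi)(\omega)=\xi(\omega)(\varphi)\qquad\text{for } P\text{-a.e. }\omega\in\Omega .$$ -/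

import Mathlib

open MeasureTheory ProbabilityTheory Filter Topology
open scoped NNReal SchwartzMap

noncomputable section

namespace FBMCurrent

/-! ### Fractional Brownian motion -/

/-- A real fractional Brownian motion `(B_t)_{t ≥ 0}` with Hurst parameter `H`: a centred Gaussian
process with covariance `(s ^ (2H) + t ^ (2H) - |s - t| ^ (2H)) / 2` and almost surely continuous
paths. -/
structure IsFBMReal {Ω : Type*} [MeasurableSpace Ω] (H : ℝ) (B : ℝ≥0 → Ω → ℝ)
    (P : Measure Ω) : Prop where
  measurable : ∀ t, Measurable (B t)
  gaussian : IsGaussianProcess B P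
  mean : ∀ t, P[B t] = 0
  covariance : ∀ s t : ℝ≥0, cov[B s, B t; P] =
    1 / 2 * ((s : ℝ) ^ (2 * H) + (t : ℝ) ^ (2 * H) - |(s : ℝ) - (t : ℝ)| ^ (2 * H))
  continuous_paths : ∀ᵐ ω ∂P, Continuous (fun t ↦ B t ω)

/-- A `d`-dimensional fractional Brownian motion with Hurst parameter `H`: its components are
independent real fractional Brownian motions with Hurst parameter `H`. -/
structure IsFBM {Ω : Type*} [MeasurableSpace Ω] {d : ℕ} (H : ℝ)
    (X : ℝ≥0 → Ω → EuclideanSpace ℝ (Fin d)) (P : Measure Ω) : Prop where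
  component : ∀ i : Fin d, IsFBMReal H (fun t ω ↦ X t ω i) P
  indep : iIndepFun (fun (i : Fin d) (ω : Ω) (t : ℝ≥0) ↦ X t ω i) P

/-! ### The forward integral via regularization -/

/-- The regularized forward integral
`I⁻_ε(φ) = ∫₀ᵀ ⟨φ(X_t), (X_{t+ε} - X_t) / ε⟩ dt`. -/
def forwardApprox {Ω : Type*} {d : ℕ} (X : ℝ≥0 → Ω → EuclideanSpace ℝ (Fin d)) (T ε : ℝ)
    (φ : EuclideanSpace ℝ (Fin d) → EuclideanSpace ℝ (Fin d)) (ω : Ω) : ℝ :=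
  ∫ t in (0 : ℝ)..T, inner ℝ (φ (X t.toNNReal ω))
    (ε⁻¹ • (X (t + ε).toNNReal ω - X t.toNNReal ω))

/-- The random variable `Y` is (a version of) the forward integral
`I⁻(φ) = ∫₀ᵀ ⟨φ(X_t), d⁻X_t⟩`, i.e. the limit in probability of `I⁻_ε(φ)` as `ε → 0+`. -/
def IsForwardIntegral {Ω : Type*} [MeasurableSpace Ω] {d : ℕ} (P : Measure Ω)
    (X : ℝ≥0 → Ω → EuclideanSpace ℝ (Fin d)) (T : ℝ)
    (φ : EuclideanSpace ℝ (Fin d) → EuclideanSpace ℝ (Fin d)) (Y : Ω → ℝ) : Prop :=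
  AEMeasurable Y P ∧ TendstoInMeasure P (fun ε : ℝ ↦ forwardApprox X T ε φ) (𝓝[>] 0) Y

/-! ### The Sobolev spaces `H_2^s(ℝ^d)` of real vector fields -/

/-- Tempered distributional fields on `ℝ^d` with values in `ℂ^d`. -/
abbrev DistField (d : ℕ) : Type :=
  𝓢'(EuclideanSpace ℝ (Fin d), EuclideanSpace ℂ (Fin d))

/-- A distributional field is real if all its components take real values on real test
functions. -/
def IsRealField {d : ℕ} (f : DistField d) : Prop :=
  ∀ g : 𝓢(EuclideanSpace ℝ (Fin d), ℂ), (∀ x, (g x).im = 0) → ∀ i, (f g i).im = 0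

/-- The real distributional fields `f` such that `(1 - Δ) ^ (s / 2) f` is in `L²`, as a real vector
space. -/
def sobolevSubmodule (d : ℕ) (s : ℝ) : Submodule ℝ (DistField d) where
  carrier := {f | TemperedDistribution.MemSobolev s 2 f ∧ IsRealField f}
  zero_mem' := ⟨TemperedDistribution.memSobolev_fun_zero _ _ s 2, fun g _ i ↦ by simp⟩
  add_mem' := fun {f f'} hf hf' ↦ ⟨hf.1.add hf'.1, fun g hg i ↦ by
    simp [hf.2 g hg i, hf'.2 g hg i]⟩
  smul_mem' := fun c f hf ↦ ⟨by
    have h := hf.1.smul (c : ℂ)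
    rwa [Complex.coe_smul] at h, fun g hg i ↦ by simp [hf.2 g hg i]⟩

/-- The Sobolev space `H_2^s(ℝ^d)` of real vector fields, with the norm (up to equivalence)
`‖f‖ = ‖(1 - Δ) ^ (s / 2) f‖_{L²}` defined below. (It is a type synonym, so that it does not carry
the topology of tempered distributions.) -/
def SobolevField (d : ℕ) (s : ℝ) : Type := sobolevSubmodule d s

namespace SobolevField

variable {d : ℕ} {s : ℝ}

instance : AddCommGroup (SobolevField d s) := inferInstanceAs (AddCommGroup (sobolevSubmodule d s))

instance : Module ℝ (SobolevField d s) := inferInstanceAs (Module ℝ (sobolevSubmodule d s))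

/-- The tempered distribution underlying an element of `H_2^s`. -/
def toDist : SobolevField d s →ₗ[ℝ] DistField d := (sobolevSubmodule d s).subtype

theorem memSobolev (f : SobolevField d s) : TemperedDistribution.MemSobolev s 2 f.toDist := f.2.1

/-- The map `f ↦ (1 - Δ) ^ (s / 2) f` from `H_2^s` to `L²`. As everywhere in Mathlib, `Δ` is scaled
by `(2π) ^ (-2)` here, which gives the same space with an equivalent norm. -/
def besselFun (f : SobolevField d s) :
    Lp (EuclideanSpace ℂ (Fin d)) 2 (volume : Measure (EuclideanSpace ℝ (Fin d))) :=
  f.memSobolev.choose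

theorem besselFun_spec (f : SobolevField d s) :
    TemperedDistribution.besselPotential _ _ s f.toDist =
      Lp.toTemperedDistributionCLM (EuclideanSpace ℂ (Fin d))
        (volume : Measure (EuclideanSpace ℝ (Fin d))) 2 f.besselFun :=
  f.memSobolev.choose_spec

theorem toTemperedDistributionCLM_injective :
    Function.Injective (Lp.toTemperedDistributionCLM (EuclideanSpace ℂ (Fin d))
        (volume : Measure (EuclideanSpace ℝ (Fin d))) 2) :=
  LinearMap.ker_eq_bot.1 Lp.ker_toTemperedDistributionCLM_eq_bot

/-- `besselFun` as a linear map. -/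
def bessel (d : ℕ) (s : ℝ) : SobolevField d s →ₗ[ℝ]
    Lp (EuclideanSpace ℂ (Fin d)) 2 (volume : Measure (EuclideanSpace ℝ (Fin d))) where
  toFun := besselFun
  map_add' f g := toTemperedDistributionCLM_injective <| by
    rw [← besselFun_spec, map_add, map_add, map_add, besselFun_spec, besselFun_spec]
  map_smul' c f := toTemperedDistributionCLM_injective <| by
    rw [← besselFun_spec, map_smul, RingHom.id_apply, ContinuousLinearMap.map_smul_of_tower,
      ContinuousLinearMap.map_smul_of_tower, besselFun_spec]

theorem bessel_injective : Function.Injective (bessel d s) := by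
  intro f g h
  have h' : f.besselFun = g.besselFun := h
  have h2 : TemperedDistribution.besselPotential _ _ s f.toDist =
      TemperedDistribution.besselPotential _ _ s g.toDist := by
    rw [besselFun_spec, besselFun_spec, h']
  have h3 := congrArg (TemperedDistribution.besselPotential _ _ (-s)) h2
  simp only [TemperedDistribution.besselPotential_besselPotential_apply, add_neg_cancel,
    TemperedDistribution.besselPotential_zero, ContinuousLinearMap.id_apply] at h3
  exact Subtype.ext h3

instance : NormedAddCommGroup (SobolevField d s) :=
  NormedAddCommGroup.induced _ _ (bessel d s) bessel_injective

instance : NormedSpace ℝ (SobolevField d s) :=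
  NormedSpace.induced ℝ _ _ (bessel d s)

instance : MeasurableSpace (SobolevField d s) := borel _

instance : BorelSpace (SobolevField d s) := ⟨rfl⟩

end SobolevField

/-! ### Rapidly decreasing fields and duality -/

/-- The inclusion `ℝ^d → ℂ^d`. -/
def complexify (d : ℕ) : EuclideanSpace ℝ (Fin d) →L[ℝ] EuclideanSpace ℂ (Fin d) :=
  LinearMap.toContinuousLinearMap
    { toFun := fun v ↦ WithLp.toLp 2 (fun i ↦ ((v i : ℝ) : ℂ))
      map_add' := fun v w ↦ by ext i; simp
      map_smul' := fun c v ↦ by ext i; simp }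

/-- The `i`-th component of a rapidly decreasing field, as a complex-valued function. -/
def component {d : ℕ} (φ : 𝓢(EuclideanSpace ℝ (Fin d), EuclideanSpace ℝ (Fin d))) (i : Fin d) :
    𝓢(EuclideanSpace ℝ (Fin d), ℂ) :=
  φ.postcompCLM (Complex.ofRealCLM ∘L EuclideanSpace.proj i)

/-- A rapidly decreasing field `φ` as a distributional field, `g ↦ ∫ g(x) φ(x) dx`. -/
def schwartzToDist {d : ℕ} (φ : 𝓢(EuclideanSpace ℝ (Fin d), EuclideanSpace ℝ (Fin d))) :
    DistField d :=
  SchwartzMap.toTemperedDistributionCLM (EuclideanSpace ℝ (Fin d)) (EuclideanSpace ℂ (Fin d))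
    volume (φ.postcompCLM (complexify d))

theorem schwartzToDist_mem {d : ℕ} (s : ℝ)
    (φ : 𝓢(EuclideanSpace ℝ (Fin d), EuclideanSpace ℝ (Fin d))) :
    schwartzToDist φ ∈ sobolevSubmodule d s := by
  refine ⟨SchwartzMap.memSobolev _, fun g hg i ↦ ?_⟩
  have hint : Integrable (fun x ↦ g x • (φ.postcompCLM (complexify d)) x)
      (volume : Measure (EuclideanSpace ℝ (Fin d))) := by
    exact (SchwartzMap.pairing (ContinuousLinearMap.lsmul ℂ ℂ) g
      (φ.postcompCLM (complexify d))).integrable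
  have h1 : schwartzToDist φ g i = ∫ x, g x * ((φ x i : ℝ) : ℂ) := by
    have h0 : schwartzToDist φ g = ∫ x, g x • (φ.postcompCLM (complexify d)) x :=
      SchwartzMap.toTemperedDistributionCLM_apply_apply volume _ g
    rw [h0]
    have h2 := (EuclideanSpace.proj i : EuclideanSpace ℂ (Fin d) →L[ℂ] ℂ).integral_comp_comm hint
    exact h2.symm
  have h3 : ∀ x, g x * ((φ x i : ℝ) : ℂ) = (((g x).re * φ x i : ℝ) : ℂ) := fun x ↦ by
    apply Complex.ext <;> simp [hg x]
  rw [h1]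
  simp_rw [h3]
  have h4 : ∫ x, (((g x).re * φ x i : ℝ) : ℂ) = ((∫ x, (g x).re * φ x i : ℝ) : ℂ) :=
    integral_ofReal
  rw [h4]
  exact Complex.ofReal_im _

/-- A rapidly decreasing field as an element of `H_2^s`. -/
def schwartzToSobolev {d : ℕ} (s : ℝ)
    (φ : 𝓢(EuclideanSpace ℝ (Fin d), EuclideanSpace ℝ (Fin d))) : SobolevField d s :=
  ⟨schwartzToDist φ, schwartzToDist_mem s φ⟩

/-- The distributional pairing `⟨u, φ⟩ = ∑ i, u_i(φ_i)` of a real distributional field `u` with a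
rapidly decreasing field `φ`. -/
def pairing {d : ℕ} (u : DistField d)
    (φ : 𝓢(EuclideanSpace ℝ (Fin d), EuclideanSpace ℝ (Fin d))) : ℝ :=
  ∑ i, (u (component φ i) i).re

/-- The element `u` of `H_2^{-s}` and the continuous linear functional `l` on `H_2^s` correspond to
each other under the identification of `H_2^{-s}` with the dual of `H_2^s`. -/
def Represents {d : ℕ} {s : ℝ} (u : SobolevField d (-s)) (l : StrongDual ℝ (SobolevField d s)) :
    Prop :=
  ∀ φ : 𝓢(EuclideanSpace ℝ (Fin d), EuclideanSpace ℝ (Fin d)),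
    l (schwartzToSobolev s φ) = pairing u.toDist φ

/-- The forward integrals `I⁻(φ)` have a pathwise redefinition in `H_2^{-s} = (H_2^s)'`: there is a
measurable map `ξ` from `Ω` to the dual of `H_2^s`, given by a measurable map `u` from `Ω` to
`H_2^{-s}`, such that for every smooth compactly supported field `φ`, `I⁻(φ)(ω) = ξ(ω)(φ)` for
almost every `ω`. -/
def HasPathwiseRedefinition {Ω : Type*} [MeasurableSpace Ω] {d : ℕ} (P : Measure Ω)
    (X : ℝ≥0 → Ω → EuclideanSpace ℝ (Fin d)) (T s : ℝ) : Prop :=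
  ∃ (ξ : Ω → StrongDual ℝ (SobolevField d s)) (u : Ω → SobolevField d (-s)),
    Measurable ξ ∧ Measurable u ∧ (∀ ω, Represents (u ω) (ξ ω)) ∧
    ∀ φ : 𝓢(EuclideanSpace ℝ (Fin d), EuclideanSpace ℝ (Fin d)), HasCompactSupport φ →
      ∀ Y : Ω → ℝ, IsForwardIntegral P X T φ Y →
        ∀ᵐ ω ∂P, Y ω = ξ ω (schwartzToSobolev s φ)

end FBMCurrent

end

/-! The regularized forward integral is the pairing of `φ` with the random current `φ ↦ I⁻_ε(φ)`,
whose Fourier transform is `Z_ε(k) = ∫₀ᵀ e^{-2πi⟨k, X_t⟩} (X_{t+ε} - X_t)/ε dt` (`fourierApprox`).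
It suffices to show that `(1 + ‖k‖²)^{-α/2} Z_ε(k)` is Cauchy in `L²(P ⊗ dk)`: the limit, read as a
random element of `L²(dk)`, gives the `H_2^{-α}`-valued current, and every `I⁻_ε(φ)` converges in
`L²(P)`, because it is a fixed continuous functional of the weighted transform.

The second moments are explicit. Gaussian calculus gives `E⟨Z_ε(k), Z_δ(k)⟩` as the integral over
`(t, s) ∈ (0, T]²` of `kernel d (2H) ‖2πk‖² ε δ (t - s)`. Two facts about this integral are needed:
a bound by `C (1 + ‖k‖²)^{-θ}` uniform in `ε, δ > 0` (`exists_abs_double_integral_kernel_le`), and a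
limit as `(ε, δ) → 0` jointly (`exists_tendsto_double_integral_kernel`). The joint limit `L` makes
`E‖Z_ε - Z_δ‖²` tend to `L - 2L + L = 0` for each `k`, and the uniform bound allows dominated
convergence in `k` as soon as `2(α + θ) > d`.

For `H > 1/2` the kernel is at most a constant times `(1 + y)^{-θ} |r|^{2H - 2 - 2Hθ}` with `y =
‖2πk‖²` (`abs_kernel_le`), which is integrable at `r = 0` exactly when `θ < 1 - 1/(2H)`; hence the
threshold `α_H = d/2 - 1 + 1/(2H)`. For `H = 1/2` the kernel has no such majorant: it is an
approximate identity of mass about `d`, and `θ = 0` suffices because `α_H = d/2`. -/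

namespace FBMCurrent

/-! ### Gaussian moments weighted by a complex exponential -/

section GaussianExpectation

variable {Ω : Type*} [MeasurableSpace Ω] {P : Measure Ω}

theorem integral_cexp_of_hasGaussianLaw {V : Ω → ℝ} (hV : HasGaussianLaw V P) (h0 : P[V] = 0) :
    ∫ ω, Complex.exp (Complex.I * (V ω : ℂ)) ∂P = (Real.exp (-(∫ ω, V ω * V ω ∂P) / 2) : ℝ) := by
  have := hV.isProbabilityMeasure
  have h1 : charFun (P.map V) 1 = ∫ ω, Complex.exp (Complex.I * (V ω : ℂ)) ∂P := by
    rw [charFun_apply_real, integral_map hV.aemeasurable (by fun_prop)]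
    congr 1 with ω
    congr 1
    push_cast
    ring
  rw [← h1, hV.map_eq_gaussianReal, charFun_gaussianReal, h0]
  have h2 : Var[V; P] = ∫ ω, V ω * V ω ∂P := by
    rw [variance_of_integral_eq_zero hV.aemeasurable h0]
    simp [sq]
  have h3 : ((Var[V; P].toNNReal : ℝ≥0) : ℝ) = ∫ ω, V ω * V ω ∂P := by
    rw [Real.coe_toNNReal _ (variance_nonneg _ _), h2]
  have h4 : (((Var[V; P].toNNReal : ℝ≥0) : ℝ) : ℂ) = ((∫ ω, V ω * V ω ∂P : ℝ) : ℂ) := by rw [h3]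
  push_cast at h4 ⊢
  rw [h4]
  congr 1
  ring

theorem norm_cexp_I_mul (x : ℝ) : ‖Complex.exp (Complex.I * (x : ℂ))‖ = 1 := by
  rw [mul_comm, Complex.norm_exp_ofReal_mul_I]

/-- The exponential has modulus one, so `‖W A‖` dominates the derivative for every value of the
parameter. -/
theorem hasDerivAt_integral_mul_cexp {W : Ω → ℂ} {V A : Ω → ℝ} (hW : Integrable W P)
    (hV : AEMeasurable V P) (hA : AEMeasurable A P) (hWA : Integrable (fun ω ↦ W ω * (A ω : ℂ)) P) :
    HasDerivAt (fun x : ℝ ↦ ∫ ω, W ω * Complex.exp (Complex.I * ((V ω + x * A ω : ℝ) : ℂ)) ∂P)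
      (∫ ω, W ω * (A ω : ℂ) * Complex.I * Complex.exp (Complex.I * (V ω : ℂ)) ∂P) 0 := by
  have hWm := hW.aestronglyMeasurable
  have hm : ∀ x : ℝ, AEStronglyMeasurable
      (fun ω ↦ W ω * Complex.exp (Complex.I * ((V ω + x * A ω : ℝ) : ℂ))) P := fun x ↦ by
    refine hWm.mul (AEMeasurable.aestronglyMeasurable ?_)
    fun_prop
  have key := hasDerivAt_integral_of_dominated_loc_of_deriv_le (μ := P) (𝕜 := ℝ) (s := Set.univ)
    (F := fun (x : ℝ) ω ↦ W ω * Complex.exp (Complex.I * ((V ω + x * A ω : ℝ) : ℂ)))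
    (F' := fun (x : ℝ) ω ↦ W ω * (A ω : ℂ) * Complex.I *
      Complex.exp (Complex.I * ((V ω + x * A ω : ℝ) : ℂ)))
    (x₀ := (0 : ℝ)) (bound := fun ω ↦ ‖W ω * (A ω : ℂ)‖) Filter.univ_mem
    (Eventually.of_forall hm) ?_ ?_ ?_ hWA.norm ?_
  · have h2 := key.2
    simpa using h2
  · refine hW.norm.mono' (hm 0) (ae_of_all _ fun ω ↦ ?_)
    rw [norm_mul, norm_cexp_I_mul, mul_one]
  · refine (hWA.aestronglyMeasurable.mul_const _).mul (AEMeasurable.aestronglyMeasurable ?_)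
    fun_prop
  · refine ae_of_all _ fun ω x _ ↦ ?_
    rw [norm_mul, norm_cexp_I_mul, mul_one, norm_mul, Complex.norm_I, mul_one]
  · refine ae_of_all _ fun ω x _ ↦ ?_
    have h1 : HasDerivAt (fun x : ℝ ↦ ((V ω + x * A ω : ℝ) : ℂ)) ((A ω : ℝ) : ℂ) x := by
      have := ((hasDerivAt_id x).mul_const (A ω)).const_add (V ω)
      simpa using this.ofReal_comp
    have h2 := ((h1.const_mul Complex.I).cexp).const_mul (W ω)
    refine h2.congr_deriv ?_
    ring

/-- Differentiate the characteristic function `y ↦ E e^{i(V + yB)}` at `y = 0`, once under the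
expectation and once in its closed form. -/
theorem integral_mul_cexp_of_hasGaussianLaw {V B : Ω → ℝ}
    (h : ∀ y : ℝ, HasGaussianLaw (fun ω ↦ V ω + y * B ω) P) (hV : MemLp V 2 P) (hB : MemLp B 2 P)
    (hV0 : P[V] = 0) (hB0 : P[B] = 0) :
    ∫ ω, (B ω : ℂ) * Complex.exp (Complex.I * (V ω : ℂ)) ∂P =
      Complex.I * ((∫ ω, V ω * B ω ∂P : ℝ) : ℂ) *
        (Real.exp (-(∫ ω, V ω * V ω ∂P) / 2) : ℝ) := by
  have := (h 0).isProbabilityMeasure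
  have hBi := hB.integrable one_le_two
  have hVi := hV.integrable one_le_two
  have h1 := hasDerivAt_integral_mul_cexp (W := fun _ ↦ 1) (V := V) (A := B) (P := P)
    (integrable_const _) hVi.aemeasurable hBi.aemeasurable (by simp_rw [one_mul]; exact hBi.ofReal)
  have hVV : Integrable (fun ω ↦ V ω * V ω) P := hV.integrable_mul hV
  have hVB : Integrable (fun ω ↦ V ω * B ω) P := hV.integrable_mul hB
  have hBB : Integrable (fun ω ↦ B ω * B ω) P := hB.integrable_mul hB
  have h2 : ∀ y : ℝ, ∫ ω, (V ω + y * B ω) * (V ω + y * B ω) ∂P =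
      ∫ ω, V ω * V ω ∂P + 2 * y * ∫ ω, V ω * B ω ∂P + y ^ 2 * ∫ ω, B ω * B ω ∂P := fun y ↦ by
    rw [← integral_const_mul, ← integral_const_mul, ← integral_add hVV (hVB.const_mul _),
      ← integral_add (by exact hVV.add (hVB.const_mul _)) (hBB.const_mul _)]
    congr 1 with ω
    ring
  have h3 : ∀ y : ℝ, ∫ ω, (1 : ℂ) * Complex.exp (Complex.I * ((V ω + y * B ω : ℝ) : ℂ)) ∂P =
      (Real.exp (-(∫ ω, V ω * V ω ∂P + 2 * y * ∫ ω, V ω * B ω ∂P +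
        y ^ 2 * ∫ ω, B ω * B ω ∂P) / 2) : ℝ) := fun y ↦ by
    simp_rw [one_mul]
    rw [integral_cexp_of_hasGaussianLaw (h y), h2]
    rw [integral_add hVi (hBi.const_mul _), integral_const_mul, hV0, hB0]
    simp
  simp_rw [h3] at h1
  set v := ∫ ω, V ω * V ω ∂P
  set c := ∫ ω, V ω * B ω ∂P
  set b := ∫ ω, B ω * B ω ∂P
  have h4 : HasDerivAt (fun y : ℝ ↦ Real.exp (-(v + 2 * y * c + y ^ 2 * b) / 2))
      (-c * Real.exp (-v / 2)) 0 := by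
    have e1 : HasDerivAt (fun y : ℝ ↦ -(v + 2 * y * c + y ^ 2 * b) / 2) (-c) 0 := by
      have e2 := ((((((hasDerivAt_id (0 : ℝ)).const_mul 2).mul_const c).const_add v).add
        (((hasDerivAt_id (0 : ℝ)).pow 2).mul_const b)).neg).div_const 2
      refine e2.congr_deriv ?_
      simp
      ring
    refine e1.exp.congr_deriv ?_
    simp [mul_comm]
  have h5 := h1.unique h4.ofReal_comp
  simp only [one_mul] at h5
  have h6 : ∫ ω, (B ω : ℂ) * Complex.I * Complex.exp (Complex.I * (V ω : ℂ)) ∂P =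
      Complex.I * ∫ ω, (B ω : ℂ) * Complex.exp (Complex.I * (V ω : ℂ)) ∂P := by
    rw [← integral_const_mul]
    congr 1 with ω
    ring
  rw [h6] at h5
  have h7 : ∫ ω, (B ω : ℂ) * Complex.exp (Complex.I * (V ω : ℂ)) ∂P =
      -Complex.I * (Complex.I * ∫ ω, (B ω : ℂ) * Complex.exp (Complex.I * (V ω : ℂ)) ∂P) := by
    rw [← mul_assoc, neg_mul, Complex.I_mul_I, neg_neg, one_mul]
  rw [h7, h5]
  push_cast
  ring

/-- One more differentiation of the same kind, now of `x ↦ E[B e^{i(U + xA)}]`, whose closed form is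
the preceding lemma. -/
theorem integral_mul_mul_cexp_of_hasGaussianLaw {U A B : Ω → ℝ}
    (h : ∀ x y : ℝ, HasGaussianLaw (fun ω ↦ U ω + x * A ω + y * B ω) P) (hU : MemLp U 2 P)
    (hA : MemLp A 2 P) (hB : MemLp B 2 P) (hU0 : P[U] = 0) (hA0 : P[A] = 0) (hB0 : P[B] = 0) :
    ∫ ω, ((A ω * B ω : ℝ) : ℂ) * Complex.exp (Complex.I * (U ω : ℂ)) ∂P =
      (((∫ ω, A ω * B ω ∂P - (∫ ω, U ω * A ω ∂P) * ∫ ω, U ω * B ω ∂P) *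
        Real.exp (-(∫ ω, U ω * U ω ∂P) / 2) : ℝ) : ℂ) := by
  have := (h 0 0).isProbabilityMeasure
  have hBi := hB.integrable one_le_two
  have hAi := hA.integrable one_le_two
  have hUi := hU.integrable one_le_two
  have hUU : Integrable (fun ω ↦ U ω * U ω) P := hU.integrable_mul hU
  have hUA : Integrable (fun ω ↦ U ω * A ω) P := hU.integrable_mul hA
  have hUB : Integrable (fun ω ↦ U ω * B ω) P := hU.integrable_mul hB
  have hAB : Integrable (fun ω ↦ A ω * B ω) P := hA.integrable_mul hB
  have hAA : Integrable (fun ω ↦ A ω * A ω) P := hA.integrable_mul hA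
  have h1 := hasDerivAt_integral_mul_cexp (W := fun ω ↦ (B ω : ℂ)) (V := U) (A := A) (P := P)
    hBi.ofReal hUi.aemeasurable hAi.aemeasurable
    (by convert! hAB.ofReal (𝕜 := ℂ) using 2 with ω; simp [mul_comm])
  have h2 : ∀ x : ℝ, ∫ ω, (U ω + x * A ω) * (U ω + x * A ω) ∂P =
      ∫ ω, U ω * U ω ∂P + 2 * x * ∫ ω, U ω * A ω ∂P + x ^ 2 * ∫ ω, A ω * A ω ∂P := fun y ↦ by
    rw [← integral_const_mul, ← integral_const_mul, ← integral_add hUU (hUA.const_mul _),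
      ← integral_add (by exact hUU.add (hUA.const_mul _)) (hAA.const_mul _)]
    congr 1 with ω
    ring
  have h2' : ∀ x : ℝ, ∫ ω, (U ω + x * A ω) * B ω ∂P =
      ∫ ω, U ω * B ω ∂P + x * ∫ ω, A ω * B ω ∂P := fun y ↦ by
    rw [← integral_const_mul, ← integral_add hUB (hAB.const_mul _)]
    congr 1 with ω
    ring
  have h3 : ∀ x : ℝ, ∫ ω, (B ω : ℂ) * Complex.exp (Complex.I * ((U ω + x * A ω : ℝ) : ℂ)) ∂P =
      Complex.I * (((∫ ω, U ω * B ω ∂P + x * ∫ ω, A ω * B ω ∂P) *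
        (Real.exp (-(∫ ω, U ω * U ω ∂P + 2 * x * ∫ ω, U ω * A ω ∂P +
        x ^ 2 * ∫ ω, A ω * A ω ∂P) / 2)) : ℝ) : ℂ) := fun x ↦ by
    rw [integral_mul_cexp_of_hasGaussianLaw (h x) (hU.add (hA.const_mul x)) hB _ hB0, h2, h2']
    · push_cast; ring
    · rw [integral_add hUi (hAi.const_mul _), integral_const_mul, hU0, hA0]
      simp
  simp_rw [h3] at h1
  set v := ∫ ω, U ω * U ω ∂P
  set a := ∫ ω, U ω * A ω ∂P
  set b := ∫ ω, U ω * B ω ∂P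
  set c := ∫ ω, A ω * B ω ∂P
  set q := ∫ ω, A ω * A ω ∂P
  have h4 : HasDerivAt (fun y : ℝ ↦ (b + y * c) * Real.exp (-(v + 2 * y * a + y ^ 2 * q) / 2))
      ((c - a * b) * Real.exp (-v / 2)) 0 := by
    have e1 : HasDerivAt (fun y : ℝ ↦ -(v + 2 * y * a + y ^ 2 * q) / 2) (-a) 0 := by
      have e2 := ((((((hasDerivAt_id (0 : ℝ)).const_mul 2).mul_const a).const_add v).add
        (((hasDerivAt_id (0 : ℝ)).pow 2).mul_const q)).neg).div_const 2
      refine e2.congr_deriv ?_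
      simp
      ring
    have e3 := (((hasDerivAt_id (0 : ℝ)).mul_const c).const_add b).mul e1.exp
    refine e3.congr_deriv ?_
    simp
    ring
  have h5 := h1.unique (h4.ofReal_comp.const_mul Complex.I)
  have h6 : ∫ ω, (B ω : ℂ) * (A ω : ℂ) * Complex.I * Complex.exp (Complex.I * (U ω : ℂ)) ∂P =
      Complex.I * ∫ ω, ((A ω * B ω : ℝ) : ℂ) * Complex.exp (Complex.I * (U ω : ℂ)) ∂P := by
    rw [← integral_const_mul]
    congr 1 with ω
    push_cast
    ring
  rw [h6] at h5
  exact mul_left_cancel₀ Complex.I_ne_zero h5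

end GaussianExpectation

/-! ### Second moments of fractional Brownian increments -/

section FBMExpectation

variable {Ω : Type*} [MeasurableSpace Ω] {P : Measure Ω} {H : ℝ}

namespace IsFBMReal

variable {B : ℝ≥0 → Ω → ℝ}

theorem memLp_two (hB : IsFBMReal H B P) (t : ℝ≥0) : MemLp (B t) 2 P :=
  (hB.gaussian.hasGaussianLaw_eval t).memLp_two

theorem memLp_two_sub (hB : IsFBMReal H B P) (s t : ℝ≥0) :
    MemLp (fun ω ↦ B s ω - B t ω) 2 P :=
  (hB.memLp_two s).sub (hB.memLp_two t)

theorem integral_mul (hB : IsFBMReal H B P) (s t : ℝ≥0) : ∫ ω, B s ω * B t ω ∂P =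
    1 / 2 * ((s : ℝ) ^ (2 * H) + (t : ℝ) ^ (2 * H) - |(s : ℝ) - (t : ℝ)| ^ (2 * H)) := by
  have := hB.gaussian.isProbabilityMeasure
  rw [← hB.covariance, covariance_eq_sub (hB.memLp_two s) (hB.memLp_two t), hB.mean, hB.mean]
  simp

theorem integral_sub (hB : IsFBMReal H B P) (s t : ℝ≥0) : ∫ ω, (B s ω - B t ω) ∂P = 0 := by
  have := hB.gaussian.isProbabilityMeasure
  rw [MeasureTheory.integral_sub ((hB.memLp_two s).integrable one_le_two)
    ((hB.memLp_two t).integrable one_le_two), hB.mean, hB.mean, sub_zero]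

theorem integral_sub_mul_sub (hB : IsFBMReal H B P) (a b c e : ℝ≥0) :
    ∫ ω, (B a ω - B b ω) * (B c ω - B e ω) ∂P =
      1 / 2 * (|(a : ℝ) - e| ^ (2 * H) + |(b : ℝ) - c| ^ (2 * H) - |(a : ℝ) - c| ^ (2 * H)
        - |(b : ℝ) - e| ^ (2 * H)) := by
  have h : ∀ s t, Integrable (fun ω ↦ B s ω * B t ω) P := fun s t ↦
    (hB.memLp_two s).integrable_mul (hB.memLp_two t)
  have h1 : ∀ ω, (B a ω - B b ω) * (B c ω - B e ω) =
      (B a ω * B c ω - B a ω * B e ω) - (B b ω * B c ω - B b ω * B e ω) := fun ω ↦ by ring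
  simp_rw [h1]
  rw [MeasureTheory.integral_sub (by exact (h _ _).sub (h _ _)) (by exact (h _ _).sub (h _ _)),
    MeasureTheory.integral_sub (h _ _) (h _ _), MeasureTheory.integral_sub (h _ _) (h _ _)]
  simp_rw [hB.integral_mul]
  ring

theorem hasGaussianLaw_sum (hB : IsFBMReal H B P) {n : ℕ} (τ : Fin n → ℝ≥0) (c : Fin n → ℝ) :
    HasGaussianLaw (fun ω ↦ ∑ i, c i * B (τ i) ω) P :=
  ((hB.gaussian.comp_right τ).smul c).hasGaussianLaw_fun_sum (I := Finset.univ)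

theorem integral_cexp_increments (hB : IsFBMReal H B P) (x : ℝ) (t t' s s' : ℝ≥0) :
    ∫ ω, (((B t' ω - B t ω) * (B s' ω - B s ω) : ℝ) : ℂ) *
        Complex.exp (Complex.I * ((x * (B t ω - B s ω) : ℝ) : ℂ)) ∂P =
      (((∫ ω, (B t' ω - B t ω) * (B s' ω - B s ω) ∂P -
        x ^ 2 * ((∫ ω, (B t ω - B s ω) * (B t' ω - B t ω) ∂P) *
          ∫ ω, (B t ω - B s ω) * (B s' ω - B s ω) ∂P)) *
        Real.exp (-(x ^ 2 * ∫ ω, (B t ω - B s ω) * (B t ω - B s ω) ∂P) / 2) : ℝ) : ℂ) := by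
  rw [integral_mul_mul_cexp_of_hasGaussianLaw (U := fun ω ↦ x * (B t ω - B s ω))
    (A := fun ω ↦ B t' ω - B t ω) (B := fun ω ↦ B s' ω - B s ω) _
    ((hB.memLp_two_sub t s).const_mul x) (hB.memLp_two_sub t' t) (hB.memLp_two_sub s' s)
    _ (hB.integral_sub _ _) (hB.integral_sub _ _)]
  · have h1 : ∀ ω, x * (B t ω - B s ω) * (x * (B t ω - B s ω)) =
        x ^ 2 * ((B t ω - B s ω) * (B t ω - B s ω)) := fun ω ↦ by ring
    simp_rw [h1, mul_assoc, integral_const_mul]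
    congr 3
    ring
  · intro y z
    -- These are the coefficients of `x(B_t - B_s) + y(B_{t'} - B_t) + z(B_{s'} - B_s)`, collected
    -- by time.
    convert! hB.hasGaussianLaw_sum ![t, s, t', s'] ![x - y, -x - z, y, z] using 2 with ω
    simp [Fin.sum_univ_four]
    ring
  · rw [integral_const_mul, hB.integral_sub, mul_zero]

theorem integral_cexp (hB : IsFBMReal H B P) (x : ℝ) (t s : ℝ≥0) :
    ∫ ω, Complex.exp (Complex.I * ((x * (B t ω - B s ω) : ℝ) : ℂ)) ∂P =
      ((Real.exp (-(x ^ 2 * ∫ ω, (B t ω - B s ω) * (B t ω - B s ω) ∂P) / 2) : ℝ) : ℂ) := by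
  rw [integral_cexp_of_hasGaussianLaw (V := fun ω ↦ x * (B t ω - B s ω))]
  · have h1 : ∀ ω, x * (B t ω - B s ω) * (x * (B t ω - B s ω)) =
        x ^ 2 * ((B t ω - B s ω) * (B t ω - B s ω)) := fun ω ↦ by ring
    simp_rw [h1, integral_const_mul]
  · convert! hB.hasGaussianLaw_sum ![t, s] ![x, -x] using 2 with ω
    simp
    ring
  · rw [integral_const_mul, hB.integral_sub, mul_zero]

end IsFBMReal

-- The inner product is a sum over components `j`, and the exponential is a product over components
-- `l`. In the `j`-th term only the factor `l = j` carries increments, so independence reduces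
-- everything to the scalar formulas. The exponents add up to `‖x‖²`, and so do the coefficients
-- `x_j²` when summed over `j`.
set_option maxHeartbeats 400000 in
theorem IsFBM.integral_inner_mul_cexp {d : ℕ} {X : ℝ≥0 → Ω → EuclideanSpace ℝ (Fin d)}
    (hX : IsFBM H X P) (x : EuclideanSpace ℝ (Fin d)) (t t' s s' : ℝ≥0) :
    ∫ ω, ((inner ℝ (X t' ω - X t ω) (X s' ω - X s ω) : ℝ) : ℂ) *
        Complex.exp (Complex.I * ((inner ℝ x (X t ω - X s ω) : ℝ) : ℂ)) ∂P =
      (((d * (1 / 2 * (|(t' : ℝ) - s| ^ (2 * H) + |(t : ℝ) - s'| ^ (2 * H)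
          - |(t' : ℝ) - s'| ^ (2 * H) - |(t : ℝ) - s| ^ (2 * H))) -
        ‖x‖ ^ 2 * ((1 / 2 * (|(t : ℝ) - t| ^ (2 * H) + |(s : ℝ) - t'| ^ (2 * H)
          - |(t : ℝ) - t'| ^ (2 * H) - |(s : ℝ) - t| ^ (2 * H))) *
          (1 / 2 * (|(t : ℝ) - s| ^ (2 * H) + |(s : ℝ) - s'| ^ (2 * H)
          - |(t : ℝ) - s'| ^ (2 * H) - |(s : ℝ) - s| ^ (2 * H))))) *
        Real.exp (-(‖x‖ ^ 2 * (1 / 2 * (|(t : ℝ) - s| ^ (2 * H) + |(s : ℝ) - t| ^ (2 * H)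
          - |(t : ℝ) - t| ^ (2 * H) - |(s : ℝ) - s| ^ (2 * H)))) / 2) : ℝ) : ℂ) := by
  set c := 1 / 2 * (|(t' : ℝ) - s| ^ (2 * H) + |(t : ℝ) - s'| ^ (2 * H)
    - |(t' : ℝ) - s'| ^ (2 * H) - |(t : ℝ) - s| ^ (2 * H)) with hc
  set a := 1 / 2 * (|(t : ℝ) - t| ^ (2 * H) + |(s : ℝ) - t'| ^ (2 * H)
    - |(t : ℝ) - t'| ^ (2 * H) - |(s : ℝ) - t| ^ (2 * H)) with ha
  set b := 1 / 2 * (|(t : ℝ) - s| ^ (2 * H) + |(s : ℝ) - s'| ^ (2 * H)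
    - |(t : ℝ) - s'| ^ (2 * H) - |(s : ℝ) - s| ^ (2 * H)) with hb
  set r := 1 / 2 * (|(t : ℝ) - s| ^ (2 * H) + |(s : ℝ) - t| ^ (2 * H)
    - |(t : ℝ) - t| ^ (2 * H) - |(s : ℝ) - s| ^ (2 * H)) with hr
  have hprod : ∀ ω, Complex.exp (Complex.I * ((inner ℝ x (X t ω - X s ω) : ℝ) : ℂ)) =
      ∏ l, Complex.exp (Complex.I * ((x l * (X t ω l - X s ω l) : ℝ) : ℂ)) := fun ω ↦ by
    rw [← Complex.exp_sum, ← Finset.mul_sum, PiLp.inner_apply]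
    congr 2
    push_cast
    simp [mul_comm]
  have hsum : ∀ ω, ((inner ℝ (X t' ω - X t ω) (X s' ω - X s ω) : ℝ) : ℂ) *
      Complex.exp (Complex.I * ((inner ℝ x (X t ω - X s ω) : ℝ) : ℂ)) =
      ∑ j, ∏ l, ((if l = j then
        (((X t' ω l - X t ω l) * (X s' ω l - X s ω l) : ℝ) : ℂ) else 1) *
        Complex.exp (Complex.I * ((x l * (X t ω l - X s ω l) : ℝ) : ℂ))) := fun ω ↦ by
    simp_rw [Finset.prod_mul_distrib]
    rw [← Finset.sum_mul, ← hprod, PiLp.inner_apply]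
    simp only [Finset.prod_ite_eq', Finset.mem_univ, if_true]
    push_cast
    simp [mul_comm]
  have hint : ∀ j, Integrable (fun ω ↦ ∏ l, ((if l = j then
        (((X t' ω l - X t ω l) * (X s' ω l - X s ω l) : ℝ) : ℂ) else 1) *
        Complex.exp (Complex.I * ((x l * (X t ω l - X s ω l) : ℝ) : ℂ)))) P := fun j ↦ by
    have h1 : Integrable (fun ω ↦ (X t' ω j - X t ω j) * (X s' ω j - X s ω j)) P :=
      ((hX.component j).memLp_two_sub t' t).integrable_mul ((hX.component j).memLp_two_sub s' s)
    have hm : ∀ l u, Measurable fun ω ↦ X u ω l := fun l u ↦ (hX.component l).measurable u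
    have hm' : ∀ l, Measurable fun ω ↦ ((if l = j then
        (((X t' ω l - X t ω l) * (X s' ω l - X s ω l) : ℝ) : ℂ) else 1) *
        Complex.exp (Complex.I * ((x l * (X t ω l - X s ω l) : ℝ) : ℂ))) := fun l ↦ by
      have aux : ∀ f g h k : Ω → ℝ, Measurable f → Measurable g → Measurable h → Measurable k →
          Measurable fun ω ↦ ((if l = j then (((h ω - f ω) * (k ω - g ω) : ℝ) : ℂ) else 1) *
            Complex.exp (Complex.I * ((x l * (f ω - g ω) : ℝ) : ℂ))) := by
        intro f g h k hf hg hh hk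
        split_ifs <;> fun_prop
      exact aux _ _ _ _ (hm l t) (hm l s) (hm l t') (hm l s')
    refine h1.norm.mono' (Measurable.aestronglyMeasurable ?_) (ae_of_all _ fun ω ↦ ?_)
    · exact Finset.measurable_fun_prod _ fun l _ ↦ hm' l
    · simp_rw [Finset.prod_mul_distrib]
      rw [← hprod, norm_mul, norm_cexp_I_mul]
      simp only [Finset.prod_ite_eq', Finset.mem_univ, if_true, mul_one]
      rw [Complex.norm_real]
  have hval : ∀ j, ∫ ω, ∏ l, ((if l = j then
        (((X t' ω l - X t ω l) * (X s' ω l - X s ω l) : ℝ) : ℂ) else 1) *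
        Complex.exp (Complex.I * ((x l * (X t ω l - X s ω l) : ℝ) : ℂ))) ∂P =
      (((c - x j ^ 2 * (a * b)) * Real.exp (-(‖x‖ ^ 2 * r) / 2) : ℝ) : ℂ) := fun j ↦ by
    have h1 := hX.indep.integral_fun_prod_comp
      (f := fun l (p : ℝ≥0 → ℝ) ↦ (if l = j then
        (((p t' - p t) * (p s' - p s) : ℝ) : ℂ) else 1) *
        Complex.exp (Complex.I * ((x l * (p t - p s) : ℝ) : ℂ)))
      (fun l ↦ (measurable_pi_lambda _ fun t ↦ (hX.component l).measurable t).aemeasurable)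
      (fun l ↦ Measurable.aestronglyMeasurable (by split_ifs <;> fun_prop))
    rw [h1]
    have h2 : ∀ l, ∫ ω, ((if l = j then
        (((X t' ω l - X t ω l) * (X s' ω l - X s ω l) : ℝ) : ℂ) else 1) *
        Complex.exp (Complex.I * ((x l * (X t ω l - X s ω l) : ℝ) : ℂ))) ∂P =
        (((if l = j then c - x j ^ 2 * (a * b) else 1) : ℝ) : ℂ) *
          ((Real.exp (-(x l ^ 2 * r) / 2) : ℝ) : ℂ) := fun l ↦ by
      split_ifs with hl
      · subst hl
        rw [(hX.component l).integral_cexp_increments]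
        simp_rw [(hX.component l).integral_sub_mul_sub, ← hc, ← ha, ← hb, ← hr]
        push_cast
        ring
      · simp_rw [one_mul]
        rw [(hX.component l).integral_cexp]
        simp_rw [(hX.component l).integral_sub_mul_sub, ← hr]
        simp
    rw [Finset.prod_congr rfl fun l _ ↦ h2 l, Finset.prod_mul_distrib]
    rw [← Complex.ofReal_prod, ← Complex.ofReal_prod, ← Real.exp_sum, Finset.prod_ite_eq',
      if_pos (Finset.mem_univ _), ← Complex.ofReal_mul]
    congr 3
    rw [EuclideanSpace.real_norm_sq_eq, Finset.sum_mul, ← Finset.sum_div, Finset.sum_neg_distrib]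
  simp_rw [hsum]
  rw [integral_finsetSum _ fun j _ ↦ hint j]
  simp_rw [hval]
  have hfin : ∑ j, (c - x j ^ 2 * (a * b)) = d * c - ‖x‖ ^ 2 * (a * b) := by
    rw [Finset.sum_sub_distrib, EuclideanSpace.real_norm_sq_eq, Finset.sum_mul, Finset.sum_const,
      Finset.card_univ, Fintype.card_fin, nsmul_eq_mul]
  rw [← Complex.ofReal_sum, ← Finset.sum_mul, hfin]

end FBMExpectation

/-! ### Signed powers, the derivatives of `|x| ^ p` -/

section SignedPower

/-- The signed power `sgn(x) |x| ^ q`. -/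
noncomputable def signedPow (q x : ℝ) : ℝ := |x| ^ (q - 1) * x

theorem signedPow_of_pos {q x : ℝ} (hx : 0 < x) : signedPow q x = x ^ q := by
  rw [signedPow, abs_of_pos hx, ← Real.rpow_add_one hx.ne']
  simp

@[simp]
theorem signedPow_zero (q : ℝ) : signedPow q 0 = 0 := by simp [signedPow]

theorem signedPow_neg (q x : ℝ) : signedPow q (-x) = -signedPow q x := by simp [signedPow]

theorem signedPow_mul (q x y : ℝ) : signedPow q (x * y) = signedPow q x * signedPow q y := by
  rw [signedPow, signedPow, signedPow, abs_mul, Real.mul_rpow (abs_nonneg _) (abs_nonneg _)]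
  ring

theorem abs_one_sub_signedPow_le {q : ℝ} (hq : 0 < q) (hq1 : q < 1) (v : ℝ) :
    |1 - signedPow q v| ≤ 2 * |1 - v| := by
  rcases lt_trichotomy v 0 with hv | rfl | hv
  · have h1 : signedPow q v = -(-v) ^ q := by
      rw [← neg_neg v, signedPow_neg, signedPow_of_pos (by linarith), neg_neg]
    have h2 : (-v) ^ q ≤ 1 + -v := by
      rcases le_total (-v) 1 with h | h
      · have := Real.rpow_le_one (x := -v) (by linarith) h hq.le
        linarith
      · have := Real.rpow_le_self_of_one_le h hq1.le
        linarith
    have h3 : 0 ≤ (-v) ^ q := Real.rpow_nonneg (by linarith) _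
    rw [h1, abs_of_nonneg (by linarith), abs_of_nonneg (by linarith)]
    linarith
  · simp
  · rw [signedPow_of_pos hv]
    rcases le_total v 1 with h | h
    · have h1 := Real.rpow_le_one hv.le h hq.le
      have h2 := Real.self_le_rpow_of_le_one hv.le h hq1.le
      rw [abs_of_nonneg (by linarith), abs_of_nonneg (by linarith)]
      linarith
    · have h1 := Real.one_le_rpow h hq.le
      have h2 := Real.rpow_le_self_of_one_le h hq1.le
      rw [abs_of_nonpos (by linarith), abs_of_nonpos (by linarith)]
      linarith

/-- Homogeneity reduces this to `z = 1`. The singular weight involves `z` alone while `w` is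
arbitrary, even of the opposite sign or far larger; this is what makes the covariance bounds uniform
in the step sizes, including steps longer than `|r|`. -/
theorem abs_signedPow_sub_le {q : ℝ} (hq : 0 < q) (hq1 : q < 1) {z : ℝ} (hz : z ≠ 0) (w : ℝ) :
    |signedPow q z - signedPow q w| ≤ 2 * |z - w| * |z| ^ (q - 1) := by
  have h1 : w = z * (w / z) := by field_simp
  have h2 : signedPow q z - signedPow q w = signedPow q z * (1 - signedPow q (w / z)) := by
    conv_lhs => rw [h1, signedPow_mul]
    ring
  have h3 : z - w = z * (1 - w / z) := by field_simp
  rw [h2, h3, abs_mul, abs_mul, signedPow, abs_mul,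
    abs_of_nonneg (Real.rpow_nonneg (abs_nonneg z) _)]
  have h4 := abs_one_sub_signedPow_le hq hq1 (w / z)
  have h5 : 0 ≤ |z| ^ (q - 1) * |z| := by positivity
  nlinarith [mul_le_mul_of_nonneg_left h4 h5]

/-- The point of larger modulus satisfies `|x| ≥ |x - y| / 2`, so the weight in
`abs_signedPow_sub_le` becomes a power of `|x - y|`. -/
theorem abs_signedPow_sub_le_rpow {q : ℝ} (hq : 0 < q) (hq1 : q < 1) (x y : ℝ) :
    |signedPow q x - signedPow q y| ≤ 4 * |x - y| ^ q := by
  wlog hxy : |y| ≤ |x| generalizing x y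
  · rw [abs_sub_comm, abs_sub_comm x y]
    exact this y x (by linarith)
  rcases eq_or_ne x y with rfl | hne
  · simp only [sub_self, abs_zero]
    positivity
  have hx : x ≠ 0 := by
    rintro rfl
    simp at hxy
    exact hne hxy.symm
  refine (abs_signedPow_sub_le hq hq1 hx y).trans ?_
  have h0 : 0 < |x - y| := abs_pos.2 (sub_ne_zero.2 hne)
  have h1 : |x - y| / 2 ≤ |x| := by
    have := abs_sub x y
    linarith
  have h2 : |x| ^ (q - 1) ≤ (|x - y| / 2) ^ (q - 1) :=
    Real.rpow_le_rpow_of_nonpos (by positivity) h1 (by linarith)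
  have h3 : (|x - y| / 2) ^ (q - 1) ≤ 2 * |x - y| ^ (q - 1) := by
    rw [Real.div_rpow h0.le (by norm_num), div_eq_mul_inv, ← Real.rpow_neg (by norm_num), mul_comm]
    refine mul_le_mul_of_nonneg_right ?_ (by positivity)
    calc (2 : ℝ) ^ (-(q - 1)) ≤ 2 ^ (1 : ℝ) :=
          Real.rpow_le_rpow_of_exponent_le (by norm_num) (by linarith)
      _ = 2 := by simp
  calc 2 * |x - y| * |x| ^ (q - 1) ≤ 2 * |x - y| * (2 * |x - y| ^ (q - 1)) := by
        gcongr
        exact h2.trans h3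
    _ = 4 * (|x - y| ^ (q - 1) * |x - y|) := by ring
    _ = 4 * |x - y| ^ q := by rw [← Real.rpow_add_one h0.ne']; simp

theorem continuous_signedPow {q : ℝ} (hq : 0 < q) (hq1 : q < 1) : Continuous (signedPow q) := by
  rw [continuous_iff_continuousAt]
  intro x
  rw [ContinuousAt, tendsto_iff_dist_tendsto_zero]
  have h1 : Tendsto (fun y : ℝ ↦ 4 * |y - x| ^ q) (𝓝 x) (𝓝 0) := by
    have : Continuous fun y : ℝ ↦ 4 * |y - x| ^ q :=
      continuous_const.mul ((continuous_abs.comp (continuous_id.sub continuous_const)).rpow_const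
        fun _ ↦ Or.inr hq.le)
    have h := this.tendsto x
    simpa [Real.zero_rpow hq.ne'] using h
  exact squeeze_zero (fun _ ↦ dist_nonneg)
    (fun y ↦ by rw [Real.dist_eq]; exact abs_signedPow_sub_le_rpow hq hq1 y x) h1

theorem hasDerivAt_signedPow (q : ℝ) {x : ℝ} (hx : x ≠ 0) :
    HasDerivAt (signedPow q) (q * |x| ^ (q - 1)) x := by
  have key : ∀ y : ℝ, 0 < y → HasDerivAt (signedPow q) (q * y ^ (q - 1)) y := fun y hy ↦ by
    refine (Real.hasDerivAt_rpow_const (Or.inl hy.ne')).congr_of_eventuallyEq ?_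
    filter_upwards [lt_mem_nhds hy] with z hz
    exact signedPow_of_pos hz
  rcases lt_or_gt_of_ne hx with h | h
  · have h1 := (key (-x) (by linarith)).scomp x (hasDerivAt_neg x)
    have h2 := h1.neg
    have h3 : -(signedPow q ∘ Neg.neg) = signedPow q := by
      ext z
      simp [signedPow_neg]
    have h4 : HasDerivAt (signedPow q) (-((-1 : ℝ) • (q * (-x) ^ (q - 1)))) x := by
      rw [← h3]
      exact h2
    refine h4.congr_deriv ?_
    rw [abs_of_neg h]
    simp
  · rw [abs_of_pos h]
    exact key x h

theorem hasDerivAt_abs_rpow_signedPow {p : ℝ} (hp : 1 < p) (x : ℝ) :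
    HasDerivAt (fun x : ℝ ↦ |x| ^ p) (p * signedPow (p - 1) x) x := by
  refine (hasDerivAt_abs_rpow x hp).congr_deriv ?_
  rw [signedPow]
  ring_nf

end SignedPower

/-! ### Bounds and limits for the covariances of increments -/

section Covariances

/-- The covariance of `B_{t+ε} - B_t` and `B_{s+δ} - B_s` for `t - s = r`, where `p = 2H`. -/
noncomputable def incrCov (p ε δ r : ℝ) : ℝ :=
  1 / 2 * (|r + ε| ^ p + |r - δ| ^ p - |r + ε - δ| ^ p - |r| ^ p)

/-- The covariance of `B_t - B_s` and `B_{t+ε} - B_t` for `t - s = r`, where `p = 2H`. -/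
noncomputable def crossCov (p ε r : ℝ) : ℝ :=
  1 / 2 * (|r + ε| ^ p - |ε| ^ p - |r| ^ p)

/-- The expression vanishes at `ε = 0`, and its derivative in `ε` is a difference of signed powers
at points `r` apart, which Hölder continuity bounds by `|r| ^ (p - 1)`. -/
theorem abs_crossCov_le {p : ℝ} (hp : 1 < p) (hp2 : p < 2) {ε : ℝ} (hε : 0 ≤ ε) (r : ℝ) :
    |crossCov p ε r| ≤ 2 * p * ε * |r| ^ (p - 1) := by
  have h1 : ∀ x, HasDerivAt (fun x ↦ crossCov p x r)
      (1 / 2 * (p * signedPow (p - 1) (r + x) - p * signedPow (p - 1) x)) x := fun x ↦ by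
    have e1 := (hasDerivAt_abs_rpow_signedPow hp (r + x)).comp_const_add r x
    exact ((e1.sub (hasDerivAt_abs_rpow_signedPow hp x)).sub_const _).const_mul _
  have h2 := norm_image_sub_le_of_norm_deriv_le_segment' (f := fun x ↦ crossCov p x r)
    (a := 0) (b := ε) (C := 2 * p * |r| ^ (p - 1)) (fun x _ ↦ (h1 x).hasDerivWithinAt)
    (fun x _ ↦ by
      have := abs_signedPow_sub_le_rpow (q := p - 1) (by linarith) (by linarith) (r + x) x
      rw [add_sub_cancel_right] at this
      rw [← mul_sub, Real.norm_eq_abs, abs_mul, abs_mul, abs_of_pos (by linarith : (0 : ℝ) < p)]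
      have e : |(1 / 2 : ℝ)| = 1 / 2 := by norm_num
      rw [e]
      nlinarith) ε ⟨hε, le_rfl⟩
  have h0 : crossCov p 0 r = 0 := by
    simp [crossCov, Real.zero_rpow (by linarith : p ≠ 0)]
  rw [h0, sub_zero, sub_zero, Real.norm_eq_abs] at h2
  linarith

theorem tendsto_crossCov_div {p : ℝ} (hp : 1 < p) (r : ℝ) :
    Tendsto (fun ε ↦ crossCov p ε r / ε) (𝓝[>] 0) (𝓝 (p / 2 * signedPow (p - 1) r)) := by
  have e1 := (hasDerivAt_abs_rpow_signedPow hp (r + 0)).comp_const_add r 0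
  have h1 : HasDerivAt (fun x ↦ crossCov p x r)
      (1 / 2 * (p * signedPow (p - 1) (r + 0) - p * signedPow (p - 1) 0)) 0 :=
    ((e1.sub (hasDerivAt_abs_rpow_signedPow hp 0)).sub_const _).const_mul _
  have h2 := h1.tendsto_slope.mono_left (nhdsWithin_mono 0 (fun x (hx : 0 < x) ↦ hx.ne'))
  have h0 : crossCov p 0 r = 0 := by
    simp [crossCov, Real.zero_rpow (by linarith : p ≠ 0)]
  have h3 : p / 2 * signedPow (p - 1) r =
      1 / 2 * (p * signedPow (p - 1) (r + 0) - p * signedPow (p - 1) 0) := by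
    simp only [add_zero, signedPow_zero]
    ring
  rw [h3]
  refine Tendsto.congr (fun ε ↦ ?_) h2
  rw [slope_def_field, h0]
  simp

theorem hasDerivAt_abs_rpow_sub {p : ℝ} (hp : 1 < p) (δ z : ℝ) :
    HasDerivAt (fun z ↦ 1 / 2 * (|z| ^ p - |z - δ| ^ p))
      (1 / 2 * (p * signedPow (p - 1) z - p * signedPow (p - 1) (z - δ))) z :=
  ((hasDerivAt_abs_rpow_signedPow hp z).sub
    ((hasDerivAt_abs_rpow_signedPow hp (z - δ)).comp_sub_const z δ)).const_mul _

theorem monotone_of_hasDerivAt_ne_zero {f f' : ℝ → ℝ} (hf : Continuous f)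
    (hf' : ∀ x, x ≠ 0 → HasDerivAt f (f' x) x) (h0 : ∀ x, x ≠ 0 → 0 ≤ f' x) : Monotone f := by
  have h1 : MonotoneOn f (Set.Iic 0) := by
    refine monotoneOn_of_hasDerivWithinAt_nonneg (f' := f') (convex_Iic 0) hf.continuousOn
      (fun x hx ↦ ?_) (fun x hx ↦ ?_)
    all_goals rw [interior_Iic] at hx
    · exact (hf' x hx.ne).hasDerivWithinAt
    · exact h0 x hx.ne
  have h2 : MonotoneOn f (Set.Ici 0) := by
    refine monotoneOn_of_hasDerivWithinAt_nonneg (f' := f') (convex_Ici 0) hf.continuousOn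
      (fun x hx ↦ ?_) (fun x hx ↦ ?_)
    all_goals rw [interior_Ici] at hx
    · exact (hf' x hx.ne').hasDerivWithinAt
    · exact h0 x hx.ne'
  exact MonotoneOn.Iic_union_Ici h1 h2

/-- The covariance is the increment over `[r, r + ε]` of a function `h` with `|h'(z)| ≤ pδ |z| ^ (p
- 2)`. This interval may contain the singularity at `0`, so instead of a mean value estimate `h` is
compared with the continuous primitive `C * signedPow (p - 1)` of the bound: the primitive plus or
minus `h` is monotone. -/
theorem abs_incrCov_le {p : ℝ} (hp : 1 < p) (hp2 : p < 2) {ε δ r : ℝ} (hε : 0 < ε) (hδ : 0 < δ)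
    (hr : r ≠ 0) : |incrCov p ε δ r| ≤ 2 * p / (p - 1) * (ε * δ) * |r| ^ (p - 2) := by
  set h : ℝ → ℝ := fun z ↦ 1 / 2 * (|z| ^ p - |z - δ| ^ p) with hh
  have hc : incrCov p ε δ r = h (r + ε) - h r := by
    simp only [incrCov, hh]
    ring
  -- The constant that makes the derivative of `C * signedPow (p - 1)` equal to `pδ |z| ^ (p - 2)`.
  set C := p * δ / (p - 1) with hC
  have hq : 0 < p - 1 := by linarith
  have hq1 : p - 1 < 1 := by linarith
  have hder : ∀ z, z ≠ 0 →
      |1 / 2 * (p * signedPow (p - 1) z - p * signedPow (p - 1) (z - δ))| ≤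
        C * ((p - 1) * |z| ^ (p - 1 - 1)) := fun z hz ↦ by
    have e1 := abs_signedPow_sub_le hq hq1 hz (z - δ)
    rw [sub_sub_cancel, abs_of_pos hδ] at e1
    rw [← mul_sub, abs_mul, abs_mul, abs_of_pos (by linarith : (0 : ℝ) < p)]
    have e : |(1 / 2 : ℝ)| = 1 / 2 := by norm_num
    have e2 : C * ((p - 1) * |z| ^ (p - 1 - 1)) = p * δ * |z| ^ (p - 1 - 1) := by
      rw [hC]
      field_simp
    rw [e, e2]
    nlinarith
  have hcont : Continuous h := by
    rw [continuous_iff_continuousAt]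
    exact fun z ↦ (hasDerivAt_abs_rpow_sub hp δ z).continuousAt
  have hS := continuous_signedPow hq hq1
  have m1 : Monotone fun z ↦ C * signedPow (p - 1) z - h z :=
    monotone_of_hasDerivAt_ne_zero ((continuous_const.mul hS).sub hcont)
      (fun x hx ↦ ((hasDerivAt_signedPow (p - 1) hx).const_mul C).sub
        (hasDerivAt_abs_rpow_sub hp δ x))
      (fun x hx ↦ sub_nonneg.2 ((le_abs_self _).trans (hder x hx)))
  have m2 : Monotone fun z ↦ C * signedPow (p - 1) z + h z :=
    monotone_of_hasDerivAt_ne_zero ((continuous_const.mul hS).add hcont)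
      (fun x hx ↦ ((hasDerivAt_signedPow (p - 1) hx).const_mul C).add
        (hasDerivAt_abs_rpow_sub hp δ x))
      (fun x hx ↦ by linarith [(neg_abs_le _).trans' (neg_le_neg (hder x hx))])
  have i1 := m1 (by linarith : r ≤ r + ε)
  have i2 := m2 (by linarith : r ≤ r + ε)
  simp only at i1 i2
  have i3 := abs_signedPow_sub_le hq hq1 hr (r + ε)
  rw [sub_add_cancel_left, abs_neg, abs_of_pos hε, abs_sub_comm] at i3
  have i4 : |incrCov p ε δ r| ≤ C * (signedPow (p - 1) (r + ε) - signedPow (p - 1) r) := by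
    rw [hc, abs_le]
    constructor <;> linarith
  have hC0 : 0 ≤ C := by positivity
  calc |incrCov p ε δ r| ≤ C * (2 * ε * |r| ^ (p - 1 - 1)) :=
        i4.trans (mul_le_mul_of_nonneg_left ((le_abs_self _).trans i3) hC0)
    _ = 2 * p / (p - 1) * (ε * δ) * |r| ^ (p - 2) := by
        rw [hC, show p - 1 - 1 = p - 2 by ring]
        ring

/-- The mean value theorem applied in `ε` and then in `δ`; steps shorter than `|r|` keep all
intermediate points away from `0`. -/
theorem exists_incrCov_eq {p : ℝ} (hp : 1 < p) {ε δ r : ℝ} (hε : 0 < ε)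
    (hδ : 0 < δ) (hεr : ε < |r|) (hδr : δ < |r|) :
    ∃ η ∈ Set.Ioo (r - δ) (r + ε),
      incrCov p ε δ r = ε * δ * (p * (p - 1) / 2 * |η| ^ (p - 2)) := by
  have hne : ∀ z ∈ Set.Icc (r - δ) (r + ε), z ≠ 0 := fun z hz h0 ↦ by
    subst h0
    rcases abs_cases r with h | h <;> linarith [hz.1, hz.2]
  obtain ⟨ξ, hξ, hξ'⟩ := exists_hasDerivAt_eq_slope _ _ (by linarith : r < r + ε)
    (fun z _ ↦ (hasDerivAt_abs_rpow_sub hp δ z).continuousAt.continuousWithinAt)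
    (fun z _ ↦ hasDerivAt_abs_rpow_sub hp δ z)
  have hsub : Set.Icc (ξ - δ) ξ ⊆ Set.Icc (r - δ) (r + ε) :=
    Set.Icc_subset_Icc (by linarith [hξ.1]) hξ.2.le
  obtain ⟨η, hη, hη'⟩ := exists_hasDerivAt_eq_slope _ _ (by linarith : ξ - δ < ξ)
    (fun z hz ↦ (hasDerivAt_signedPow (p - 1) (hne z (hsub hz))).continuousAt.continuousWithinAt)
    (fun z hz ↦ hasDerivAt_signedPow (p - 1) (hne z (hsub (Set.Ioo_subset_Icc_self hz))))
  refine ⟨η, ⟨by linarith [hη.1, hξ.1], by linarith [hη.2, hξ.2]⟩, ?_⟩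
  rw [sub_sub_cancel, eq_div_iff hδ.ne'] at hη'
  rw [add_sub_cancel_left, eq_div_iff hε.ne', ← mul_sub, ← hη'] at hξ'
  rw [show p - 1 - 1 = p - 2 by ring] at hξ'
  rw [incrCov]
  linear_combination -hξ'

theorem tendsto_incrCov_div {p : ℝ} (hp : 1 < p) {r : ℝ} (hr : r ≠ 0) :
    Tendsto (fun x : ℝ × ℝ ↦ incrCov p x.1 x.2 r / (x.1 * x.2)) (𝓝[>] 0 ×ˢ 𝓝[>] 0)
      (𝓝 (p * (p - 1) / 2 * |r| ^ (p - 2))) := by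
  have hcont : ContinuousAt (fun η : ℝ ↦ p * (p - 1) / 2 * |η| ^ (p - 2)) r :=
    continuousAt_const.mul (continuous_abs.continuousAt.rpow_const (Or.inl (abs_ne_zero.2 hr)))
  rw [Metric.tendsto_nhds]
  intro e he
  obtain ⟨ρ, hρ, h1⟩ := Metric.continuousAt_iff.1 hcont e he
  have hr0 := abs_pos.2 hr
  have hm : Set.Ioo (0 : ℝ) (min ρ |r|) ∈ 𝓝[>] (0 : ℝ) := Ioo_mem_nhdsGT (lt_min hρ hr0)
  filter_upwards [prod_mem_prod hm hm] with x ⟨hx1, hx2⟩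
  obtain ⟨η, hη, h2⟩ := exists_incrCov_eq hp hx1.1 hx2.1 (hx1.2.trans_le (min_le_right _ _))
    (hx2.2.trans_le (min_le_right _ _))
  have e0 : x.1 * x.2 ≠ 0 := mul_ne_zero hx1.1.ne' hx2.1.ne'
  rw [h2, mul_div_cancel_left₀ _ e0]
  refine h1 ?_
  have e1 := hx1.2.trans_le (min_le_left ρ |r|)
  have e2 := hx2.2.trans_le (min_le_left ρ |r|)
  rw [Real.dist_eq, abs_lt]
  constructor <;> linarith [hη.1, hη.2]

end Covariances

/-! ### The kernel of the second moment: majorant and pointwise limit -/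

section Kernel

/-- The expectation of `e^{i⟨x, X_t - X_s⟩} ⟨(X_{t+ε} - X_t) / ε, (X_{s+δ} - X_s) / δ⟩` for a
`d`-dimensional fractional Brownian motion, where `y = ‖x‖ ^ 2`, `p = 2H` and `t - s = r`. -/
noncomputable def kernel (d : ℕ) (p y ε δ r : ℝ) : ℝ :=
  (d * incrCov p ε δ r - y * (crossCov p ε r * -crossCov p δ (-r))) / (ε * δ) *
    Real.exp (-(y * |r| ^ p) / 2)

theorem continuous_incrCov {p : ℝ} (hp : 0 ≤ p) (ε δ : ℝ) : Continuous (incrCov p ε δ) := by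
  have h : Continuous fun r : ℝ ↦ |r| ^ p := continuous_abs.rpow_const fun _ ↦ Or.inr hp
  have h1 : ∀ a : ℝ, Continuous fun r : ℝ ↦ |r + a| ^ p := fun a ↦
    h.comp (continuous_id.add continuous_const)
  have h2 : Continuous fun r : ℝ ↦ |r - δ| ^ p := h.comp (continuous_id.sub continuous_const)
  have h3 : Continuous fun r : ℝ ↦ |r + ε - δ| ^ p :=
    h.comp ((continuous_id.add continuous_const).sub continuous_const)
  exact continuous_const.mul ((((h1 ε).add h2).sub h3).sub h)

theorem continuous_crossCov {p : ℝ} (hp : 0 ≤ p) (ε : ℝ) : Continuous (crossCov p ε) := by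
  have h : Continuous fun r : ℝ ↦ |r| ^ p := continuous_abs.rpow_const fun _ ↦ Or.inr hp
  have h1 : Continuous fun r : ℝ ↦ |r + ε| ^ p := h.comp (continuous_id.add continuous_const)
  exact continuous_const.mul ((h1.sub continuous_const).sub h)

theorem continuous_kernel (d : ℕ) {p : ℝ} (hp : 0 ≤ p) (y ε δ : ℝ) :
    Continuous (kernel d p y ε δ) := by
  have h : Continuous fun r : ℝ ↦ |r| ^ p := continuous_abs.rpow_const fun _ ↦ Or.inr hp
  have h1 := continuous_incrCov hp ε δ
  have h2 := continuous_crossCov hp ε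
  have h3 : Continuous fun r ↦ crossCov p δ (-r) := (continuous_crossCov hp δ).comp continuous_neg
  exact (((continuous_const.mul h1).sub (continuous_const.mul (h2.mul h3.neg))).div_const _).mul
    (Real.continuous_exp.comp ((continuous_const.mul h).neg.div_const 2))

/-- Half of the exponential `e^{-w/2}` absorbs `A + B w`, the other half absorbs `1 + M + w`. -/
theorem mul_exp_neg_le {A B M w : ℝ} (hA : 0 ≤ A) (hB : 0 ≤ B) (hM : 0 ≤ M) (hw : 0 ≤ w) :
    (A + B * w) * Real.exp (-w / 2) * (1 + M + w) ≤ (A + 4 * B) * (5 + M) := by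
  have h1 : w / 4 ≤ Real.exp (w / 4) := by linarith [Real.add_one_le_exp (w / 4)]
  have h0 : 1 ≤ Real.exp (w / 4) := Real.one_le_exp (by linarith)
  have h2 : A + B * w ≤ (A + 4 * B) * Real.exp (w / 4) := by nlinarith
  have h3 : 1 + M + w ≤ (5 + M) * Real.exp (w / 4) := by nlinarith
  have h4 : Real.exp (w / 4) * Real.exp (-w / 2) * Real.exp (w / 4) = 1 := by
    rw [← Real.exp_add, ← Real.exp_add]
    ring_nf
    exact Real.exp_zero
  have h5 : 0 ≤ 1 + M + w := by linarith
  calc (A + B * w) * Real.exp (-w / 2) * (1 + M + w)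
      ≤ ((A + 4 * B) * Real.exp (w / 4)) * Real.exp (-w / 2) * ((5 + M) * Real.exp (w / 4)) := by
        gcongr
    _ = (A + 4 * B) * (5 + M) * (Real.exp (w / 4) * Real.exp (-w / 2) * Real.exp (w / 4)) := by ring
    _ = _ := by rw [h4, mul_one]

/-- With `w = y |r| ^ p`, the covariance bounds give at most `(A + 4p²w) |r| ^ (p - 2) e^{-w/2}`.
Since `((1 + y) |r| ^ p) ^ θ ≤ 1 + T ^ p + w`, the exponential also pays for this power: decay `(1 +
y) ^ (-θ)` is bought at the price of the extra singularity `|r| ^ (-pθ)`. -/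
theorem abs_kernel_le (d : ℕ) {p : ℝ} (hp : 1 < p) (hp2 : p < 2) {θ : ℝ} (hθ : 0 ≤ θ)
    (hθ1 : θ ≤ 1) {T : ℝ} (hT : 0 ≤ T) {y : ℝ} (hy : 0 ≤ y) {ε δ : ℝ} (hε : 0 < ε) (hδ : 0 < δ)
    {r : ℝ} (hr : r ≠ 0) (hrT : |r| ≤ T) :
    |kernel d p y ε δ r| ≤ (d * (2 * p / (p - 1)) + 4 * (4 * p ^ 2)) * (5 + T ^ p) *
      (1 + y) ^ (-θ) * |r| ^ (p - 2 - p * θ) := by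
  have hr0 : 0 < |r| := abs_pos.2 hr
  set A := d * (2 * p / (p - 1)) with hA
  have hA0 : 0 ≤ A := by
    have : 0 < p - 1 := by linarith
    positivity
  set w := y * |r| ^ p with hw
  have hw0 : 0 ≤ w := by positivity
  have e1 := abs_incrCov_le hp hp2 hε hδ hr
  have e2 := abs_crossCov_le hp hp2 hε.le r
  have e3 := abs_crossCov_le hp hp2 hδ.le (-r)
  rw [abs_neg] at e3
  have e4 : |r| ^ (p - 1) * |r| ^ (p - 1) = |r| ^ p * |r| ^ (p - 2) := by
    rw [← Real.rpow_add hr0, ← Real.rpow_add hr0]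
    ring_nf
  have e5 : |(d * incrCov p ε δ r - y * (crossCov p ε r * -crossCov p δ (-r)))| ≤
      (ε * δ) * ((A + 4 * p ^ 2 * w) * |r| ^ (p - 2)) := by
    have i1 : |(d : ℝ) * incrCov p ε δ r| ≤ d * (2 * p / (p - 1) * (ε * δ) * |r| ^ (p - 2)) := by
      rw [abs_mul, Nat.abs_cast]
      gcongr
    have i2 : |y * (crossCov p ε r * -crossCov p δ (-r))| ≤
        y * ((2 * p * ε * |r| ^ (p - 1)) * (2 * p * δ * |r| ^ (p - 1))) := by
      rw [abs_mul, abs_mul, abs_neg, abs_of_nonneg hy]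
      gcongr
    refine (abs_sub _ _).trans ((add_le_add i1 i2).trans_eq ?_)
    rw [hA, hw]
    linear_combination 4 * y * p ^ 2 * ε * δ * e4
  have hεδ : 0 < ε * δ := mul_pos hε hδ
  have e6 : |kernel d p y ε δ r| ≤ (A + 4 * p ^ 2 * w) * |r| ^ (p - 2) * Real.exp (-w / 2) := by
    rw [kernel, abs_mul, abs_div, abs_of_pos hεδ, Real.abs_exp]
    refine mul_le_mul_of_nonneg_right ?_ (Real.exp_nonneg _)
    rw [div_le_iff₀ hεδ]
    linarith
  have e7 := mul_exp_neg_le (B := 4 * p ^ 2) (M := T ^ p) hA0 (by positivity) (by positivity) hw0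
  have hb : 0 < (1 + y) * |r| ^ p := by positivity
  have e8 : ((1 + y) * |r| ^ p) ^ θ ≤ 1 + T ^ p + w := by
    have j1 : (1 + y) * |r| ^ p ≤ 1 + T ^ p + w := by
      have : |r| ^ p ≤ T ^ p := Real.rpow_le_rpow hr0.le hrT (by linarith)
      rw [hw]
      linarith
    have j0 : 1 ≤ 1 + T ^ p + w := by
      have : 0 ≤ T ^ p := by positivity
      linarith
    calc ((1 + y) * |r| ^ p) ^ θ ≤ (1 + T ^ p + w) ^ θ := Real.rpow_le_rpow hb.le j1 hθ
      _ ≤ (1 + T ^ p + w) ^ (1 : ℝ) := Real.rpow_le_rpow_of_exponent_le j0 hθ1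
      _ = _ := Real.rpow_one _
  have e9 : (A + 4 * p ^ 2 * w) * Real.exp (-w / 2) * ((1 + y) * |r| ^ p) ^ θ ≤
      (A + 4 * (4 * p ^ 2)) * (5 + T ^ p) :=
    (mul_le_mul_of_nonneg_left e8 (by positivity)).trans e7
  have e10 : ((1 + y) * |r| ^ p) ^ θ * ((1 + y) ^ (-θ) * |r| ^ (-(p * θ))) = 1 := by
    rw [Real.mul_rpow (by positivity) (by positivity), ← Real.rpow_mul hr0.le,
      Real.rpow_neg (by positivity), Real.rpow_neg hr0.le]
    field_simp
  calc |kernel d p y ε δ r| ≤ (A + 4 * p ^ 2 * w) * |r| ^ (p - 2) * Real.exp (-w / 2) := e6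
    _ = (A + 4 * p ^ 2 * w) * Real.exp (-w / 2) * ((1 + y) * |r| ^ p) ^ θ *
        ((1 + y) ^ (-θ) * (|r| ^ (p - 2) * |r| ^ (-(p * θ)))) := by
        linear_combination -((A + 4 * p ^ 2 * w) * |r| ^ (p - 2) * Real.exp (-w / 2)) * e10
    _ ≤ (A + 4 * (4 * p ^ 2)) * (5 + T ^ p) *
        ((1 + y) ^ (-θ) * (|r| ^ (p - 2) * |r| ^ (-(p * θ)))) :=
        mul_le_mul_of_nonneg_right e9 (by positivity)
    _ = _ := by
        rw [← Real.rpow_add hr0]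
        ring_nf

theorem tendsto_kernel (d : ℕ) {p : ℝ} (hp : 1 < p) (y : ℝ) {r : ℝ} (hr : r ≠ 0) :
    Tendsto (fun x : ℝ × ℝ ↦ kernel d p y x.1 x.2 r) (𝓝[>] 0 ×ˢ 𝓝[>] 0)
      (𝓝 ((d * (p * (p - 1) / 2 * |r| ^ (p - 2)) - y * (p / 2 * signedPow (p - 1) r *
        -(p / 2 * signedPow (p - 1) (-r)))) * Real.exp (-(y * |r| ^ p) / 2))) := by
  have h1 := tendsto_incrCov_div hp hr
  have h2 := (tendsto_crossCov_div hp r).comp (tendsto_fst (f := 𝓝[>] (0 : ℝ)) (g := 𝓝[>] (0 : ℝ)))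
  have h3 := (tendsto_crossCov_div hp (-r)).comp
    (tendsto_snd (f := 𝓝[>] (0 : ℝ)) (g := 𝓝[>] (0 : ℝ)))
  refine Tendsto.congr (fun x ↦ ?_)
    (((h1.const_mul (d : ℝ)).sub ((h2.mul h3.neg).const_mul y)).mul_const _)
  simp only [Function.comp_apply, kernel]
  congr 1
  rw [sub_div]
  congr 1
  · rw [mul_div_assoc]
  · rw [neg_div', div_mul_div_comm]
    ring

end Kernel

/-! ### Double integrals of functions of `t - s` with a power singularity -/

section DoubleIntegral

theorem intervalIntegrable_abs_rpow {β : ℝ} (hβ : -1 < β) (a b : ℝ) :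
    IntervalIntegrable (fun r : ℝ ↦ |r| ^ β) volume a b := by
  have hpos : ∀ c : ℝ, 0 ≤ c → IntervalIntegrable (fun r : ℝ ↦ |r| ^ β) volume 0 c := fun c hc ↦ by
    refine (intervalIntegral.intervalIntegrable_rpow' (a := 0) (b := c) hβ).congr fun r hr ↦ ?_
    rw [Set.uIoc_of_le hc] at hr
    simp only [abs_of_pos hr.1]
  have h : ∀ c : ℝ, IntervalIntegrable (fun r : ℝ ↦ |r| ^ β) volume 0 c := fun c ↦ by
    rcases le_total 0 c with hc | hc
    · exact hpos c hc
    · have h1 := (hpos (-c) (by linarith)).comp_mul_left (c := -1)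
      simpa using h1
  exact (h a).symm.trans (h b)

theorem setIntegral_comp_sub_left (f : ℝ → ℝ) {T : ℝ} (hT : 0 ≤ T) (t : ℝ) :
    ∫ s in Set.Ioc 0 T, f (t - s) = ∫ r in (t - T)..t, f r := by
  rw [← intervalIntegral.integral_of_le hT, intervalIntegral.integral_comp_sub_left, sub_zero]

theorem integrableOn_abs_sub_rpow {β : ℝ} (hβ : -1 < β) {T : ℝ} (hT : 0 ≤ T) (t : ℝ) :
    IntegrableOn (fun s : ℝ ↦ |t - s| ^ β) (Set.Ioc 0 T) := by
  have h := (intervalIntegrable_abs_rpow hβ t (t - T)).comp_sub_left t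
  rw [sub_self, sub_sub_cancel] at h
  exact (intervalIntegrable_iff_integrableOn_Ioc_of_le hT).1 h

theorem setIntegral_abs_sub_rpow_le {β : ℝ} (hβ : -1 < β) {T : ℝ} {t : ℝ}
    (ht : t ∈ Set.Ioc 0 T) :
    ∫ s in Set.Ioc 0 T, |t - s| ^ β ≤ ∫ r in (-T)..T, |r| ^ β := by
  have hT : 0 ≤ T := ht.1.le.trans ht.2
  rw [setIntegral_comp_sub_left (fun r ↦ |r| ^ β) hT]
  refine intervalIntegral.integral_mono_interval (by linarith [ht.1]) (by linarith) ht.2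
    (ae_of_all _ fun r ↦ ?_) (intervalIntegrable_abs_rpow hβ _ _)
  positivity

variable {β C T : ℝ}

theorem ae_norm_sub_le {f : ℝ → ℝ}
    (hb : ∀ r, r ≠ 0 → |r| ≤ T → |f r| ≤ C * |r| ^ β) {t : ℝ} (ht : t ∈ Set.Ioc 0 T) :
    ∀ᵐ s ∂volume.restrict (Set.Ioc 0 T), ‖f (t - s)‖ ≤ C * |t - s| ^ β := by
  have h1 : ∀ᵐ s ∂(volume : Measure ℝ).restrict (Set.Ioc 0 T), s ≠ t :=
    ae_restrict_of_ae (Measure.ae_ne volume t)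
  filter_upwards [h1, ae_restrict_mem measurableSet_Ioc] with s hs hs'
  refine hb _ (sub_ne_zero.2 (Ne.symm hs)) ?_
  rw [abs_le]
  constructor <;> linarith [ht.1, ht.2, hs'.1, hs'.2]

theorem norm_inner_integral_le (hβ : -1 < β) (hT : 0 ≤ T) (hC : 0 ≤ C) {f : ℝ → ℝ}
    (hb : ∀ r, r ≠ 0 → |r| ≤ T → |f r| ≤ C * |r| ^ β) {t : ℝ} (ht : t ∈ Set.Ioc 0 T) :
    ‖∫ s in Set.Ioc 0 T, f (t - s)‖ ≤ C * ∫ r in (-T)..T, |r| ^ β := by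
  refine (norm_integral_le_of_norm_le ((integrableOn_abs_sub_rpow hβ hT t).const_mul C)
    (ae_norm_sub_le hb ht)).trans ?_
  rw [integral_const_mul]
  exact mul_le_mul_of_nonneg_left (setIntegral_abs_sub_rpow_le hβ ht) hC

theorem abs_double_integral_le (hβ : -1 < β) (hT : 0 ≤ T) (hC : 0 ≤ C) {f : ℝ → ℝ}
    (hb : ∀ r, r ≠ 0 → |r| ≤ T → |f r| ≤ C * |r| ^ β) :
    |∫ t in Set.Ioc 0 T, ∫ s in Set.Ioc 0 T, f (t - s)| ≤
      C * (∫ r in (-T)..T, |r| ^ β) * T := by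
  have h := norm_setIntegral_le_of_norm_le_const (μ := volume) (s := Set.Ioc 0 T)
    (by simp) fun t ht ↦ norm_inner_integral_le hβ hT hC hb ht
  simpa [hT] using h

theorem aestronglyMeasurable_inner_integral {f : ℝ → ℝ} (hf : Measurable f) (μ ν : Measure ℝ)
    [SFinite ν] : AEStronglyMeasurable (fun t ↦ ∫ s, f (t - s) ∂ν) μ := by
  have h : StronglyMeasurable fun x : ℝ × ℝ ↦ f (x.1 - x.2) :=
    (hf.comp (measurable_fst.sub measurable_snd)).stronglyMeasurable
  exact h.integral_prod_right'.aestronglyMeasurable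

/-- Dominated convergence in `s` and then in `t`; the diagonal `s = t`, where neither bound nor
limit is assumed, is null. -/
theorem tendsto_double_integral {ι : Type*} {l : Filter ι} [l.IsCountablyGenerated]
    (hβ : -1 < β) (hT : 0 ≤ T) (hC : 0 ≤ C) {f : ι → ℝ → ℝ} {g : ℝ → ℝ}
    (hf : ∀ i, Continuous (f i))
    (hb : ∀ᶠ i in l, ∀ r, r ≠ 0 → |r| ≤ T → |f i r| ≤ C * |r| ^ β)
    (hlim : ∀ r, r ≠ 0 → Tendsto (fun i ↦ f i r) l (𝓝 (g r))) :
    Tendsto (fun i ↦ ∫ t in Set.Ioc 0 T, ∫ s in Set.Ioc 0 T, f i (t - s)) l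
      (𝓝 (∫ t in Set.Ioc 0 T, ∫ s in Set.Ioc 0 T, g (t - s))) := by
  refine tendsto_integral_filter_of_dominated_convergence
    (fun _ ↦ C * ∫ r in (-T)..T, |r| ^ β) ?_ ?_ (integrable_const _) ?_
  · exact Eventually.of_forall fun i ↦
      aestronglyMeasurable_inner_integral (hf i).measurable _ _
  · filter_upwards [hb] with i hi
    filter_upwards [ae_restrict_mem measurableSet_Ioc] with t ht
    exact norm_inner_integral_le hβ hT hC hi ht
  · filter_upwards [ae_restrict_mem measurableSet_Ioc] with t ht
    refine tendsto_integral_filter_of_dominated_convergence (fun s ↦ C * |t - s| ^ β) ?_ ?_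
      ((integrableOn_abs_sub_rpow hβ hT t).const_mul C) ?_
    · exact Eventually.of_forall fun i ↦
        ((hf i).comp (continuous_const.sub continuous_id)).aestronglyMeasurable
    · filter_upwards [hb] with i hi
      exact ae_norm_sub_le hi ht
    · have h1 : ∀ᵐ s ∂(volume : Measure ℝ).restrict (Set.Ioc 0 T), s ≠ t :=
        ae_restrict_of_ae (Measure.ae_ne volume t)
      filter_upwards [h1] with s hs
      exact hlim _ (sub_ne_zero.2 (Ne.symm hs))

end DoubleIntegral

/-! ### The Brownian case `H = 1/2`, where the kernel is an approximate identity -/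

section Brownian

theorem incrCov_one (ε δ r : ℝ) :
    incrCov 1 ε δ r = 1 / 2 * (|r + ε| + |r - δ| - |r + ε - δ| - |r|) := by
  simp [incrCov]

/-- For Brownian motion the covariance is the length of the overlap of `[t, t + ε]` and `[s, s +
δ]`, which explains its sign, its support in `[-ε, δ]` and its total integral `ε * δ`. -/
theorem incrCov_one_nonneg {ε δ : ℝ} (hε : 0 < ε) (hδ : 0 < δ) (r : ℝ) : 0 ≤ incrCov 1 ε δ r := by
  rw [incrCov_one]
  rcases abs_cases (r + ε) with h1 | h1 <;> rcases abs_cases (r - δ) with h2 | h2 <;>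
    rcases abs_cases (r + ε - δ) with h3 | h3 <;> rcases abs_cases r with h4 | h4 <;> linarith

theorem incrCov_one_eq_zero {ε δ : ℝ} (hε : 0 < ε) (hδ : 0 < δ) {r : ℝ} (hr : r ≤ -ε ∨ δ ≤ r) :
    incrCov 1 ε δ r = 0 := by
  rw [incrCov_one]
  rcases hr with h | h
  · rw [abs_of_nonpos (by linarith), abs_of_nonpos (by linarith), abs_of_nonpos (by linarith),
      abs_of_nonpos (by linarith)]
    ring
  · rw [abs_of_nonneg (by linarith), abs_of_nonneg (by linarith), abs_of_nonneg (by linarith),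
      abs_of_nonneg (by linarith)]
    ring

theorem support_incrCov_one_subset {ε δ : ℝ} (hε : 0 < ε) (hδ : 0 < δ) :
    Function.support (incrCov 1 ε δ) ⊆ Set.Ioc (-ε) δ := fun r hr ↦ by
  by_contra h
  refine hr (incrCov_one_eq_zero hε hδ ?_)
  by_contra h'
  push Not at h'
  exact h ⟨h'.1, h'.2.le⟩

/-- In the combination defining `incrCov 1 ε δ` the terms `M ^ 2` cancel, leaving `(ε² + δ² - (ε -
δ)²) / 2 = ε * δ`. -/
theorem integral_abs_add {M a : ℝ} (h : |a| ≤ M) :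
    ∫ r in (-M)..M, |r + a| = M ^ 2 + a ^ 2 := by
  obtain ⟨h1, h2⟩ := abs_le.1 h
  rw [intervalIntegral.integral_comp_add_right (fun r ↦ |r|)]
  have hc : ∀ a b : ℝ, IntervalIntegrable (fun r : ℝ ↦ |r|) volume a b := fun a b ↦
    continuous_abs.intervalIntegrable a b
  rw [← intervalIntegral.integral_add_adjacent_intervals (hc _ 0) (hc 0 _)]
  have e1 : ∫ r in (-M + a)..0, |r| = ∫ r in (-M + a)..0, -r :=
    intervalIntegral.integral_congr fun r hr ↦ by
      rw [Set.uIcc_of_le (by linarith)] at hr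
      exact abs_of_nonpos hr.2
  have e2 : ∫ r in 0..(M + a), |r| = ∫ r in 0..(M + a), r :=
    intervalIntegral.integral_congr fun r hr ↦ by
      rw [Set.uIcc_of_le (by linarith)] at hr
      exact abs_of_nonneg hr.1
  rw [e1, e2, intervalIntegral.integral_neg, integral_id, integral_id]
  ring

theorem integrable_incrCov_one {ε δ : ℝ} (hε : 0 < ε) (hδ : 0 < δ) :
    Integrable (incrCov 1 ε δ) := by
  have h := (continuous_incrCov zero_le_one ε δ).integrableOn_Icc (μ := volume) (a := -ε) (b := δ)
  exact (integrableOn_iff_integrable_of_support_subset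
    ((support_incrCov_one_subset hε hδ).trans Set.Ioc_subset_Icc_self)).1 h

theorem integral_incrCov_one {ε δ : ℝ} (hε : 0 < ε) (hδ : 0 < δ) :
    ∫ r, incrCov 1 ε δ r = ε * δ := by
  set M := ε + δ with hM
  rw [← intervalIntegral.integral_eq_integral_of_support_subset (a := -M) (b := M)
    ((support_incrCov_one_subset hε hδ).trans
      (Set.Ioc_subset_Ioc (by linarith) (by linarith)))]
  have hc : ∀ a : ℝ, IntervalIntegrable (fun r : ℝ ↦ |r + a|) volume (-M) M := fun a ↦
    (continuous_abs.comp (continuous_id.add continuous_const)).intervalIntegrable _ _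
  have e : ∀ r, incrCov 1 ε δ r = 1 / 2 * (|r + ε| + |r + -δ| - |r + (ε - δ)| - |r + 0|) :=
    fun r ↦ by
      rw [incrCov_one]
      ring_nf
  simp_rw [e]
  rw [intervalIntegral.integral_const_mul, intervalIntegral.integral_sub
    (((hc _).add (hc _)).sub (hc _)) (hc _), intervalIntegral.integral_sub
    ((hc _).add (hc _)) (hc _), intervalIntegral.integral_add (hc _) (hc _),
    integral_abs_add, integral_abs_add, integral_abs_add, integral_abs_add]
  · ring
  · rw [abs_zero]; linarith
  · rw [abs_le]; constructor <;> linarith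
  · rw [abs_neg, abs_of_pos hδ]; linarith
  · rw [abs_of_pos hε]; linarith

/-- The product of cross covariances vanishes: Brownian increments are independent, and the one
starting at the later of the times `t`, `s` is uncorrelated with `X_t - X_s`. -/
theorem kernel_one (d : ℕ) (y : ℝ) {ε δ : ℝ} (hε : 0 < ε) (hδ : 0 < δ) (r : ℝ) :
    kernel d 1 y ε δ r =
      d / (ε * δ) * (incrCov 1 ε δ r * Real.exp (-(y * |r|) / 2)) := by
  have h : crossCov 1 ε r * -crossCov 1 δ (-r) = 0 := by
    rcases le_total 0 r with h | h
    · have : crossCov 1 ε r = 0 := by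
        simp only [crossCov, Real.rpow_one]
        rw [abs_of_nonneg h, abs_of_pos hε, abs_of_nonneg (by linarith)]
        ring
      rw [this, zero_mul]
    · have : crossCov 1 δ (-r) = 0 := by
        simp only [crossCov, Real.rpow_one]
        rw [abs_of_nonneg (by linarith), abs_of_pos hδ, abs_of_nonneg (by linarith)]
        ring
      rw [this, neg_zero, mul_zero]
  rw [kernel, h, Real.rpow_one]
  ring

theorem kernel_one_nonneg (d : ℕ) (y : ℝ) {ε δ : ℝ} (hε : 0 < ε) (hδ : 0 < δ) (r : ℝ) :
    0 ≤ kernel d 1 y ε δ r := by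
  rw [kernel_one d y hε hδ]
  have := incrCov_one_nonneg hε hδ r
  positivity

theorem kernel_one_le (d : ℕ) {y : ℝ} (hy : 0 ≤ y) {ε δ : ℝ} (hε : 0 < ε) (hδ : 0 < δ) (r : ℝ) :
    kernel d 1 y ε δ r ≤ d / (ε * δ) * incrCov 1 ε δ r := by
  rw [kernel_one d y hε hδ]
  have h1 := incrCov_one_nonneg hε hδ r
  have h2 : Real.exp (-(y * |r|) / 2) ≤ 1 := Real.exp_le_one_iff.2 (by
    have : 0 ≤ y * |r| := by positivity
    linarith)
  have h3 : 0 ≤ d / (ε * δ) := by positivity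
  exact mul_le_mul_of_nonneg_left (mul_le_of_le_one_right h1 h2) h3

theorem integrable_kernel_one (d : ℕ) {y : ℝ} (hy : 0 ≤ y) {ε δ : ℝ} (hε : 0 < ε) (hδ : 0 < δ) :
    Integrable (kernel d 1 y ε δ) := by
  refine ((integrable_incrCov_one hε hδ).const_mul (d / (ε * δ))).mono'
    (continuous_kernel d zero_le_one y ε δ).aestronglyMeasurable (ae_of_all _ fun r ↦ ?_)
  rw [Real.norm_of_nonneg (kernel_one_nonneg d y hε hδ r)]
  exact kernel_one_le d hy hε hδ r

theorem norm_inner_integral_kernel_one_le (d : ℕ) {y : ℝ} (hy : 0 ≤ y) {ε δ : ℝ} (hε : 0 < ε)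
    (hδ : 0 < δ) {T : ℝ} (hT : 0 ≤ T) (t : ℝ) :
    ‖∫ s in Set.Ioc 0 T, kernel d 1 y ε δ (t - s)‖ ≤ d := by
  rw [Real.norm_of_nonneg (integral_nonneg fun s ↦ kernel_one_nonneg d y hε hδ _),
    setIntegral_comp_sub_left _ hT, intervalIntegral.integral_of_le (by linarith)]
  have hi := (integrable_incrCov_one hε hδ).const_mul (d / (ε * δ))
  calc ∫ r in Set.Ioc (t - T) t, kernel d 1 y ε δ r ≤ ∫ r, kernel d 1 y ε δ r :=
        setIntegral_le_integral (integrable_kernel_one d hy hε hδ)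
          (ae_of_all _ (kernel_one_nonneg d y hε hδ))
    _ ≤ ∫ r, d / (ε * δ) * incrCov 1 ε δ r :=
        integral_mono (integrable_kernel_one d hy hε hδ) hi (kernel_one_le d hy hε hδ)
    _ = d := by
        rw [integral_const_mul, integral_incrCov_one hε hδ]
        field_simp

/-- On the support `|r| ≤ ε + δ`, so the exponential differs from one by at most `y(ε + δ)/2`, while
the remaining factor has mass `d`. -/
theorem abs_integral_kernel_one_sub_le (d : ℕ) {y : ℝ} (hy : 0 ≤ y) {ε δ : ℝ} (hε : 0 < ε)
    (hδ : 0 < δ) : |(∫ r, kernel d 1 y ε δ r) - d| ≤ d * (y * (ε + δ) / 2) := by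
  have hi := (integrable_incrCov_one hε hδ).const_mul (d / (ε * δ))
  have h0 : (d : ℝ) = ∫ r, d / (ε * δ) * incrCov 1 ε δ r := by
    rw [integral_const_mul, integral_incrCov_one hε hδ]
    field_simp
  have h1 : (∫ r, kernel d 1 y ε δ r) - d =
      ∫ r, (kernel d 1 y ε δ r - d / (ε * δ) * incrCov 1 ε δ r) := by
    rw [integral_sub (integrable_kernel_one d hy hε hδ) hi, ← h0]
  rw [h1, ← Real.norm_eq_abs]
  refine (norm_integral_le_of_norm_le (hi.mul_const (y * (ε + δ) / 2))
    (ae_of_all _ fun r ↦ ?_)).trans_eq ?_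
  · rw [Real.norm_eq_abs, abs_sub_comm,
      abs_of_nonneg (sub_nonneg.2 (kernel_one_le d hy hε hδ r)), kernel_one d y hε hδ]
    by_cases hr : incrCov 1 ε δ r = 0
    · simp [hr]
    have hr' := support_incrCov_one_subset hε hδ hr
    have hrε : |r| ≤ ε + δ := by
      rw [abs_le]
      constructor <;> linarith [hr'.1, hr'.2]
    have h2 := Real.add_one_le_exp (-(y * |r|) / 2)
    have h3 : y * |r| ≤ y * (ε + δ) := mul_le_mul_of_nonneg_left hrε hy
    have h4 : 1 - Real.exp (-(y * |r|) / 2) ≤ y * (ε + δ) / 2 := by linarith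
    have h5 : 0 ≤ d / (ε * δ) * incrCov 1 ε δ r := by
      have := incrCov_one_nonneg hε hδ r
      positivity
    calc _ = d / (ε * δ) * incrCov 1 ε δ r * (1 - Real.exp (-(y * |r|) / 2)) := by ring
      _ ≤ _ := mul_le_mul_of_nonneg_left h4 h5
  · rw [integral_mul_const, ← h0]

theorem tendsto_double_integral_kernel_one (d : ℕ) {y : ℝ} (hy : 0 ≤ y) {T : ℝ} (hT : 0 ≤ T) :
    Tendsto (fun x : ℝ × ℝ ↦ ∫ t in Set.Ioc 0 T, ∫ s in Set.Ioc 0 T,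
      kernel d 1 y x.1 x.2 (t - s)) (𝓝[>] 0 ×ˢ 𝓝[>] 0) (𝓝 (∫ _t in Set.Ioc 0 T, (d : ℝ))) := by
  have hpos : ∀ᶠ x : ℝ × ℝ in 𝓝[>] 0 ×ˢ 𝓝[>] 0, 0 < x.1 ∧ 0 < x.2 :=
    prod_mem_prod self_mem_nhdsWithin self_mem_nhdsWithin
  refine tendsto_integral_filter_of_dominated_convergence (fun _ ↦ (d : ℝ)) ?_ ?_
    (integrable_const _) ?_
  · exact Eventually.of_forall fun x ↦ aestronglyMeasurable_inner_integral
      (continuous_kernel d zero_le_one y x.1 x.2).measurable _ _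
  · filter_upwards [hpos] with x hx
    exact ae_of_all _ fun t ↦ norm_inner_integral_kernel_one_le d hy hx.1 hx.2 hT t
  · have h1 : ∀ᵐ t ∂(volume : Measure ℝ).restrict (Set.Ioc 0 T), t ≠ T :=
      ae_restrict_of_ae (Measure.ae_ne volume T)
    filter_upwards [h1, ae_restrict_mem measurableSet_Ioc] with t htT ht
    have htT' : 0 < T - t := sub_pos.2 (lt_of_le_of_ne ht.2 htT)
    -- For `0 < t < T` and such small steps the support of the kernel lies in `(t - T, t]`, so the
    -- inner integral sees its full mass.
    have hsm : ∀ᶠ x : ℝ × ℝ in 𝓝[>] 0 ×ˢ 𝓝[>] 0, x.1 ∈ Set.Ioo 0 (T - t) ∧ x.2 ∈ Set.Ioo 0 t :=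
      prod_mem_prod (Ioo_mem_nhdsGT htT') (Ioo_mem_nhdsGT ht.1)
    rw [tendsto_iff_norm_sub_tendsto_zero]
    have hz : Tendsto (fun x : ℝ × ℝ ↦ d * (y * (x.1 + x.2) / 2)) (𝓝[>] 0 ×ˢ 𝓝[>] 0) (𝓝 0) := by
      have hc : Continuous fun x : ℝ × ℝ ↦ (d : ℝ) * (y * (x.1 + x.2) / 2) := by fun_prop
      have := hc.tendsto (0, 0)
      simp only [add_zero, mul_zero, zero_div] at this
      rw [nhds_prod_eq] at this
      exact this.mono_left (prod_mono nhdsWithin_le_nhds nhdsWithin_le_nhds)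
    refine squeeze_zero' (Eventually.of_forall fun _ ↦ norm_nonneg _) ?_ hz
    filter_upwards [hsm] with x hx
    have hsupp : Function.support (kernel d 1 y x.1 x.2) ⊆ Set.Ioc (t - T) t := fun r hr ↦ by
      have h2 : incrCov 1 x.1 x.2 r ≠ 0 := fun h0 ↦ hr (by
        rw [kernel_one d y hx.1.1 hx.2.1, h0]
        simp)
      have h3 := support_incrCov_one_subset hx.1.1 hx.2.1 h2
      exact ⟨by linarith [h3.1, hx.1.2], by linarith [h3.2, hx.2.2]⟩
    rw [setIntegral_comp_sub_left _ hT,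
      intervalIntegral.integral_eq_integral_of_support_subset hsupp]
    exact abs_integral_kernel_one_sub_le d hy hx.1.1 hx.2.1

end Brownian

/-! ### Uniform decay and joint limit of the second moments -/

section KernelConclusion

/-- The condition `p * θ < p - 1` says `p - 2 - pθ > -1`, the integrability of the majorant at `0`;
the alternative `θ = 0` is what remains available at `p = 1`. -/
theorem exists_abs_double_integral_kernel_le (d : ℕ) {p : ℝ} (hp : 1 ≤ p) (hp2 : p < 2) {θ : ℝ}
    (hθ : 0 ≤ θ) (hθp : p * θ < p - 1 ∨ θ = 0) {T : ℝ} (hT : 0 ≤ T) :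
    ∃ C : ℝ, 0 ≤ C ∧ ∀ y, 0 ≤ y → ∀ ε, 0 < ε → ∀ δ, 0 < δ →
      |∫ t in Set.Ioc 0 T, ∫ s in Set.Ioc 0 T, kernel d p y ε δ (t - s)| ≤ C * (1 + y) ^ (-θ) := by
  rcases hp.eq_or_lt with rfl | hp1
  · have hθ0 : θ = 0 := by
      rcases hθp with h | h <;> linarith
    refine ⟨d * T, by positivity, fun y hy ε hε δ hδ ↦ ?_⟩
    have h := norm_setIntegral_le_of_norm_le_const (μ := volume) (s := Set.Ioc 0 T)
      (by simp) fun t _ ↦ norm_inner_integral_kernel_one_le d hy hε hδ hT t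
    simpa [hT, hθ0] using h
  · have hβ : -1 < p - 2 - p * θ := by
      rcases hθp with h | h
      · linarith
      · rw [h]
        linarith
    have hθ1 : θ ≤ 1 := by nlinarith
    have hq : 0 < p - 1 := by linarith
    set K := ∫ r in (-T)..T, |r| ^ (p - 2 - p * θ) with hK
    have hK0 : 0 ≤ K := intervalIntegral.integral_nonneg (by linarith) fun r _ ↦ by positivity
    refine ⟨(d * (2 * p / (p - 1)) + 4 * (4 * p ^ 2)) * (5 + T ^ p) * K * T, by positivity,
      fun y hy ε hε δ hδ ↦ ?_⟩
    refine (abs_double_integral_le hβ hT (by positivity)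
      fun r hr hrT ↦ abs_kernel_le d hp1 hp2 hθ hθ1 hT hy hε hδ hr hrT).trans_eq ?_
    rw [← hK]
    ring

theorem exists_tendsto_double_integral_kernel (d : ℕ) {p : ℝ} (hp : 1 ≤ p) (hp2 : p < 2)
    {T : ℝ} (hT : 0 ≤ T) {y : ℝ} (hy : 0 ≤ y) :
    ∃ L : ℝ, Tendsto (fun x : ℝ × ℝ ↦ ∫ t in Set.Ioc 0 T, ∫ s in Set.Ioc 0 T,
      kernel d p y x.1 x.2 (t - s)) (𝓝[>] 0 ×ˢ 𝓝[>] 0) (𝓝 L) := by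
  rcases hp.eq_or_lt with rfl | hp1
  · exact ⟨_, tendsto_double_integral_kernel_one d hy hT⟩
  · have hq : 0 < p - 1 := by linarith
    refine ⟨_, tendsto_double_integral (β := p - 2 - p * 0)
      (C := (d * (2 * p / (p - 1)) + 4 * (4 * p ^ 2)) * (5 + T ^ p) * (1 + y) ^ (-(0 : ℝ)))
      (by linarith) hT (by positivity) (fun x ↦ continuous_kernel d (by linarith) y x.1 x.2) ?_
      fun r hr ↦ tendsto_kernel d hp1 y hr⟩
    have hpos : ∀ᶠ x : ℝ × ℝ in 𝓝[>] 0 ×ˢ 𝓝[>] 0, 0 < x.1 ∧ 0 < x.2 :=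
      prod_mem_prod self_mem_nhdsWithin self_mem_nhdsWithin
    filter_upwards [hpos] with x hx r hr hrT
    exact abs_kernel_le d hp1 hp2 le_rfl zero_le_one hT hy hx.1 hx.2 hr hrT

end KernelConclusion

open FourierTransform

/-! ### Fourier transforms commute with linear maps on the target -/

section FourierReal

variable {V : Type*} [NormedAddCommGroup V] [InnerProductSpace ℝ V] [FiniteDimensional ℝ V]
  [MeasurableSpace V] [BorelSpace V]

theorem fourierInv_postcompCLM {F G : Type*} [NormedAddCommGroup F] [NormedSpace ℂ F]
    [CompleteSpace F] [NormedAddCommGroup G] [NormedSpace ℂ G] [CompleteSpace G]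
    (L : F →L[ℂ] G) (f : 𝓢(V, F)) :
    𝓕⁻ (f.postcompCLM L) = (𝓕⁻ f).postcompCLM L := by
  ext x
  rw [SchwartzMap.postcompCLM_apply, SchwartzMap.fourierInv_coe, SchwartzMap.fourierInv_coe,
    Real.fourierInv_eq', Real.fourierInv_eq', ← L.integral_comp_comm]
  · simp
  · refine (f.integrable (μ := volume)).norm.mono'
      (Continuous.aestronglyMeasurable (by have := f.continuous; fun_prop)) (ae_of_all _ fun v ↦ ?_)
    rw [norm_smul, Complex.norm_exp_ofReal_mul_I, one_mul]

theorem fourier_postcompCLM {F G : Type*} [NormedAddCommGroup F] [NormedSpace ℂ F]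
    [CompleteSpace F] [NormedAddCommGroup G] [NormedSpace ℂ G] [CompleteSpace G]
    (L : F →L[ℂ] G) (f : 𝓢(V, F)) :
    𝓕 (f.postcompCLM L) = (𝓕 f).postcompCLM L := by
  have h := fourierInv_postcompCLM L (𝓕 f)
  rw [fourierInv_fourier_eq] at h
  rw [← h, fourier_fourierInv_eq]

/-- The symbol `(1 + ‖x‖ ^ 2) ^ (s / 2)` of the Bessel potential. -/
noncomputable def besselSymbol (V : Type*) [NormedAddCommGroup V] (s : ℝ) (x : V) : ℂ :=
  (((1 + ‖x‖ ^ 2) ^ (s / 2) : ℝ) : ℂ)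

end FourierReal

/-! ### Bessel potentials preserve real test functions -/

section BesselReal

theorem hasTemperateGrowth_besselSymbol {V : Type*} [NormedAddCommGroup V] [InnerProductSpace ℝ V]
    (s : ℝ) : (besselSymbol V s).HasTemperateGrowth := by
  unfold besselSymbol
  fun_prop

variable {V : Type*} [NormedAddCommGroup V] [InnerProductSpace ℝ V] [FiniteDimensional ℝ V]
  [MeasurableSpace V] [BorelSpace V]

theorem conj_fourier (f : V → ℂ) (x : V) :
    starRingEnd ℂ (𝓕 f x) = 𝓕⁻ (fun v ↦ starRingEnd ℂ (f v)) x := by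
  rw [Real.fourier_eq', Real.fourierInv_eq', ← integral_conj]
  congr 1 with v
  rw [smul_eq_mul, smul_eq_mul, map_mul, ← Complex.exp_conj]
  congr 2
  simp [map_ofNat (starRingEnd ℂ) 2]

theorem conj_fourierInv (f : V → ℂ) (x : V) :
    starRingEnd ℂ (𝓕⁻ f x) = 𝓕 (fun v ↦ starRingEnd ℂ (f v)) x := by
  rw [Real.fourierInv_eq_fourier_neg, conj_fourier, Real.fourierInv_eq_fourier_neg, neg_neg]

/-- The Bessel potential of a rapidly decreasing function. -/
noncomputable def besselSchwartz (s : ℝ) (g : 𝓢(V, ℂ)) : 𝓢(V, ℂ) :=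
  𝓕⁻ (SchwartzMap.smulLeftCLM ℂ (besselSymbol V s) (𝓕 g))

/-- The symbol is even, so the two Fourier transforms may be exchanged. The left side is the
transpose that acts on test functions in `besselPotential_apply_eq_integral`. -/
theorem fourier_smulLeftCLM_fourierInv (s : ℝ) (g : 𝓢(V, ℂ)) :
    𝓕 (SchwartzMap.smulLeftCLM ℂ (besselSymbol V s) (𝓕⁻ g)) = besselSchwartz s g := by
  have hm := hasTemperateGrowth_besselSymbol (V := V) s
  ext x
  rw [besselSchwartz, SchwartzMap.fourierInv_coe, SchwartzMap.fourier_coe,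
    Real.fourierInv_eq_fourier_comp_neg]
  refine congrFun (congrArg _ (funext fun v ↦ ?_)) x
  rw [SchwartzMap.smulLeftCLM_apply_apply hm, SchwartzMap.smulLeftCLM_apply_apply hm,
    SchwartzMap.fourierInv_coe, SchwartzMap.fourier_coe, Real.fourierInv_eq_fourier_neg]
  simp [besselSymbol]

/-- Conjugation exchanges the two transforms and fixes the real symbol; evenness of the symbol then
brings back the original expression. -/
theorem besselSchwartz_im (s : ℝ) {g : 𝓢(V, ℂ)} (hg : ∀ x, (g x).im = 0) (x : V) :
    (besselSchwartz s g x).im = 0 := by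
  have hm := hasTemperateGrowth_besselSymbol (V := V) s
  rw [← Complex.conj_eq_iff_im]
  conv_lhs => rw [← fourier_smulLeftCLM_fourierInv, SchwartzMap.fourier_coe, conj_fourier]
  rw [besselSchwartz, SchwartzMap.fourierInv_coe]
  refine congrFun (congrArg _ (funext fun v ↦ ?_)) x
  rw [SchwartzMap.smulLeftCLM_apply_apply hm, SchwartzMap.smulLeftCLM_apply_apply hm,
    SchwartzMap.fourierInv_coe, SchwartzMap.fourier_coe, smul_eq_mul, smul_eq_mul, map_mul,
    conj_fourierInv]
  congr 2
  · simp [besselSymbol]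
  · exact congrFun (congrArg _ (funext fun w ↦ Complex.conj_eq_iff_im.2 (hg w))) v

end BesselReal

/-! ### From a square integrable Fourier transform to a real current and its functional -/

section SobolevDuality

variable {d : ℕ} {s : ℝ}

/-- The complexification of the real part of a complex vector. -/
noncomputable def realPart (d : ℕ) : EuclideanSpace ℂ (Fin d) →L[ℝ] EuclideanSpace ℂ (Fin d) :=
  LinearMap.toContinuousLinearMap
    { toFun := fun v ↦ WithLp.toLp 2 (fun i ↦ (((v i).re : ℝ) : ℂ))
      map_add' := fun v w ↦ by ext i; simp
      map_smul' := fun c v ↦ by ext i; simp }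

@[simp]
theorem realPart_apply (v : EuclideanSpace ℂ (Fin d)) (i : Fin d) :
    realPart d v i = (((v i).re : ℝ) : ℂ) := rfl

@[simp]
theorem complexify_apply (v : EuclideanSpace ℝ (Fin d)) (i : Fin d) :
    complexify d v i = ((v i : ℝ) : ℂ) := rfl

/-- Replacing an inverse Fourier transform by its real part makes the current real without any
symmetry of the `L²` limit having to be shown, and real fields do not notice the change. -/
theorem re_inner_realPart (v w : EuclideanSpace ℂ (Fin d)) (hw : ∀ i, (w i).im = 0) :
    (inner ℂ (realPart d v) w).re = (inner ℂ v w).re := by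
  simp [PiLp.inner_apply, hw]

/-- The real part of the inverse Fourier transform on `L²`. -/
noncomputable def realFourierInv (d : ℕ) :
    Lp (EuclideanSpace ℂ (Fin d)) 2 (volume : Measure (EuclideanSpace ℝ (Fin d))) →L[ℝ]
      Lp (EuclideanSpace ℂ (Fin d)) 2 (volume : Measure (EuclideanSpace ℝ (Fin d))) :=
  ((realPart d).compLpL 2 volume) ∘L
    ((Lp.fourierTransformₗᵢ (EuclideanSpace ℝ (Fin d))
      (EuclideanSpace ℂ (Fin d))).symm.toContinuousLinearEquiv.toContinuousLinearMap.restrictScalars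
        ℝ)

theorem realFourierInv_apply
    (w : Lp (EuclideanSpace ℂ (Fin d)) 2 (volume : Measure (EuclideanSpace ℝ (Fin d)))) :
    realFourierInv d w = (realPart d).compLpL 2 volume (𝓕⁻ w) := rfl

theorem coeFn_realFourierInv
    (w : Lp (EuclideanSpace ℂ (Fin d)) 2 (volume : Measure (EuclideanSpace ℝ (Fin d)))) :
    realFourierInv d w =ᵐ[volume] fun x ↦ realPart d ((𝓕⁻ w : Lp _ 2 _) x) := by
  rw [realFourierInv_apply]
  exact (realPart d).coeFn_compLpL _

/-- The Bessel potential of a rapidly decreasing vector field. -/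
noncomputable def besselField (s : ℝ)
    (φ : 𝓢(EuclideanSpace ℝ (Fin d), EuclideanSpace ℝ (Fin d))) :
    𝓢(EuclideanSpace ℝ (Fin d), EuclideanSpace ℂ (Fin d)) :=
  𝓕⁻ (SchwartzMap.smulLeftCLM (EuclideanSpace ℂ (Fin d))
    (besselSymbol (EuclideanSpace ℝ (Fin d)) s) (𝓕 (φ.postcompCLM (complexify d))))

theorem besselField_apply (φ : 𝓢(EuclideanSpace ℝ (Fin d), EuclideanSpace ℝ (Fin d)))
    (x : EuclideanSpace ℝ (Fin d)) (i : Fin d) :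
    besselField s φ x i = besselSchwartz s (component φ i) x := by
  have hm := hasTemperateGrowth_besselSymbol (V := EuclideanSpace ℝ (Fin d)) s
  set L : EuclideanSpace ℂ (Fin d) →L[ℂ] ℂ := EuclideanSpace.proj i with hL
  have h1 : besselField s φ x i = ((besselField s φ).postcompCLM L) x := rfl
  have h2 : component φ i = (φ.postcompCLM (complexify d)).postcompCLM L := by
    ext x
    rfl
  rw [h1, besselField, ← fourierInv_postcompCLM, besselSchwartz, h2, fourier_postcompCLM]
  congr 2
  ext k
  rw [SchwartzMap.postcompCLM_apply, SchwartzMap.smulLeftCLM_apply_apply hm,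
    SchwartzMap.smulLeftCLM_apply_apply hm, SchwartzMap.postcompCLM_apply, map_smul]

theorem component_im (φ : 𝓢(EuclideanSpace ℝ (Fin d), EuclideanSpace ℝ (Fin d))) (i : Fin d)
    (x : EuclideanSpace ℝ (Fin d)) : (component φ i x).im = 0 :=
  Complex.ofReal_im _

theorem bessel_schwartzToSobolev (φ : 𝓢(EuclideanSpace ℝ (Fin d), EuclideanSpace ℝ (Fin d))) :
    SobolevField.bessel d s (schwartzToSobolev s φ) = (besselField s φ).toLp 2 := by
  have hm := hasTemperateGrowth_besselSymbol (V := EuclideanSpace ℝ (Fin d)) s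
  refine SobolevField.toTemperedDistributionCLM_injective ?_
  have h1 := (schwartzToSobolev s φ).besselFun_spec
  refine h1.symm.trans ?_
  have h2 := TemperedDistribution.fourierMultiplierCLM_toTemperedDistributionCLM_eq hm
    (φ.postcompCLM (complexify d))
  rw [Lp.toTemperedDistributionCLM_apply, Lp.toTemperedDistribution_toLp_eq]
  exact h2

theorem inner_toLp_eq_integral {F : Type*} [NormedAddCommGroup F] [InnerProductSpace ℂ F]
    (f : Lp F 2 (volume : Measure (EuclideanSpace ℝ (Fin d))))
    (g : 𝓢(EuclideanSpace ℝ (Fin d), F)) :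
    inner ℂ f (g.toLp 2) = ∫ x, inner ℂ (f x) (g x) := by
  rw [L2.inner_def]
  refine integral_congr_ae ?_
  filter_upwards [g.coeFn_toLp 2 volume] with x hx
  rw [hx]

theorem integrable_inner_schwartz {F : Type*} [NormedAddCommGroup F] [InnerProductSpace ℂ F]
    (f : Lp F 2 (volume : Measure (EuclideanSpace ℝ (Fin d))))
    (g : 𝓢(EuclideanSpace ℝ (Fin d), F)) :
    Integrable (fun x ↦ inner ℂ (f x) (g x)) := by
  refine (L2.integrable_inner (𝕜 := ℂ) f (g.toLp 2)).congr ?_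
  filter_upwards [g.coeFn_toLp 2 volume] with x hx
  rw [hx]

/-- The real part can be dropped because `besselField s φ` is real; Plancherel then moves the
pairing to the Fourier side. -/
theorem re_inner_realFourierInv (φ : 𝓢(EuclideanSpace ℝ (Fin d), EuclideanSpace ℝ (Fin d)))
    (w : Lp (EuclideanSpace ℂ (Fin d)) 2 (volume : Measure (EuclideanSpace ℝ (Fin d)))) :
    (inner ℂ (realFourierInv d w) ((besselField s φ).toLp 2)).re =
      (∫ k, inner ℂ (w k) (besselSymbol _ s k • 𝓕 (φ.postcompCLM (complexify d)) k)).re := by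
  have hm := hasTemperateGrowth_besselSymbol (V := EuclideanSpace ℝ (Fin d)) s
  have hre : ∀ f : Lp (EuclideanSpace ℂ (Fin d)) 2 (volume : Measure (EuclideanSpace ℝ (Fin d))),
      (inner ℂ f ((besselField s φ).toLp 2)).re =
        ∫ x, (inner ℂ (f x) (besselField s φ x)).re := fun f ↦ by
    rw [inner_toLp_eq_integral]
    exact (integral_re (integrable_inner_schwartz f (besselField s φ))).symm
  have h1 : (inner ℂ (realFourierInv d w) ((besselField s φ).toLp 2)).re =
      (inner ℂ (𝓕⁻ w) ((besselField s φ).toLp 2 volume)).re := by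
    rw [hre, hre]
    refine integral_congr_ae ?_
    filter_upwards [coeFn_realFourierInv w] with x hx
    rw [hx, re_inner_realPart]
    intro i
    rw [besselField_apply]
    exact besselSchwartz_im s (component_im φ i) x
  rw [h1, ← Lp.inner_fourier_eq, fourier_fourierInv_eq, SchwartzMap.toLp_fourier_eq, besselField,
    fourier_fourierInv_eq, inner_toLp_eq_integral]
  simp_rw [SchwartzMap.smulLeftCLM_apply_apply hm]

theorem besselPotential_apply_eq_integral
    (h : Lp (EuclideanSpace ℂ (Fin d)) 2 (volume : Measure (EuclideanSpace ℝ (Fin d))))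
    (g : 𝓢(EuclideanSpace ℝ (Fin d), ℂ)) (i : Fin d) :
    TemperedDistribution.besselPotential (EuclideanSpace ℝ (Fin d)) (EuclideanSpace ℂ (Fin d)) s
      (Lp.toTemperedDistributionCLM (EuclideanSpace ℂ (Fin d)) volume 2 h) g i =
      ∫ x, besselSchwartz s g x * h x i := by
  have h1 : TemperedDistribution.besselPotential (EuclideanSpace ℝ (Fin d))
      (EuclideanSpace ℂ (Fin d)) s
      (Lp.toTemperedDistributionCLM (EuclideanSpace ℂ (Fin d)) volume 2 h) g =
      ∫ x, besselSchwartz s g x • h x := by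
    rw [← fourier_smulLeftCLM_fourierInv, Lp.toTemperedDistributionCLM_apply]
    exact Lp.toTemperedDistribution_apply h _
  have hint : Integrable (fun x ↦ besselSchwartz s g x • h x) := by
    rw [← memLp_one_iff_integrable]
    exact (Lp.memLp h).smul ((besselSchwartz s g).memLp 2 volume)
  rw [h1]
  exact ((EuclideanSpace.proj i : EuclideanSpace ℂ (Fin d) →L[ℂ] ℂ).integral_comp_comm hint).symm

/-- The current in `H_2^{-s}` whose Bessel potential has the real part of a given function as
Fourier transform. -/
noncomputable def currentOfFourier (d : ℕ) (s : ℝ) :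
    Lp (EuclideanSpace ℂ (Fin d)) 2 (volume : Measure (EuclideanSpace ℝ (Fin d))) →ₗ[ℝ]
      SobolevField d (-s) where
  toFun w := ⟨TemperedDistribution.besselPotential _ _ s
      (Lp.toTemperedDistributionCLM (EuclideanSpace ℂ (Fin d)) volume 2 (realFourierInv d w)), by
    refine ⟨⟨realFourierInv d w, by simp⟩, fun g hg i ↦ ?_⟩
    rw [besselPotential_apply_eq_integral]
    have h1 : ∀ᵐ x, besselSchwartz s g x * realFourierInv d w x i =
        (((besselSchwartz s g x).re * ((𝓕⁻ w : Lp _ 2 _) x i).re : ℝ) : ℂ) := by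
      filter_upwards [coeFn_realFourierInv w] with x hx
      rw [hx, realPart_apply]
      apply Complex.ext <;> simp [besselSchwartz_im s hg x]
    rw [integral_congr_ae h1, integral_complex_ofReal, Complex.ofReal_im]⟩
  map_add' w w' := Subtype.ext (by
    simp only [map_add]
    rfl)
  map_smul' c w := Subtype.ext (by
    simp only [map_smul, ContinuousLinearMap.map_smul_of_tower, RingHom.id_apply]
    rfl)

theorem toDist_currentOfFourier
    (w : Lp (EuclideanSpace ℂ (Fin d)) 2 (volume : Measure (EuclideanSpace ℝ (Fin d)))) :
    (currentOfFourier d s w).toDist = TemperedDistribution.besselPotential _ _ s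
      (Lp.toTemperedDistributionCLM (EuclideanSpace ℂ (Fin d)) volume 2 (realFourierInv d w)) := rfl

theorem bessel_currentOfFourier
    (w : Lp (EuclideanSpace ℂ (Fin d)) 2 (volume : Measure (EuclideanSpace ℝ (Fin d)))) :
    SobolevField.bessel d (-s) (currentOfFourier d s w) = realFourierInv d w := by
  refine SobolevField.toTemperedDistributionCLM_injective ?_
  refine (currentOfFourier d s w).besselFun_spec.symm.trans ?_
  rw [toDist_currentOfFourier]
  simp

theorem continuous_currentOfFourier : Continuous (currentOfFourier d s) := by
  refine AddMonoidHomClass.continuous_of_bound (currentOfFourier d s) ‖realFourierInv d‖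
    fun w ↦ ?_
  have h : ‖currentOfFourier d s w‖ = ‖realFourierInv d w‖ := by
    rw [← bessel_currentOfFourier (s := s)]
    rfl
  rw [h]
  exact (realFourierInv d).le_opNorm w

/-- The functional on `H_2^s` given by the real `L²` pairing of the Bessel potential with a
fixed function. -/
noncomputable def functionalOfBessel (d : ℕ) (s : ℝ) :
    Lp (EuclideanSpace ℂ (Fin d)) 2 (volume : Measure (EuclideanSpace ℝ (Fin d))) →L[ℝ]
      StrongDual ℝ (SobolevField d s) :=
  LinearMap.mkContinuous₂
    (LinearMap.mk₂ ℝ (fun h f ↦ (inner ℂ h (SobolevField.bessel d s f)).re)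
      (fun h h' f ↦ by rw [inner_add_left, Complex.add_re])
      (fun c h f ↦ by
        rw [← algebraMap_smul ℂ c h, inner_smul_left, Complex.coe_algebraMap,
          Complex.conj_ofReal, Complex.re_ofReal_mul, smul_eq_mul])
      (fun h f f' ↦ by rw [map_add, inner_add_right, Complex.add_re])
      (fun c h f ↦ by
        rw [map_smul, ← algebraMap_smul ℂ c (SobolevField.bessel d s f), inner_smul_right,
          Complex.coe_algebraMap, Complex.re_ofReal_mul, smul_eq_mul]))
    1 (fun h f ↦ by
      rw [one_mul]
      exact (Complex.abs_re_le_norm _).trans (norm_inner_le_norm _ _))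

theorem functionalOfBessel_apply
    (h : Lp (EuclideanSpace ℂ (Fin d)) 2 (volume : Measure (EuclideanSpace ℝ (Fin d))))
    (f : SobolevField d s) :
    functionalOfBessel d s h f = (inner ℂ h (SobolevField.bessel d s f)).re := rfl

theorem functionalOfBessel_realFourierInv
    (w : Lp (EuclideanSpace ℂ (Fin d)) 2 (volume : Measure (EuclideanSpace ℝ (Fin d))))
    (φ : 𝓢(EuclideanSpace ℝ (Fin d), EuclideanSpace ℝ (Fin d))) :
    functionalOfBessel d s (realFourierInv d w) (schwartzToSobolev s φ) =
      (∫ k, inner ℂ (w k) (besselSymbol _ s k • 𝓕 (φ.postcompCLM (complexify d)) k)).re := by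
  rw [functionalOfBessel_apply, bessel_schwartzToSobolev, re_inner_realFourierInv]

theorem represents_currentOfFourier
    (w : Lp (EuclideanSpace ℂ (Fin d)) 2 (volume : Measure (EuclideanSpace ℝ (Fin d)))) :
    Represents (currentOfFourier d s w) (functionalOfBessel d s (realFourierInv d w)) := by
  intro φ
  rw [functionalOfBessel_apply, bessel_schwartzToSobolev, inner_toLp_eq_integral, pairing]
  set h := realFourierInv d w with hh
  have hint := integrable_inner_schwartz h (besselField s φ)
  have hinti : ∀ i, Integrable (fun x ↦ besselSchwartz s (component φ i) x * h x i) := fun i ↦ by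
    have h1 : MemLp (fun x ↦ h x i) 2 volume :=
      (Lp.memLp h).continuousLinearMap_comp
        (EuclideanSpace.proj i : EuclideanSpace ℂ (Fin d) →L[ℂ] ℂ)
    exact ((besselSchwartz s (component φ i)).memLp 2 volume).integrable_mul h1
  have h1 : ∀ i, ((currentOfFourier d s w).toDist (component φ i) i).re =
      ∫ x, (besselSchwartz s (component φ i) x * h x i).re := fun i ↦ by
    rw [toDist_currentOfFourier, besselPotential_apply_eq_integral]
    exact (integral_re (hinti i)).symm
  simp_rw [h1]
  have hre : ∀ i, Integrable (fun x ↦ (besselSchwartz s (component φ i) x * h x i).re) :=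
    fun i ↦ (hinti i).re
  rw [← integral_finsetSum _ fun i _ ↦ hre i]
  refine (integral_re hint).symm.trans (integral_congr_ae ?_)
  filter_upwards [coeFn_realFourierInv w] with x hx
  simp only [PiLp.inner_apply, RCLike.re_to_complex, Complex.re_sum]
  refine Finset.sum_congr rfl fun i _ ↦ ?_
  rw [besselField_apply, hh, hx, realPart_apply]
  simp [mul_comm]

end SobolevDuality

/-! ### Square integrable functions on a product as random elements of `L²` -/

section Currying

open scoped ENNReal

/-- A closed set is the zero set of the distance to it, and by separability this distance is an
infimum over countably many points. -/
theorem measurable_of_measurable_edist {Ω E : Type*} [MeasurableSpace Ω] [PseudoEMetricSpace E]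
    [SecondCountableTopology E] [MeasurableSpace E] [BorelSpace E] {f : Ω → E}
    (hf : ∀ c, Measurable fun ω ↦ edist (f ω) c) : Measurable f := by
  refine measurable_of_isClosed fun s hs ↦ ?_
  obtain ⟨D, hDs, hDc, hD⟩ :=
    (TopologicalSpace.IsSeparable.of_separableSpace s).exists_countable_dense_subset
  have hcl : closure D = s := subset_antisymm (closure_minimal hDs hs) hD
  have h1 : f ⁻¹' s = (fun ω ↦ ⨅ c ∈ D, edist (f ω) c) ⁻¹' {0} := by
    ext ω
    rw [Set.mem_preimage, ← hcl, Metric.mem_closure_iff_infEDist_zero]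
    rfl
  rw [h1]
  exact (Measurable.biInf D hDc fun c _ ↦ hf c) (measurableSet_singleton 0)

/-- The sections of a measurable representative are in `L²(ν)` for almost every `ω` by Tonelli, and
`W` is set to `0` on the measurable set of other `ω`. Measurability is tested through distances to
fixed elements, which are again given by Tonelli. -/
theorem exists_stronglyMeasurable_toLp {Ω K F : Type*} [MeasurableSpace Ω] [MeasurableSpace K]
    [NormedAddCommGroup F] [SecondCountableTopology F] [MeasurableSpace F] [BorelSpace F]
    {P : Measure Ω} [SFinite P] {ν : Measure K} [SFinite ν] [MeasureTheory.IsSeparable ν]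
    {Z : Ω × K → F} (hZ : MemLp Z 2 (P.prod ν)) :
    ∃ W : Ω → Lp F 2 ν, StronglyMeasurable W ∧ ∀ᵐ ω ∂P, W ω =ᵐ[ν] fun k ↦ Z (ω, k) := by
  have : Fact ((2 : ℝ≥0∞) ≠ ∞) := ⟨by simp⟩
  set Z' : Ω × K → F := hZ.aestronglyMeasurable.mk Z with hZ'
  have hZm : StronglyMeasurable Z' := hZ.aestronglyMeasurable.stronglyMeasurable_mk
  have hZZ : Z =ᵐ[P.prod ν] Z' := hZ.aestronglyMeasurable.ae_eq_mk
  have hsec : ∀ ω, StronglyMeasurable fun k ↦ Z' (ω, k) := fun ω ↦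
    hZm.comp_measurable measurable_prodMk_left
  have hnorm : ∀ c : K → F, Measurable c →
      Measurable fun ω ↦ eLpNorm (fun k ↦ Z' (ω, k) - c k) 2 ν := fun c hc ↦ by
    have h1 : Measurable fun x : Ω × K ↦ ‖Z' x - c x.2‖ₑ ^ (2 : ℝ) := by
      have := hZm.measurable
      fun_prop
    have h2 := (h1.lintegral_prod_right' (ν := ν)).pow_const (1 / 2 : ℝ)
    convert! h2 using 2 with ω
    rw [eLpNorm_eq_lintegral_rpow_enorm_toReal (by simp) (by simp)]
    simp
  set S : Set Ω := {ω | eLpNorm (fun k ↦ Z' (ω, k)) 2 ν < ∞} with hS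
  have hmeas : MeasurableSet S := by
    rw [hS]
    have := hnorm (fun _ ↦ 0) measurable_const
    simp only [sub_zero] at this
    exact measurableSet_lt this measurable_const
  classical
  set W : Ω → Lp F 2 ν := fun ω ↦ if h : eLpNorm (fun k ↦ Z' (ω, k)) 2 ν < ∞ then
    MemLp.toLp (fun k ↦ Z' (ω, k)) ⟨(hsec ω).aestronglyMeasurable, h⟩ else 0 with hW
  let : MeasurableSpace (Lp F 2 ν) := borel _
  have : BorelSpace (Lp F 2 ν) := ⟨rfl⟩
  have hWm : Measurable W := by
    refine measurable_of_measurable_edist fun c ↦ ?_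
    have hc : StronglyMeasurable (c : K → F) := Lp.stronglyMeasurable c
    have h1 : (fun ω ↦ edist (W ω) c) =
        S.piecewise
          (fun ω ↦ eLpNorm (fun k ↦ Z' (ω, k) - c k) 2 ν) (fun _ ↦ edist 0 c) := by
      ext ω
      by_cases h : eLpNorm (fun k ↦ Z' (ω, k)) 2 ν < ∞
      · rw [Set.piecewise_eq_of_mem S _ _ h]
        simp only [hW, dif_pos h]
        rw [Lp.edist_def]
        refine eLpNorm_congr_ae ?_
        filter_upwards [MemLp.coeFn_toLp (⟨(hsec ω).aestronglyMeasurable, h⟩ :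
          MemLp (fun k ↦ Z' (ω, k)) 2 ν)] with k hk
        simp [hk]
      · rw [Set.piecewise_eq_of_notMem S _ _ h]
        simp only [hW, dif_neg h]
    rw [h1]
    exact (hnorm c hc.measurable).piecewise hmeas measurable_const
  refine ⟨W, hWm.stronglyMeasurable, ?_⟩
  have hfin : ∀ᵐ ω ∂P, eLpNorm (fun k ↦ Z' (ω, k)) 2 ν < ∞ := by
    have h1 : MemLp Z' 2 (P.prod ν) := (memLp_congr_ae hZZ).1 hZ
    have h2 := (eLpNorm_lt_top_iff_lintegral_rpow_enorm_lt_top (by simp) (by simp)).1 h1.2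
    rw [lintegral_prod _ (hZm.enorm.pow_const _).aemeasurable] at h2
    have h3 := ae_lt_top (hZm.enorm.pow_const _).lintegral_prod_right' h2.ne
    filter_upwards [h3] with ω hω
    exact (eLpNorm_lt_top_iff_lintegral_rpow_enorm_lt_top (by simp) (by simp)).2 hω
  filter_upwards [hfin, Measure.ae_ae_of_ae_prod hZZ] with ω hω hω'
  simp only [hW, dif_pos hω]
  exact (MemLp.coeFn_toLp _).trans (EventuallyEq.symm hω')

end Currying

/-! ### Fourier transform of the regularized current and its second moments -/

section FourierApprox

variable {Ω : Type*} {d : ℕ} {X : ℝ≥0 → Ω → EuclideanSpace ℝ (Fin d)}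

/-- The integrand of the Fourier transform of the regularized current. -/
noncomputable def incrementField (X : ℝ≥0 → Ω → EuclideanSpace ℝ (Fin d)) (ε : ℝ)
    (k : EuclideanSpace ℝ (Fin d)) (ω : Ω) (t : ℝ) : EuclideanSpace ℂ (Fin d) :=
  Complex.exp (-(Complex.I * ((inner ℝ ((2 * Real.pi) • k) (X t.toNNReal ω) : ℝ) : ℂ))) •
    complexify d (ε⁻¹ • (X (t + ε).toNNReal ω - X t.toNNReal ω))

/-- The Fourier transform
`∫₀ᵀ e^{-2πi⟨k, X_t⟩} (X_{t+ε} - X_t) / ε dt` of the regularized current. -/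
noncomputable def fourierApprox (X : ℝ≥0 → Ω → EuclideanSpace ℝ (Fin d)) (T ε : ℝ)
    (z : Ω × EuclideanSpace ℝ (Fin d)) : EuclideanSpace ℂ (Fin d) :=
  ∫ t in Set.Ioc 0 T, incrementField X ε z.2 z.1 t

theorem inner_complexify (v w : EuclideanSpace ℝ (Fin d)) :
    inner ℂ (complexify d v) (complexify d w) = ((inner ℝ v w : ℝ) : ℂ) := by
  simp only [PiLp.inner_apply, complexify_apply]
  push_cast
  simp

theorem norm_complexify (v : EuclideanSpace ℝ (Fin d)) : ‖complexify d v‖ = ‖v‖ := by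
  simp [EuclideanSpace.norm_eq]

theorem norm_incrementField (ε : ℝ) (k : EuclideanSpace ℝ (Fin d)) (ω : Ω) (t : ℝ) :
    ‖incrementField X ε k ω t‖ = ‖ε⁻¹ • (X (t + ε).toNNReal ω - X t.toNNReal ω)‖ := by
  rw [incrementField, norm_smul, norm_complexify]
  have : -(Complex.I * ((inner ℝ ((2 * Real.pi) • k) (X t.toNNReal ω) : ℝ) : ℂ)) =
      Complex.I * ((-inner ℝ ((2 * Real.pi) • k) (X t.toNNReal ω) : ℝ) : ℂ) := by
    push_cast
    ring
  rw [this, norm_cexp_I_mul, one_mul]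

theorem inner_incrementField (ε δ : ℝ) (k : EuclideanSpace ℝ (Fin d)) (ω : Ω) (t s : ℝ) :
    inner ℂ (incrementField X ε k ω t) (incrementField X δ k ω s) =
      ((ε⁻¹ * δ⁻¹ : ℝ) : ℂ) * (((inner ℝ (X (t + ε).toNNReal ω - X t.toNNReal ω)
        (X (s + δ).toNNReal ω - X s.toNNReal ω) : ℝ) : ℂ) * Complex.exp (Complex.I *
          ((inner ℝ ((2 * Real.pi) • k) (X t.toNNReal ω - X s.toNNReal ω) : ℝ) : ℂ))) := by
  have key : ∀ (a b : ℂ) (v w : EuclideanSpace ℝ (Fin d)),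
      inner ℂ (a • complexify d v) (b • complexify d w) =
        starRingEnd ℂ a * b * ((inner ℝ v w : ℝ) : ℂ) := fun a b v w ↦ by
    rw [inner_smul_left, inner_smul_right, inner_complexify]
    ring
  rw [incrementField, incrementField, key,
    real_inner_smul_left (X (t + ε).toNNReal ω - X t.toNNReal ω),
    real_inner_smul_right (X (t + ε).toNNReal ω - X t.toNNReal ω), ← Complex.exp_conj,
    inner_sub_right ((2 * Real.pi) • k)]
  have h : Complex.exp (Complex.I * ((inner ℝ ((2 * Real.pi) • k) (X t.toNNReal ω) -
      inner ℝ ((2 * Real.pi) • k) (X s.toNNReal ω) : ℝ) : ℂ)) =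
      Complex.exp (starRingEnd ℂ
        (-(Complex.I * ((inner ℝ ((2 * Real.pi) • k) (X t.toNNReal ω) : ℝ) : ℂ)))) *
      Complex.exp (-(Complex.I * ((inner ℝ ((2 * Real.pi) • k) (X s.toNNReal ω) : ℝ) : ℂ))) := by
    rw [← Complex.exp_add]
    congr 1
    simp only [map_neg, map_mul, Complex.conj_I, Complex.conj_ofReal]
    push_cast
    ring
  rw [h]
  push_cast
  ring

theorem continuous_incrementField (hc : ∀ ω, Continuous fun t ↦ X t ω) (ε : ℝ)
    (k : EuclideanSpace ℝ (Fin d)) (ω : Ω) : Continuous (incrementField X ε k ω) := by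
  have h1 : Continuous fun t : ℝ ↦ X t.toNNReal ω := (hc ω).comp continuous_real_toNNReal
  have h2 : Continuous fun t : ℝ ↦ X (t + ε).toNNReal ω :=
    h1.comp (continuous_id.add continuous_const)
  unfold incrementField
  fun_prop

theorem integrable_incrementField (hc : ∀ ω, Continuous fun t ↦ X t ω) (ε T : ℝ)
    (k : EuclideanSpace ℝ (Fin d)) (ω : Ω) :
    Integrable (incrementField X ε k ω) (volume.restrict (Set.Ioc 0 T)) :=
  ((continuous_incrementField hc ε k ω).integrableOn_Icc (a := 0) (b := T)).mono_set
    Set.Ioc_subset_Icc_self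

theorem inner_fourierApprox (hc : ∀ ω, Continuous fun t ↦ X t ω) (T ε δ : ℝ) (ω : Ω)
    (k : EuclideanSpace ℝ (Fin d)) :
    inner ℂ (fourierApprox X T ε (ω, k)) (fourierApprox X T δ (ω, k)) =
      ∫ z, inner ℂ (incrementField X ε k ω z.1) (incrementField X δ k ω z.2)
        ∂((volume.restrict (Set.Ioc 0 T)).prod (volume.restrict (Set.Ioc 0 T))) := by
  have h1 := integrable_incrementField hc ε T k ω
  have h2 := integrable_incrementField hc δ T k ω
  have hint : Integrable (fun z : ℝ × ℝ ↦
      inner ℂ (incrementField X ε k ω z.1) (incrementField X δ k ω z.2))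
      ((volume.restrict (Set.Ioc 0 T)).prod (volume.restrict (Set.Ioc 0 T))) := by
    refine (h1.norm.mul_prod h2.norm).mono' ?_ (ae_of_all _ fun z ↦ norm_inner_le_norm _ _)
    have c1 := continuous_incrementField hc ε k ω
    have c2 := continuous_incrementField hc δ k ω
    exact ((c1.comp continuous_fst).inner (c2.comp continuous_snd)).aestronglyMeasurable
  rw [integral_prod _ hint]
  have e1 : ∀ t, ∫ s in Set.Ioc 0 T, inner ℂ (incrementField X ε k ω t) (incrementField X δ k ω s) =
      starRingEnd ℂ (inner ℂ (fourierApprox X T δ (ω, k)) (incrementField X ε k ω t)) := fun t ↦ by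
    rw [integral_inner h2, inner_conj_symm, fourierApprox]
  simp_rw [e1]
  rw [integral_conj, integral_inner h1, inner_conj_symm]
  rfl

variable [MeasurableSpace Ω] {P : Measure Ω} {H : ℝ}

theorem IsFBM.measurable (hX : IsFBM H X P) (t : ℝ≥0) : Measurable (X t) := by
  have h : Measurable fun ω i ↦ X t ω i :=
    measurable_pi_lambda _ fun i ↦ (hX.component i).measurable t
  exact (WithLp.measurable_toLp 2 (Fin d → ℝ)).comp h

theorem IsFBM.measurable_uncurry (hX : IsFBM H X P) (hc : ∀ ω, Continuous fun t ↦ X t ω) :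
    Measurable fun z : Ω × ℝ ↦ X z.2.toNNReal z.1 := by
  have h := measurable_uncurry_of_continuous_of_measurable (u := X) hc hX.measurable
  exact h.comp ((measurable_real_toNNReal.comp measurable_snd).prodMk measurable_fst)

theorem measurable_incrementField (hX : IsFBM H X P) (hc : ∀ ω, Continuous fun t ↦ X t ω) (ε : ℝ) :
    Measurable fun z : (Ω × EuclideanSpace ℝ (Fin d)) × ℝ ↦ incrementField X ε z.1.2 z.1.1 z.2 := by
  have h := hX.measurable_uncurry hc
  have h1 : Measurable fun z : (Ω × EuclideanSpace ℝ (Fin d)) × ℝ ↦ X z.2.toNNReal z.1.1 :=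
    h.comp (measurable_fst.fst.prodMk measurable_snd)
  have h2 : Measurable fun z : (Ω × EuclideanSpace ℝ (Fin d)) × ℝ ↦ X (z.2 + ε).toNNReal z.1.1 :=
    h.comp (measurable_fst.fst.prodMk (measurable_snd.add_const ε))
  have h3 : Measurable fun z : (Ω × EuclideanSpace ℝ (Fin d)) × ℝ ↦ z.1.2 := measurable_fst.snd
  have h4 := (complexify d).continuous.measurable.comp ((h2.sub h1).const_smul ε⁻¹)
  have h5 : Measurable fun z : (Ω × EuclideanSpace ℝ (Fin d)) × ℝ ↦
      Complex.exp (-(Complex.I * ((inner ℝ ((2 * Real.pi) • z.1.2) (X z.2.toNNReal z.1.1) : ℝ) :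
        ℂ))) :=
    Complex.measurable_exp.comp ((Complex.measurable_ofReal.comp
      ((h3.const_smul (2 * Real.pi)).inner h1)).const_mul Complex.I).neg
  exact h5.smul h4

theorem stronglyMeasurable_fourierApprox (hX : IsFBM H X P)
    (hc : ∀ ω, Continuous fun t ↦ X t ω) (T ε : ℝ) : StronglyMeasurable (fourierApprox X T ε) :=
  (measurable_incrementField hX hc ε).stronglyMeasurable.integral_prod_right'

theorem IsFBM.integral_norm_sub_sq (hX : IsFBM H X P) (hH : 0 < H) (t s : ℝ≥0) :
    Integrable (fun ω ↦ ‖X t ω - X s ω‖ ^ 2) P ∧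
      ∫ ω, ‖X t ω - X s ω‖ ^ 2 ∂P = d * |(t : ℝ) - s| ^ (2 * H) := by
  have h1 : ∀ ω, ‖X t ω - X s ω‖ ^ 2 =
      ∑ i, (X t ω i - X s ω i) * (X t ω i - X s ω i) := fun ω ↦ by
    rw [EuclideanSpace.real_norm_sq_eq]
    simp [sq]
  have h2 : ∀ i, Integrable (fun ω ↦ (X t ω i - X s ω i) * (X t ω i - X s ω i)) P := fun i ↦
    ((hX.component i).memLp_two_sub t s).integrable_mul ((hX.component i).memLp_two_sub t s)
  simp_rw [h1]
  refine ⟨integrable_finsetSum _ fun i _ ↦ h2 i, ?_⟩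
  rw [integral_finsetSum _ fun i _ ↦ h2 i]
  simp_rw [fun i ↦ (hX.component i).integral_sub_mul_sub t s t s]
  rw [Finset.sum_const, Finset.card_univ, Fintype.card_fin, nsmul_eq_mul, sub_self, sub_self,
    abs_zero, Real.zero_rpow (by positivity), abs_sub_comm (s : ℝ)]
  ring

theorem IsFBM.integral_norm_incrementField_sq (hX : IsFBM H X P) (hH : 0 < H) {ε t : ℝ}
    (hε : 0 < ε) (ht : 0 ≤ t) (k : EuclideanSpace ℝ (Fin d)) :
    Integrable (fun ω ↦ ‖incrementField X ε k ω t‖ ^ 2) P ∧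
      ∫ ω, ‖incrementField X ε k ω t‖ ^ 2 ∂P = ε⁻¹ ^ 2 * (d * ε ^ (2 * H)) := by
  have h1 : ∀ ω, ‖incrementField X ε k ω t‖ ^ 2 =
      ε⁻¹ ^ 2 * ‖X (t + ε).toNNReal ω - X t.toNNReal ω‖ ^ 2 := fun ω ↦ by
    rw [norm_incrementField, norm_smul, mul_pow, Real.norm_eq_abs, sq_abs]
  obtain ⟨h2, h3⟩ := hX.integral_norm_sub_sq hH (t + ε).toNNReal t.toNNReal
  simp_rw [h1]
  refine ⟨h2.const_mul _, ?_⟩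
  rw [integral_const_mul, h3, Real.coe_toNNReal _ ht, Real.coe_toNNReal _ (by positivity),
    add_sub_cancel_left, abs_of_pos hε]

/-- The Gaussian formula with `x = 2πk`. All covariances depend on `t - s` only, by stationarity of
the increments. -/
theorem IsFBM.integral_inner_incrementField (hX : IsFBM H X P) (hH : 0 < H) {ε δ t s : ℝ}
    (hε : 0 < ε) (hδ : 0 < δ) (ht : 0 ≤ t) (hs : 0 ≤ s) (k : EuclideanSpace ℝ (Fin d)) :
    ∫ ω, inner ℂ (incrementField X ε k ω t) (incrementField X δ k ω s) ∂P =
      ((kernel d (2 * H) (‖(2 * Real.pi) • k‖ ^ 2) ε δ (t - s) : ℝ) : ℂ) := by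
  simp_rw [inner_incrementField]
  rw [integral_const_mul, hX.integral_inner_mul_cexp, ← Complex.ofReal_mul]
  congr 1
  rw [Real.coe_toNNReal _ ht, Real.coe_toNNReal _ hs, Real.coe_toNNReal _ (by positivity),
    Real.coe_toNNReal _ (by positivity)]
  have h0 : |(0 : ℝ)| ^ (2 * H) = 0 := by
    rw [abs_zero, Real.zero_rpow (by positivity)]
  have e1 : t + ε - s = t - s + ε := by ring
  have e2 : t - (s + δ) = t - s - δ := by ring
  have e3 : t + ε - (s + δ) = t - s + ε - δ := by ring
  have e4 : |s - (t + ε)| = |t - s + ε| := by rw [abs_sub_comm, e1]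
  have e5 : |t - (t + ε)| = |ε| := by rw [sub_add_cancel_left, abs_neg]
  have e6 : |s - t| = |t - s| := abs_sub_comm _ _
  have e7 : |s - (s + δ)| = |δ| := by rw [sub_add_cancel_left, abs_neg]
  have e8 : |-(t - s) + δ| = |t - s - δ| := by rw [← abs_neg]; ring_nf
  rw [kernel, incrCov, crossCov, crossCov, sub_self, sub_self, h0, e1, e2, e3, e4, e5, e6, e7, e8,
    abs_neg]
  have e9 : -(‖(2 * Real.pi) • k‖ ^ 2 * (1 / 2 * (|t - s| ^ (2 * H) + |t - s| ^ (2 * H) - 0 - 0))) =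
      -(‖(2 * Real.pi) • k‖ ^ 2 * |t - s| ^ (2 * H)) := by ring
  rw [e9]
  field_simp
  ring

/-- The justification for Fubini: the inner product is at most the sum of the two squared norms,
whose expectations do not depend on the times. -/
theorem IsFBM.integrable_inner_incrementField (hX : IsFBM H X P) [IsFiniteMeasure P] (hH : 0 < H)
    (hc : ∀ ω, Continuous fun t ↦ X t ω) (T : ℝ) {ε δ : ℝ} (hε : 0 < ε) (hδ : 0 < δ)
    (k : EuclideanSpace ℝ (Fin d)) :
    Integrable (fun z : Ω × (ℝ × ℝ) ↦
      inner ℂ (incrementField X ε k z.1 z.2.1) (incrementField X δ k z.1 z.2.2))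
      (P.prod ((volume.restrict (Set.Ioc 0 T)).prod (volume.restrict (Set.Ioc 0 T)))) := by
  set C : ℝ := ε⁻¹ ^ 2 * (d * ε ^ (2 * H)) + δ⁻¹ ^ 2 * (d * δ ^ (2 * H)) with hC
  have hm : ∀ η, Measurable fun z : Ω × ℝ ↦ incrementField X η k z.1 z.2 := fun η ↦
    (measurable_incrementField hX hc η).comp
      (f := fun z : Ω × ℝ ↦ ((z.1, k), z.2)) (by fun_prop)
  have hm1 : Measurable fun z : Ω × (ℝ × ℝ) ↦
      inner ℂ (incrementField X ε k z.1 z.2.1) (incrementField X δ k z.1 z.2.2) :=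
    ((hm ε).comp (f := fun z : Ω × (ℝ × ℝ) ↦ (z.1, z.2.1)) (by fun_prop)).inner
      ((hm δ).comp (f := fun z : Ω × (ℝ × ℝ) ↦ (z.1, z.2.2)) (by fun_prop))
  have hpos : ∀ᵐ z ∂((volume.restrict (Set.Ioc 0 T)).prod (volume.restrict (Set.Ioc 0 T))),
      0 ≤ z.1 ∧ 0 ≤ z.2 := by
    rw [Measure.prod_restrict]
    filter_upwards [ae_restrict_mem (measurableSet_Ioc.prod measurableSet_Ioc)] with z hz
    exact ⟨hz.1.1.le, hz.2.1.le⟩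
  have hle : ∀ ω t s, ‖inner ℂ (incrementField X ε k ω t) (incrementField X δ k ω s)‖ ≤
      ‖incrementField X ε k ω t‖ ^ 2 + ‖incrementField X δ k ω s‖ ^ 2 := fun ω t s ↦ by
    refine (norm_inner_le_norm _ _).trans ?_
    nlinarith [sq_nonneg (‖incrementField X ε k ω t‖ - ‖incrementField X δ k ω s‖),
      sq_nonneg ‖incrementField X ε k ω t‖, sq_nonneg ‖incrementField X δ k ω s‖]
  rw [integrable_prod_iff' hm1.aestronglyMeasurable]
  constructor
  · filter_upwards [hpos] with z hz
    refine ((hX.integral_norm_incrementField_sq hH hε hz.1 k).1.add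
      (hX.integral_norm_incrementField_sq hH hδ hz.2 k).1).mono' ?_ (ae_of_all _ fun ω ↦ hle _ _ _)
    exact (hm1.comp (measurable_prodMk_right (y := z))).aestronglyMeasurable
  · refine Integrable.mono' (integrable_const C) ?_ ?_
    · exact hm1.stronglyMeasurable.norm.integral_prod_left'.aestronglyMeasurable
    · filter_upwards [hpos] with z hz
      obtain ⟨i1, j1⟩ := hX.integral_norm_incrementField_sq hH hε hz.1 k
      obtain ⟨i2, j2⟩ := hX.integral_norm_incrementField_sq hH hδ hz.2 k
      rw [Real.norm_of_nonneg (integral_nonneg fun ω ↦ norm_nonneg _), hC, ← j1, ← j2,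
        ← integral_add i1 i2]
      exact integral_mono_of_nonneg (ae_of_all _ fun ω ↦ norm_nonneg _) (i1.add i2)
        (ae_of_all _ fun ω ↦ hle _ _ _)

theorem IsFBM.integral_inner_fourierApprox (hX : IsFBM H X P) [IsFiniteMeasure P] (hH : 0 < H)
    (hc : ∀ ω, Continuous fun t ↦ X t ω) (T : ℝ) {ε δ : ℝ} (hε : 0 < ε) (hδ : 0 < δ)
    (k : EuclideanSpace ℝ (Fin d)) :
    Integrable (fun ω ↦ inner ℂ (fourierApprox X T ε (ω, k)) (fourierApprox X T δ (ω, k))) P ∧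
    ∫ ω, inner ℂ (fourierApprox X T ε (ω, k)) (fourierApprox X T δ (ω, k)) ∂P =
      ((∫ t in Set.Ioc 0 T, ∫ s in Set.Ioc 0 T,
        kernel d (2 * H) (‖(2 * Real.pi) • k‖ ^ 2) ε δ (t - s) : ℝ) : ℂ) := by
  have hint := hX.integrable_inner_incrementField hH hc T hε hδ k
  simp_rw [inner_fourierApprox hc T ε δ _ k]
  refine ⟨hint.integral_prod_left, ?_⟩
  rw [integral_integral_swap hint]
  have hker : Integrable (fun z : ℝ × ℝ ↦
      kernel d (2 * H) (‖(2 * Real.pi) • k‖ ^ 2) ε δ (z.1 - z.2))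
      ((volume.restrict (Set.Ioc 0 T)).prod (volume.restrict (Set.Ioc 0 T))) := by
    have hcont : Continuous fun z : ℝ × ℝ ↦
        kernel d (2 * H) (‖(2 * Real.pi) • k‖ ^ 2) ε δ (z.1 - z.2) :=
      (continuous_kernel d (by positivity) _ ε δ).comp (continuous_fst.sub continuous_snd)
    rw [Measure.prod_restrict]
    exact (hcont.continuousOn.integrableOn_compact (isCompact_Icc.prod isCompact_Icc)).mono_set
      (Set.prod_mono Set.Ioc_subset_Icc_self Set.Ioc_subset_Icc_self)
  rw [← integral_prod (fun z : ℝ × ℝ ↦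
      kernel d (2 * H) (‖(2 * Real.pi) • k‖ ^ 2) ε δ (z.1 - z.2)) hker]
  refine Eq.trans (integral_congr_ae ?_) integral_ofReal
  have hpos : ∀ᵐ z ∂((volume.restrict (Set.Ioc 0 T)).prod (volume.restrict (Set.Ioc 0 T))),
      0 ≤ z.1 ∧ 0 ≤ z.2 := by
    rw [Measure.prod_restrict]
    filter_upwards [ae_restrict_mem (measurableSet_Ioc.prod measurableSet_Ioc)] with z hz
    exact ⟨hz.1.1.le, hz.2.1.le⟩
  filter_upwards [hpos] with z hz
  exact hX.integral_inner_incrementField hH hε hδ hz.1 hz.2 k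

end FourierApprox

/-! ### Square norms and completeness of `L^p` for families of functions -/

section SquareFunction

open scoped ENNReal

theorem norm_besselSymbol_sq {V : Type*} [NormedAddCommGroup V] (s : ℝ) (x : V) :
    ‖besselSymbol V s x‖ ^ 2 = (1 + ‖x‖ ^ 2) ^ s := by
  have h : 0 ≤ 1 + ‖x‖ ^ 2 := by positivity
  rw [besselSymbol, Complex.norm_real, Real.norm_of_nonneg (by positivity), ← Real.rpow_natCast,
    ← Real.rpow_mul h]
  congr 1
  push_cast
  ring

theorem lintegral_enorm_smul_rpow_two {Ω F : Type*} [MeasurableSpace Ω] {P : Measure Ω}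
    [NormedAddCommGroup F] [NormedSpace ℂ F] {U : Ω → F} (hU : Integrable (fun ω ↦ ‖U ω‖ ^ 2) P)
    (c : ℂ) :
    ∫⁻ ω, ‖c • U ω‖ₑ ^ (2 : ℝ) ∂P = ENNReal.ofReal (‖c‖ ^ 2 * ∫ ω, ‖U ω‖ ^ 2 ∂P) := by
  rw [← integral_const_mul, ofReal_integral_eq_lintegral_ofReal (hU.const_mul _)
    (ae_of_all _ fun ω ↦ by positivity)]
  refine lintegral_congr fun ω ↦ ?_
  rw [← ofReal_norm, ENNReal.ofReal_rpow_of_nonneg (norm_nonneg _) (by norm_num), norm_smul]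
  congr 1
  rw [Real.rpow_two, mul_pow]

theorem exists_tendsto_eLpNorm_sub {ι α E : Type*} [MeasurableSpace α] {μ : Measure α}
    [NormedAddCommGroup E] [CompleteSpace E] {p : ℝ≥0∞} [Fact (1 ≤ p)] {l : Filter ι} [l.NeBot]
    {f : ι → α → E} (hf : ∀ᶠ i in l, MemLp (f i) p μ)
    (hc : Tendsto (fun x : ι × ι ↦ eLpNorm (f x.1 - f x.2) p μ) (l ×ˢ l) (𝓝 0)) :
    ∃ g : α → E, MemLp g p μ ∧ Tendsto (fun i ↦ eLpNorm (f i - g) p μ) l (𝓝 0) := by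
  classical
  set F : ι → Lp E p μ := fun i ↦ if h : MemLp (f i) p μ then h.toLp else 0 with hF
  have hFf : ∀ i, MemLp (f i) p μ → F i =ᵐ[μ] f i := fun i hi ↦ by
    simp only [hF, dif_pos hi]
    exact hi.coeFn_toLp
  have hcauchy : Cauchy (l.map F) := by
    rw [cauchy_map_iff', tendsto_uniformity_iff_dist_tendsto_zero]
    have h1 := (ENNReal.tendsto_toReal ENNReal.zero_ne_top).comp hc
    rw [ENNReal.toReal_zero] at h1
    refine h1.congr' ?_
    filter_upwards [prod_mem_prod hf hf] with x hx
    rw [Lp.dist_def]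
    refine congrArg ENNReal.toReal (eLpNorm_congr_ae ?_)
    exact ((hFf _ hx.1).sub (hFf _ hx.2)).symm
  obtain ⟨g, hg⟩ := cauchy_map_iff_exists_tendsto.1 hcauchy
  refine ⟨g, Lp.memLp g, ?_⟩
  rw [Lp.tendsto_Lp_iff_tendsto_eLpNorm'] at hg
  refine hg.congr' ?_
  filter_upwards [hf] with i hi
  exact eLpNorm_congr_ae ((hFf i hi).sub EventuallyEq.rfl)

end SquareFunction

/-! ### The weighted Fourier transforms are Cauchy in `L²(P ⊗ dk)` -/

section WeightedApprox

open scoped ENNReal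

variable {Ω : Type*} {d : ℕ} {X : ℝ≥0 → Ω → EuclideanSpace ℝ (Fin d)}

/-- The second moment `E⟨Z_ε(k), Z_δ(k)⟩` of the Fourier transforms of the regularized currents. -/
noncomputable def secondMoment (d : ℕ) (H T : ℝ) (k : EuclideanSpace ℝ (Fin d)) (ε δ : ℝ) : ℝ :=
  ∫ t in Set.Ioc 0 T, ∫ s in Set.Ioc 0 T, kernel d (2 * H) (‖(2 * Real.pi) • k‖ ^ 2) ε δ (t - s)

/-- The Fourier transform of the regularized current, weighted so as to be square integrable. -/
noncomputable def weightedApprox (X : ℝ≥0 → Ω → EuclideanSpace ℝ (Fin d)) (T s ε : ℝ)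
    (z : Ω × EuclideanSpace ℝ (Fin d)) : EuclideanSpace ℂ (Fin d) :=
  besselSymbol (EuclideanSpace ℝ (Fin d)) (-s) z.2 • fourierApprox X T ε z

variable [MeasurableSpace Ω] {P : Measure Ω} {H : ℝ}

theorem stronglyMeasurable_weightedApprox (hX : IsFBM H X P)
    (hc : ∀ ω, Continuous fun t ↦ X t ω) (T s ε : ℝ) :
    StronglyMeasurable (weightedApprox X T s ε) :=
  ((hasTemperateGrowth_besselSymbol (-s)).1.continuous.stronglyMeasurable.comp_measurable
    measurable_snd).smul (stronglyMeasurable_fourierApprox hX hc T ε)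

theorem IsFBM.integral_norm_fourierApprox_sq (hX : IsFBM H X P) [IsFiniteMeasure P] (hH : 0 < H)
    (hc : ∀ ω, Continuous fun t ↦ X t ω) (T : ℝ) {ε : ℝ} (hε : 0 < ε)
    (k : EuclideanSpace ℝ (Fin d)) :
    Integrable (fun ω ↦ ‖fourierApprox X T ε (ω, k)‖ ^ 2) P ∧
      ∫ ω, ‖fourierApprox X T ε (ω, k)‖ ^ 2 ∂P = secondMoment d H T k ε ε := by
  obtain ⟨h1, h2⟩ := hX.integral_inner_fourierApprox hH hc T hε hε k
  have h3 : ∀ ω, ‖fourierApprox X T ε (ω, k)‖ ^ 2 =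
      (inner ℂ (fourierApprox X T ε (ω, k)) (fourierApprox X T ε (ω, k))).re := fun ω ↦
    norm_sq_eq_re_inner (𝕜 := ℂ) _
  simp_rw [h3]
  refine ⟨h1.re, ?_⟩
  have h4 := integral_re h1
  simp only [RCLike.re_eq_complex_re] at h4
  rw [h4, h2, Complex.ofReal_re, secondMoment]

theorem IsFBM.integral_norm_fourierApprox_sub_sq (hX : IsFBM H X P) [IsFiniteMeasure P]
    (hH : 0 < H) (hc : ∀ ω, Continuous fun t ↦ X t ω) (T : ℝ) {ε δ : ℝ} (hε : 0 < ε) (hδ : 0 < δ)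
    (k : EuclideanSpace ℝ (Fin d)) :
    Integrable (fun ω ↦ ‖fourierApprox X T ε (ω, k) - fourierApprox X T δ (ω, k)‖ ^ 2) P ∧
      ∫ ω, ‖fourierApprox X T ε (ω, k) - fourierApprox X T δ (ω, k)‖ ^ 2 ∂P =
        secondMoment d H T k ε ε - 2 * secondMoment d H T k ε δ + secondMoment d H T k δ δ := by
  obtain ⟨h1, h2⟩ := hX.integral_inner_fourierApprox hH hc T hε hδ k
  obtain ⟨i1, j1⟩ := hX.integral_norm_fourierApprox_sq hH hc T hε k
  obtain ⟨i2, j2⟩ := hX.integral_norm_fourierApprox_sq hH hc T hδ k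
  have h3 : ∀ ω, ‖fourierApprox X T ε (ω, k) - fourierApprox X T δ (ω, k)‖ ^ 2 =
      ‖fourierApprox X T ε (ω, k)‖ ^ 2 -
        2 * (inner ℂ (fourierApprox X T ε (ω, k)) (fourierApprox X T δ (ω, k))).re +
        ‖fourierApprox X T δ (ω, k)‖ ^ 2 := fun ω ↦ norm_sub_sq (𝕜 := ℂ) _ _
  have h4 := integral_re h1
  have h5 := h1.re
  simp only [RCLike.re_eq_complex_re] at h4 h5
  simp_rw [h3]
  refine ⟨(i1.sub (h5.const_mul 2)).add i2, ?_⟩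
  rw [integral_add (by exact i1.sub (h5.const_mul 2)) i2, integral_sub i1 (h5.const_mul 2),
    integral_const_mul, h4, h2, j1, j2, Complex.ofReal_re, secondMoment, secondMoment, secondMoment]

theorem exists_abs_secondMoment_le (d : ℕ) {H : ℝ} (hH : 1 / 2 ≤ H) (hH1 : H < 1) {θ : ℝ}
    (hθ : 0 ≤ θ) (hθp : 2 * H * θ < 2 * H - 1 ∨ θ = 0) {T : ℝ} (hT : 0 ≤ T) :
    ∃ C : ℝ, 0 ≤ C ∧ ∀ k ε, 0 < ε → ∀ δ, 0 < δ →
      |secondMoment d H T k ε δ| ≤ C * (1 + ‖k‖ ^ 2) ^ (-θ) := by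
  obtain ⟨C, hC, h⟩ := exists_abs_double_integral_kernel_le d (p := 2 * H) (by linarith)
    (by linarith) hθ hθp hT
  refine ⟨C, hC, fun k ε hε δ hδ ↦ (h _ (by positivity) ε hε δ hδ).trans ?_⟩
  refine mul_le_mul_of_nonneg_left ?_ hC
  refine Real.rpow_le_rpow_of_nonpos (by positivity) ?_ (by linarith)
  have h1 : (1 : ℝ) ≤ 2 * Real.pi := by linarith [Real.pi_gt_three]
  rw [norm_smul, Real.norm_of_nonneg (by positivity), mul_pow]
  nlinarith [sq_nonneg ‖k‖, one_le_pow₀ h1 (n := 2)]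

/-- The joint limit of the second moments also governs both diagonal terms, so the combination tends
to `L - 2L + L`. -/
theorem tendsto_secondMoment_defect (d : ℕ) {H : ℝ} (hH : 1 / 2 ≤ H) (hH1 : H < 1) {T : ℝ}
    (hT : 0 ≤ T) (k : EuclideanSpace ℝ (Fin d)) :
    Tendsto (fun x : ℝ × ℝ ↦ secondMoment d H T k x.1 x.1 - 2 * secondMoment d H T k x.1 x.2 +
      secondMoment d H T k x.2 x.2) (𝓝[>] 0 ×ˢ 𝓝[>] 0) (𝓝 0) := by
  obtain ⟨L, hL⟩ := exists_tendsto_double_integral_kernel d (p := 2 * H) (by linarith)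
    (by linarith) hT (y := ‖(2 * Real.pi) • k‖ ^ 2) (by positivity)
  have h1 : Tendsto (fun x : ℝ × ℝ ↦ secondMoment d H T k x.1 x.2) (𝓝[>] 0 ×ˢ 𝓝[>] 0) (𝓝 L) := hL
  have h2 := h1.comp ((tendsto_fst (g := 𝓝[>] (0 : ℝ))).prodMk tendsto_fst)
  have h3 := h1.comp ((tendsto_snd (f := 𝓝[>] (0 : ℝ))).prodMk tendsto_snd)
  have h4 := (h2.sub (h1.const_mul 2)).add h3
  have h5 : L - 2 * L + L = 0 := by ring
  rw [h5] at h4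
  exact h4

theorem eLpNorm_weighted_eq [SFinite P] (s : ℝ) {U : Ω × EuclideanSpace ℝ (Fin d) →
    EuclideanSpace ℂ (Fin d)} (hU : StronglyMeasurable fun z : Ω × EuclideanSpace ℝ (Fin d) ↦
      besselSymbol (EuclideanSpace ℝ (Fin d)) (-s) z.2 • U z) :
    eLpNorm (fun z ↦ besselSymbol (EuclideanSpace ℝ (Fin d)) (-s) z.2 • U z) 2 (P.prod volume) =
      (∫⁻ k, ∫⁻ ω, ‖besselSymbol (EuclideanSpace ℝ (Fin d)) (-s) k • U (ω, k)‖ₑ ^ (2 : ℝ) ∂P) ^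
        (1 / 2 : ℝ) := by
  rw [eLpNorm_eq_lintegral_rpow_enorm_toReal (by simp) (by simp)]
  simp only [ENNReal.toReal_ofNat]
  rw [lintegral_prod_symm' _ (hU.enorm.pow_const _)]

/-- The origin of the threshold: some `θ` with `d/2 - α < θ < 1 - 1/(2H)` exists precisely because
`α > α_H`. At `H = 1/2` the assumption reads `α > d/2` and no decay is needed. -/
theorem exists_decay_exponent {H α : ℝ} (hH : 1 / 2 ≤ H)
    (hα : (d : ℝ) / 2 - 1 + 1 / (2 * H) < α) :
    ∃ θ : ℝ, 0 ≤ θ ∧ (2 * H * θ < 2 * H - 1 ∨ θ = 0) ∧ (d : ℝ) < 2 * (α + θ) := by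
  rcases hH.eq_or_lt with rfl | hH
  · refine ⟨0, le_rfl, Or.inr rfl, ?_⟩
    norm_num at hα
    linarith
  · have hH0 : 0 < 2 * H := by linarith
    have h1 : 1 / (2 * H) < 1 := by
      rw [div_lt_one hH0]
      linarith
    obtain ⟨θ, h2, h3⟩ := exists_between (a₁ := max 0 ((d : ℝ) / 2 - α)) (a₂ := 1 - 1 / (2 * H))
      (max_lt (by linarith) (by linarith))
    have h4 := (le_max_left _ _).trans_lt h2
    have h5 := (le_max_right _ _).trans_lt h2
    refine ⟨θ, h4.le, Or.inl ?_, by linarith⟩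
    have h6 := mul_lt_mul_of_pos_left h3 hH0
    have h7 : 2 * H * (1 - 1 / (2 * H)) = 2 * H - 1 := by field_simp
    linarith

theorem lintegral_weight_lt_top (C : ℝ) {α θ : ℝ} (h : (d : ℝ) < 2 * (α + θ)) :
    ∫⁻ k : EuclideanSpace ℝ (Fin d), ENNReal.ofReal ((1 + ‖k‖ ^ 2) ^ (-α) *
      (C * (1 + ‖k‖ ^ 2) ^ (-θ))) < ∞ := by
  have h1 : Integrable fun k : EuclideanSpace ℝ (Fin d) ↦
      (1 + ‖k‖ ^ 2) ^ (-(2 * (α + θ)) / 2) :=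
    integrable_rpow_neg_one_add_norm_sq (by simpa using h)
  have h2 := h1.const_mul C
  have h3 : ∀ k : EuclideanSpace ℝ (Fin d), (1 + ‖k‖ ^ 2) ^ (-α) * (C * (1 + ‖k‖ ^ 2) ^ (-θ)) =
      C * (1 + ‖k‖ ^ 2) ^ (-(2 * (α + θ)) / 2) := fun k ↦ by
    have h4 : -(2 * (α + θ)) / 2 = -α + -θ := by ring
    rw [h4, Real.rpow_add (by positivity)]
    ring
  simp_rw [h3]
  exact h2.lintegral_lt_top

theorem IsFBM.memLp_weightedApprox (hX : IsFBM H X P) [IsFiniteMeasure P] (hH : 1 / 2 ≤ H)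
    (hH1 : H < 1) (hc : ∀ ω, Continuous fun t ↦ X t ω) {T : ℝ} (hT : 0 ≤ T) {α : ℝ}
    (hα : (d : ℝ) / 2 - 1 + 1 / (2 * H) < α) {ε : ℝ} (hε : 0 < ε) :
    MemLp (weightedApprox X T α ε) 2 (P.prod volume) := by
  obtain ⟨θ, hθ, hθp, hd⟩ := exists_decay_exponent hH hα
  obtain ⟨C, hC, hb⟩ := exists_abs_secondMoment_le d hH hH1 hθ hθp hT
  have hm := stronglyMeasurable_weightedApprox hX hc T α ε
  refine ⟨hm.aestronglyMeasurable, ?_⟩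
  have h1 := eLpNorm_weighted_eq (P := P) α hm
  refine h1.trans_lt (ENNReal.rpow_lt_top_of_nonneg (by norm_num) (ne_of_lt ?_))
  refine (lintegral_mono fun k ↦ ?_).trans_lt (lintegral_weight_lt_top C hd)
  obtain ⟨i1, j1⟩ := hX.integral_norm_fourierApprox_sq (by linarith) hc T hε k
  rw [lintegral_enorm_smul_rpow_two i1, j1, norm_besselSymbol_sq]
  exact ENNReal.ofReal_le_ofReal (mul_le_mul_of_nonneg_left
    ((le_abs_self _).trans (hb k ε hε ε hε)) (by positivity))

theorem IsFBM.tendsto_eLpNorm_weightedApprox_sub (hX : IsFBM H X P) [IsFiniteMeasure P]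
    (hH : 1 / 2 ≤ H) (hH1 : H < 1) (hc : ∀ ω, Continuous fun t ↦ X t ω) {T : ℝ} (hT : 0 ≤ T)
    {α : ℝ} (hα : (d : ℝ) / 2 - 1 + 1 / (2 * H) < α) :
    Tendsto (fun x : ℝ × ℝ ↦ eLpNorm (weightedApprox X T α x.1 - weightedApprox X T α x.2) 2
      (P.prod volume)) (𝓝[>] 0 ×ˢ 𝓝[>] 0) (𝓝 0) := by
  obtain ⟨θ, hθ, hθp, hd⟩ := exists_decay_exponent hH hα
  obtain ⟨C, hC, hb⟩ := exists_abs_secondMoment_le d hH hH1 hθ hθp hT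
  have hsub : ∀ x : ℝ × ℝ, weightedApprox X T α x.1 - weightedApprox X T α x.2 = fun z ↦
      besselSymbol (EuclideanSpace ℝ (Fin d)) (-α) z.2 •
        (fourierApprox X T x.1 z - fourierApprox X T x.2 z) := fun x ↦ by
    ext1 z
    rw [Pi.sub_apply, weightedApprox, weightedApprox, smul_sub]
  have hm : ∀ x : ℝ × ℝ, StronglyMeasurable fun z : Ω × EuclideanSpace ℝ (Fin d) ↦
      besselSymbol (EuclideanSpace ℝ (Fin d)) (-α) z.2 •
        (fourierApprox X T x.1 z - fourierApprox X T x.2 z) := fun x ↦ by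
    rw [← hsub]
    exact (stronglyMeasurable_weightedApprox hX hc T α x.1).sub
      (stronglyMeasurable_weightedApprox hX hc T α x.2)
  simp_rw [hsub, fun x ↦ eLpNorm_weighted_eq (P := P) α (hm x)]
  have hpos : ∀ᶠ x : ℝ × ℝ in 𝓝[>] 0 ×ˢ 𝓝[>] 0, 0 < x.1 ∧ 0 < x.2 :=
    prod_mem_prod self_mem_nhdsWithin self_mem_nhdsWithin
  have hval : ∀ x : ℝ × ℝ, 0 < x.1 ∧ 0 < x.2 → ∀ k,
      ∫⁻ ω, ‖besselSymbol (EuclideanSpace ℝ (Fin d)) (-α) k •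
        (fourierApprox X T x.1 (ω, k) - fourierApprox X T x.2 (ω, k))‖ₑ ^ (2 : ℝ) ∂P =
      ENNReal.ofReal ((1 + ‖k‖ ^ 2) ^ (-α) * (secondMoment d H T k x.1 x.1 -
        2 * secondMoment d H T k x.1 x.2 + secondMoment d H T k x.2 x.2)) := fun x hx k ↦ by
    obtain ⟨i1, j1⟩ := hX.integral_norm_fourierApprox_sub_sq (by linarith) hc T hx.1 hx.2 k
    rw [lintegral_enorm_smul_rpow_two i1, j1, norm_besselSymbol_sq]
  have key : Tendsto (fun x : ℝ × ℝ ↦ ∫⁻ k, ∫⁻ ω, ‖besselSymbol (EuclideanSpace ℝ (Fin d)) (-α) k •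
      (fourierApprox X T x.1 (ω, k) - fourierApprox X T x.2 (ω, k))‖ₑ ^ (2 : ℝ) ∂P)
      (𝓝[>] 0 ×ˢ 𝓝[>] 0) (𝓝 (∫⁻ _ : EuclideanSpace ℝ (Fin d), 0)) := by
    refine tendsto_lintegral_filter_of_dominated_convergence
      -- The factor `4` counts the second moments in the defect with multiplicity, `1 + 2 + 1`.
      (fun k ↦ ENNReal.ofReal ((1 + ‖k‖ ^ 2) ^ (-α) * (4 * C * (1 + ‖k‖ ^ 2) ^ (-θ))))
      (Eventually.of_forall fun x ↦ ?_) ?_ (lintegral_weight_lt_top (4 * C) hd).ne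
      (ae_of_all _ fun k ↦ ?_)
    · exact ((hm x).enorm.pow_const _).lintegral_prod_left'
    · filter_upwards [hpos] with x hx
      refine ae_of_all _ fun k ↦ ?_
      rw [hval x hx k]
      refine ENNReal.ofReal_le_ofReal (mul_le_mul_of_nonneg_left ?_ (by positivity))
      have h1 := abs_le.1 (hb k x.1 hx.1 x.1 hx.1)
      have h2 := abs_le.1 (hb k x.1 hx.1 x.2 hx.2)
      have h3 := abs_le.1 (hb k x.2 hx.2 x.2 hx.2)
      linarith [h1.2, h2.1, h3.2]
    · have h1 := (tendsto_secondMoment_defect d hH hH1 hT k).const_mul ((1 + ‖k‖ ^ 2) ^ (-α))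
      rw [mul_zero] at h1
      have h2 := ENNReal.tendsto_ofReal h1
      rw [ENNReal.ofReal_zero] at h2
      refine h2.congr' ?_
      filter_upwards [hpos] with x hx
      exact (hval x hx k).symm
  rw [lintegral_zero] at key
  have h1 := (ENNReal.continuous_rpow_const (y := (1 / 2 : ℝ))).tendsto 0 |>.comp key
  rw [ENNReal.zero_rpow_of_pos (by norm_num)] at h1
  exact h1

end WeightedApprox

open FourierTransform

/-! ### The regularized forward integral expressed on the Fourier side -/

section FourierInversion

variable {Ω : Type*} {d : ℕ} {X : ℝ≥0 → Ω → EuclideanSpace ℝ (Fin d)}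

theorem inner_eq_re_integral_fourier (φ : 𝓢(EuclideanSpace ℝ (Fin d), EuclideanSpace ℝ (Fin d)))
    (x v : EuclideanSpace ℝ (Fin d)) :
    inner ℝ (φ x) v = (∫ k, inner ℂ
      (Complex.exp (-(Complex.I * ((inner ℝ ((2 * Real.pi) • k) x : ℝ) : ℂ))) • complexify d v)
      (𝓕 (φ.postcompCLM (complexify d)) k)).re := by
  set ψ := 𝓕 (φ.postcompCLM (complexify d)) with hψ
  have h1 : complexify d (φ x) =
      ∫ k, Complex.exp (((2 * Real.pi * inner ℝ k x : ℝ) : ℂ) * Complex.I) • ψ k := by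
    rw [← Real.fourierInv_eq', ← SchwartzMap.fourierInv_coe, hψ, fourierInv_fourier_eq]
    rfl
  have hint : Integrable fun k ↦
      Complex.exp (((2 * Real.pi * inner ℝ k x : ℝ) : ℂ) * Complex.I) • ψ k := by
    refine (ψ.integrable (μ := volume)).norm.mono'
      (Continuous.aestronglyMeasurable (by have := ψ.continuous; fun_prop)) (ae_of_all _ fun k ↦ ?_)
    rw [norm_smul, Complex.norm_exp_ofReal_mul_I, one_mul]
  have h2 : ∀ k, inner ℂ
      (Complex.exp (-(Complex.I * ((inner ℝ ((2 * Real.pi) • k) x : ℝ) : ℂ))) • complexify d v)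
      (ψ k) = inner ℂ (complexify d v)
        (Complex.exp (((2 * Real.pi * inner ℝ k x : ℝ) : ℂ) * Complex.I) • ψ k) := fun k ↦ by
    rw [inner_smul_left (𝕜 := ℂ), inner_smul_right (𝕜 := ℂ), ← Complex.exp_conj,
      real_inner_smul_left k]
    congr 2
    simp only [map_neg, map_mul, Complex.conj_I, Complex.conj_ofReal]
    ring
  simp_rw [h2]
  rw [integral_inner hint, ← h1, inner_complexify, Complex.ofReal_re, real_inner_comm]

/-- Fourier inversion of `φ` at the point `X_t`, followed by Fubini in `(t, k)`. -/
theorem forwardApprox_eq_re_integral (hc : ∀ ω, Continuous fun t ↦ X t ω) {T : ℝ} (hT : 0 ≤ T)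
    (ε : ℝ) (φ : 𝓢(EuclideanSpace ℝ (Fin d), EuclideanSpace ℝ (Fin d))) (ω : Ω) :
    forwardApprox X T ε φ ω = (∫ k, inner ℂ (fourierApprox X T ε (ω, k))
      (𝓕 (φ.postcompCLM (complexify d)) k)).re := by
  set ψ := 𝓕 (φ.postcompCLM (complexify d)) with hψ
  have c1 : Continuous fun t : ℝ ↦ X t.toNNReal ω := (hc ω).comp continuous_real_toNNReal
  have c2 : Continuous fun t : ℝ ↦ X (t + ε).toNNReal ω :=
    c1.comp (continuous_id.add continuous_const)
  have hcont : Continuous fun z : ℝ × EuclideanSpace ℝ (Fin d) ↦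
      inner ℂ (incrementField X ε z.2 ω z.1) (ψ z.2) := by
    have := ψ.continuous
    unfold incrementField
    fun_prop
  have hint : Integrable (fun z : ℝ × EuclideanSpace ℝ (Fin d) ↦
      inner ℂ (incrementField X ε z.2 ω z.1) (ψ z.2))
      ((volume.restrict (Set.Ioc 0 T)).prod volume) := by
    -- The norm of `incrementField` does not depend on the frequency, so frequency `0` provides a
    -- majorant for all.
    have h1 := integrable_incrementField hc ε T 0 ω
    refine (h1.norm.mul_prod (ψ.integrable (μ := volume)).norm).mono'
      hcont.aestronglyMeasurable (ae_of_all _ fun z ↦ ?_)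
    refine (norm_inner_le_norm _ _).trans_eq ?_
    rw [norm_incrementField, norm_incrementField]
  have h1 : ∀ t, inner ℝ (φ (X t.toNNReal ω)) (ε⁻¹ • (X (t + ε).toNNReal ω - X t.toNNReal ω)) =
      (∫ k, inner ℂ (incrementField X ε k ω t) (ψ k)).re := fun t ↦
    inner_eq_re_integral_fourier φ _ _
  have h2 : ∀ k, ∫ t in Set.Ioc 0 T, inner ℂ (incrementField X ε k ω t) (ψ k) =
      inner ℂ (fourierApprox X T ε (ω, k)) (ψ k) := fun k ↦ by
    have e1 : ∀ t, inner ℂ (incrementField X ε k ω t) (ψ k) =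
        starRingEnd ℂ (inner ℂ (ψ k) (incrementField X ε k ω t)) := fun t ↦
      (inner_conj_symm _ _).symm
    simp_rw [e1]
    rw [integral_conj, integral_inner (integrable_incrementField hc ε T k ω), inner_conj_symm]
    rfl
  rw [forwardApprox, intervalIntegral.integral_of_le hT]
  simp_rw [h1, ← h2]
  rw [← integral_integral_swap hint]
  exact integral_re hint.integral_prod_left

/-- The weight of order `-s` in `weightedApprox` cancels the symbol of order `s` applied to `φ`.
Thus the dependence on `ω` and `ε` is only through `w`, and continuously so. -/
theorem forwardApprox_eq_functionalOfBessel (hc : ∀ ω, Continuous fun t ↦ X t ω) {T : ℝ}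
    (hT : 0 ≤ T) (s ε : ℝ) (φ : 𝓢(EuclideanSpace ℝ (Fin d), EuclideanSpace ℝ (Fin d))) {ω : Ω}
    {w : Lp (EuclideanSpace ℂ (Fin d)) 2 (volume : Measure (EuclideanSpace ℝ (Fin d)))}
    (hw : w =ᵐ[volume] fun k ↦ weightedApprox X T s ε (ω, k)) :
    forwardApprox X T ε φ ω =
      functionalOfBessel d s (realFourierInv d w) (schwartzToSobolev s φ) := by
  rw [forwardApprox_eq_re_integral hc hT, functionalOfBessel_realFourierInv]
  congr 1
  refine integral_congr_ae ?_
  filter_upwards [hw] with k hk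
  rw [hk, weightedApprox, inner_smul_left, inner_smul_right, ← mul_assoc]
  have h : starRingEnd ℂ (besselSymbol (EuclideanSpace ℝ (Fin d)) (-s) k) *
      besselSymbol (EuclideanSpace ℝ (Fin d)) s k = 1 := by
    have h0 : (0 : ℝ) < 1 + ‖k‖ ^ 2 := by positivity
    rw [besselSymbol, besselSymbol, Complex.conj_ofReal, ← Complex.ofReal_mul, ← Real.rpow_add h0]
    simp [neg_div]
  rw [h, one_mul]

end FourierInversion

/-! ### Convergence of the forward integrals for continuous paths -/

section ForwardIntegral

open scoped ENNReal

theorem eLpNorm_curry_eq {Ω K F : Type*} [MeasurableSpace Ω] [MeasurableSpace K]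
    [NormedAddCommGroup F] {P : Measure Ω} {ν : Measure K} [SFinite ν]
    {Z : Ω × K → F} (hZ : AEStronglyMeasurable Z (P.prod ν)) {W : Ω → Lp F 2 ν}
    (h : ∀ᵐ ω ∂P, W ω =ᵐ[ν] fun k ↦ Z (ω, k)) : eLpNorm W 2 P = eLpNorm Z 2 (P.prod ν) := by
  rw [eLpNorm_eq_lintegral_rpow_enorm_toReal (by simp) (by simp),
    eLpNorm_eq_lintegral_rpow_enorm_toReal (by simp) (by simp)]
  simp only [ENNReal.toReal_ofNat]
  rw [lintegral_prod _ (hZ.enorm.pow_const _)]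
  congr 1
  refine lintegral_congr_ae ?_
  filter_upwards [h] with ω hω
  rw [Lp.enorm_def, eLpNorm_congr_ae hω, eLpNorm_eq_lintegral_rpow_enorm_toReal (by simp) (by simp)]
  simp only [ENNReal.toReal_ofNat]
  rw [← ENNReal.rpow_mul]
  norm_num

variable {Ω : Type*} [MeasurableSpace Ω] {P : Measure Ω} {H : ℝ} {d : ℕ}
  {X : ℝ≥0 → Ω → EuclideanSpace ℝ (Fin d)}

theorem stronglyMeasurable_forwardApprox (hX : IsFBM H X P)
    (hc : ∀ ω, Continuous fun t ↦ X t ω) {T : ℝ} (hT : 0 ≤ T) (ε : ℝ)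
    (φ : 𝓢(EuclideanSpace ℝ (Fin d), EuclideanSpace ℝ (Fin d))) :
    StronglyMeasurable (forwardApprox X T ε φ) := by
  have h := hX.measurable_uncurry hc
  have h2 : Measurable fun z : Ω × ℝ ↦ X (z.2 + ε).toNNReal z.1 :=
    h.comp (measurable_fst.prodMk (measurable_snd.add_const ε))
  have h3 := (Measurable.inner (𝕜 := ℝ) (φ.continuous.measurable.comp h)
    ((h2.sub h).const_smul ε⁻¹)).stronglyMeasurable
  have h4 := h3.integral_prod_right' (ν := volume.restrict (Set.Ioc 0 T))
  convert! h4 using 1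
  ext ω
  rw [forwardApprox, intervalIntegral.integral_of_le hT]
  rfl

/-- The random element `W` is the curried `L²` limit and is chosen before `φ`; this uniformity is
the pathwise redefinition. For fixed `φ` the error is at most `‖Λ‖` times the `L²(P ⊗ dk)` distance,
so convergence holds in `L²(P)` and hence in probability. -/
theorem IsFBM.exists_isForwardIntegral (hX : IsFBM H X P) [IsFiniteMeasure P] (hH : 1 / 2 ≤ H)
    (hH1 : H < 1) (hc : ∀ ω, Continuous fun t ↦ X t ω) {T : ℝ} (hT : 0 ≤ T) {α : ℝ}
    (hα : (d : ℝ) / 2 - 1 + 1 / (2 * H) < α) :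
    ∃ W : Ω → Lp (EuclideanSpace ℂ (Fin d)) 2 (volume : Measure (EuclideanSpace ℝ (Fin d))),
      StronglyMeasurable W ∧
      ∀ φ : 𝓢(EuclideanSpace ℝ (Fin d), EuclideanSpace ℝ (Fin d)), IsForwardIntegral P X T φ
        fun ω ↦ functionalOfBessel d α (realFourierInv d (W ω)) (schwartzToSobolev α φ) := by
  have hL : ∀ ε : ℝ, 0 < ε → MemLp (weightedApprox X T α ε) 2 (P.prod volume) := fun ε hε ↦
    hX.memLp_weightedApprox hH hH1 hc hT hα hε
  obtain ⟨z, hz, hlim⟩ := exists_tendsto_eLpNorm_sub (l := 𝓝[>] (0 : ℝ))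
    (by filter_upwards [self_mem_nhdsWithin] with ε hε using hL ε hε)
    (hX.tendsto_eLpNorm_weightedApprox_sub hH hH1 hc hT hα)
  obtain ⟨W, hWm, hW⟩ := exists_stronglyMeasurable_toLp hz
  refine ⟨W, hWm, fun φ ↦ ?_⟩
  set Λ : Lp (EuclideanSpace ℂ (Fin d)) 2 (volume : Measure (EuclideanSpace ℝ (Fin d))) →L[ℝ] ℝ :=
    ((ContinuousLinearMap.apply ℝ ℝ (schwartzToSobolev α φ)).comp
      (functionalOfBessel d α)).comp (realFourierInv d) with hΛ
  have hΛW : StronglyMeasurable fun ω ↦ Λ (W ω) := Λ.continuous.comp_stronglyMeasurable hWm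
  refine ⟨hΛW.measurable.aemeasurable, ?_⟩
  refine tendstoInMeasure_of_tendsto_eLpNorm (p := 2) (by simp)
    (fun ε ↦ (stronglyMeasurable_forwardApprox hX hc hT ε φ).aestronglyMeasurable)
    hΛW.aestronglyMeasurable ?_
  have hbound : ∀ ε : ℝ, 0 < ε → eLpNorm (forwardApprox X T ε φ - fun ω ↦ Λ (W ω)) 2 P ≤
      ENNReal.ofReal ‖Λ‖ * eLpNorm (weightedApprox X T α ε - z) 2 (P.prod volume) := fun ε hε ↦ by
    obtain ⟨V, hVm, hV⟩ := exists_stronglyMeasurable_toLp (hL ε hε)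
    have h1 : eLpNorm (V - W) 2 P = eLpNorm (weightedApprox X T α ε - z) 2 (P.prod volume) := by
      refine eLpNorm_curry_eq ((hL ε hε).sub hz).aestronglyMeasurable ?_
      filter_upwards [hV, hW] with ω h1 h2
      exact (Lp.coeFn_sub _ _).trans (h1.sub h2)
    rw [← h1]
    refine eLpNorm_le_mul_eLpNorm_of_ae_le_mul ?_ 2
    filter_upwards [hV] with ω hω
    have h2 : forwardApprox X T ε φ ω = Λ (V ω) :=
      forwardApprox_eq_functionalOfBessel hc hT α ε φ hω
    rw [Pi.sub_apply, Pi.sub_apply, h2, ← map_sub]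
    exact Λ.le_opNorm _
  have h3 : Tendsto (fun ε ↦ ENNReal.ofReal ‖Λ‖ *
      eLpNorm (weightedApprox X T α ε - z) 2 (P.prod volume)) (𝓝[>] 0) (𝓝 0) := by
    have := ENNReal.Tendsto.const_mul (a := ENNReal.ofReal ‖Λ‖) hlim (Or.inr ENNReal.ofReal_ne_top)
    rwa [mul_zero] at this
  refine tendsto_of_tendsto_of_tendsto_of_le_of_le' tendsto_const_nhds h3
    (Eventually.of_forall fun _ ↦ bot_le) ?_
  filter_upwards [self_mem_nhdsWithin] with ε hε using hbound ε hε

end ForwardIntegral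

theorem forwardApprox_congr {Ω : Type*} {d : ℕ} {X X' : ℝ≥0 → Ω → EuclideanSpace ℝ (Fin d)} {ω : Ω}
    (h : ∀ t, X' t ω = X t ω) (T ε : ℝ)
    (φ : EuclideanSpace ℝ (Fin d) → EuclideanSpace ℝ (Fin d)) :
    forwardApprox X' T ε φ ω = forwardApprox X T ε φ ω := by
  rw [forwardApprox, forwardApprox]
  simp_rw [h]

/-! ### Reduction to everywhere continuous paths, and uniqueness of the limit -/

section Modification

variable {Ω : Type*} [MeasurableSpace Ω] {P : Measure Ω} {H : ℝ}

theorem IsFBMReal.congr {B B' : ℝ≥0 → Ω → ℝ} (hB : IsFBMReal H B P)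
    (hm : ∀ t, Measurable (B' t)) (h : ∀ᵐ ω ∂P, ∀ t, B' t ω = B t ω) : IsFBMReal H B' P := by
  have h1 : ∀ t, B' t =ᵐ[P] B t := fun t ↦ h.mono fun ω hω ↦ hω t
  have h2 : ∀ t, P[B' t] = P[B t] := fun t ↦ integral_congr_ae (h1 t)
  refine ⟨hm, hB.gaussian.congr fun t ↦ (h1 t).symm, fun t ↦ (h2 t).trans (hB.mean t),
    fun s t ↦ ?_, ?_⟩
  · refine Eq.trans ?_ (hB.covariance s t)
    rw [ProbabilityTheory.covariance, ProbabilityTheory.covariance, h2, h2]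
    refine integral_congr_ae ?_
    filter_upwards [h1 s, h1 t] with ω hs ht
    rw [hs, ht]
  · filter_upwards [h, hB.continuous_paths] with ω hω hc
    simp_rw [hω]
    exact hc

theorem IsFBM.congr {d : ℕ} {X X' : ℝ≥0 → Ω → EuclideanSpace ℝ (Fin d)} (hX : IsFBM H X P)
    (hm : ∀ t, Measurable (X' t)) (h : ∀ᵐ ω ∂P, ∀ t, X' t ω = X t ω) : IsFBM H X' P := by
  refine ⟨fun i ↦ (hX.component i).congr (fun t ↦ ?_) ?_, hX.indep.congr fun i ↦ ?_⟩
  · exact (EuclideanSpace.proj (𝕜 := ℝ) i).continuous.measurable.comp (hm t)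
  · filter_upwards [h] with ω hω t
    rw [hω]
  · filter_upwards [h] with ω hω
    simp_rw [hω]

/-- Paths are replaced by `0` on a measurable null set containing every `ω` with a discontinuous
path. The new process agrees with the old one at all times simultaneously, almost surely, so
regularized integrals and their limits in probability carry over. -/
theorem IsFBM.exists_continuous_modification {d : ℕ} {X : ℝ≥0 → Ω → EuclideanSpace ℝ (Fin d)}
    (hX : IsFBM H X P) : ∃ X' : ℝ≥0 → Ω → EuclideanSpace ℝ (Fin d), IsFBM H X' P ∧
      (∀ ω, Continuous fun t ↦ X' t ω) ∧ ∀ᵐ ω ∂P, ∀ t, X' t ω = X t ω := by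
  classical
  have h0 : ∀ᵐ ω ∂P, ∀ i, Continuous fun t ↦ X t ω i :=
    ae_all_iff.2 fun i ↦ (hX.component i).continuous_paths
  set N := toMeasurable P {ω | ¬ ∀ i, Continuous fun t ↦ X t ω i} with hN
  have hN0 : P N = 0 := by
    rw [hN, measure_toMeasurable]
    exact h0
  have hNm : MeasurableSet N := measurableSet_toMeasurable _ _
  have hNc : ∀ ω, ω ∉ N → Continuous fun t ↦ X t ω := fun ω hω ↦ by
    have h1 : ∀ i, Continuous fun t ↦ X t ω i := by
      by_contra h
      exact hω (subset_toMeasurable _ _ h)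
    exact (PiLp.continuous_toLp 2 _).comp (continuous_pi h1)
  have heq : ∀ᵐ ω ∂P, ∀ t, Nᶜ.indicator (X t) ω = X t ω := by
    filter_upwards [measure_eq_zero_iff_ae_notMem.1 hN0] with ω hω t
    exact Set.indicator_of_mem (Set.mem_compl hω) _
  refine ⟨fun t ↦ Nᶜ.indicator (X t), hX.congr
    (fun t ↦ (hX.measurable t).indicator hNm.compl) heq, fun ω ↦ ?_, heq⟩
  by_cases hω : ω ∈ N
  · have h1 : ∀ t, Nᶜ.indicator (X t) ω = 0 := fun t ↦
      Set.indicator_of_notMem (Set.notMem_compl_iff.2 hω) _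
    simp_rw [h1]
    exact continuous_const
  · have h1 : ∀ t, Nᶜ.indicator (X t) ω = X t ω := fun t ↦
      Set.indicator_of_mem (Set.mem_compl hω) _
    simp_rw [h1]
    exact hNc ω hω

theorem IsForwardIntegral.congr {d : ℕ} {X X' : ℝ≥0 → Ω → EuclideanSpace ℝ (Fin d)}
    (h : ∀ᵐ ω ∂P, ∀ t, X' t ω = X t ω) {T : ℝ}
    {φ : EuclideanSpace ℝ (Fin d) → EuclideanSpace ℝ (Fin d)} {Y : Ω → ℝ}
    (hY : IsForwardIntegral P X' T φ Y) : IsForwardIntegral P X T φ Y :=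
  ⟨hY.1, hY.2.congr' (Eventually.of_forall fun ε ↦ by
    filter_upwards [h] with ω hω using forwardApprox_congr hω T ε φ) EventuallyEq.rfl⟩

theorem IsForwardIntegral.ae_unique {d : ℕ} {X : ℝ≥0 → Ω → EuclideanSpace ℝ (Fin d)} {T : ℝ}
    {φ : EuclideanSpace ℝ (Fin d) → EuclideanSpace ℝ (Fin d)} {Y Y' : Ω → ℝ}
    (hY : IsForwardIntegral P X T φ Y) (hY' : IsForwardIntegral P X T φ Y') : Y =ᵐ[P] Y' :=
  tendstoInMeasure_ae_unique hY.2 hY'.2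

end Modification

end FBMCurrent

theorem mainTheorem7 {Ω : Type*} [MeasurableSpace Ω] (P : Measure Ω) [IsProbabilityMeasure P]
    (d : ℕ) (hd : 1 ≤ d) (H : ℝ) (hH : 1 / 2 ≤ H) (hH1 : H < 1) (T : ℝ) (hT : 0 < T)
    (X : ℝ≥0 → Ω → EuclideanSpace ℝ (Fin d)) (hX : FBMCurrent.IsFBM H X P) :
    (∀ φ : 𝓢(EuclideanSpace ℝ (Fin d), EuclideanSpace ℝ (Fin d)), HasCompactSupport φ →
      ∃ Y : Ω → ℝ, FBMCurrent.IsForwardIntegral P X T φ Y) ∧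
    ∀ α : ℝ, (d : ℝ) / 2 - 1 + 1 / (2 * H) < α → FBMCurrent.HasPathwiseRedefinition P X T α := by
  obtain ⟨X', hX', hc, hXX'⟩ := hX.exists_continuous_modification
  refine ⟨fun φ _ ↦ ?_, fun α hα ↦ ?_⟩
  · obtain ⟨W, -, hW⟩ := hX'.exists_isForwardIntegral hH hH1 hc hT.le (lt_add_one _)
    exact ⟨_, (hW φ).congr hXX'⟩
  · obtain ⟨W, hWm, hW⟩ := hX'.exists_isForwardIntegral hH hH1 hc hT.le hα
    exact ⟨fun ω ↦ FBMCurrent.functionalOfBessel d α (FBMCurrent.realFourierInv d (W ω)),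
      fun ω ↦ FBMCurrent.currentOfFourier d α (W ω),
      (((FBMCurrent.functionalOfBessel d α).continuous.comp
        (FBMCurrent.realFourierInv d).continuous).comp_stronglyMeasurable hWm).measurable,
      (FBMCurrent.continuous_currentOfFourier.comp_stronglyMeasurable hWm).measurable,
      fun ω ↦ FBMCurrent.represents_currentOfFourier (W ω),
      -- Any version `Y` of the forward integral agrees almost surely with the one built from `W`,
      -- by uniqueness of limits in probability.
      fun φ _ Y hY ↦ hY.ae_unique ((hW φ).congr hXX')⟩
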